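/- **Setting.** Let the base stations (BSs) form a homogeneous Poisson point process in $\mathbb R^2$ of density $\lambda_{\mathrm{BS}}>0$, let the target be at a fixed point, and let $R_1<R_2<\cdots$ be the ordered distances of the BSs from the target; the nearest BS, at distance $R_1$, is the sensing BS. Given the BS locations, independently over all BSs and all marks, a BS at distance $r$ from the target has a line-of-sight link to it with probability $p_{\mathrm{LOS}}(r)=e^{-\eta_b r}$ ($\eta_b>0$), illuminates it with one of its $N_b\ge 1$ non-overlapping beams of width $\theta_b>0$ with probability $\frac{N_b\theta_b}{2\pi}\le 1$, and sees a bistatic radar cross section that is exponential with mean $\sigma_{\mathrm{av,bi}}>0$. Let $\Phi_{I_T}$ be the set of BSs that illuminate the target over line-of-sight, a thinned process of intensity $\lambda_{\mathrm{BS}}\,p_{\mathrm{LOS}}(r)\frac{N_b\theta_b}{2\pi}$, and write $R_i$, $\sigma_{b,i}$ for the distance and the cross section of its members. Let $N_c\ge 1$, $\alpha_L>0$, $P_s\ge 0$, $G_m,\lambda>0$. For $r_1>0$ and $D\subseteq[0,\infty)$ put $$I(r_1,D)=\frac{P_sG_m^2\lambda^2}{(4\pi)^3r_1^{\alpha_L}}\sum_{i\in\Phi_{I_T},\,R_i\in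 D}\sigma_{b,i}R_i^{-\alpha_L},\qquad \ell_{r_1,s}(r)=1-\frac{1}{1+s\frac{P_sG_m^2\lambda^2\sigma_{\mathrm{av,bi}}}{(4\pi)^3r_1^{\alpha_L}r^{\alpha_L}}},$$ $$g_{r_1,s}(\rho)=\exp\Big(-\lambda_{\mathrm{BS}}N_b\theta_b\int_\rho^\infty p_{\mathrm{LOS}}(r)\,\ell_{r_1,s}(r)\,r\,dr\Big),$$ $$f_{r_1}(\rho)=\frac{2(\pi\lambda_{\mathrm{BS}})^{N_c}}{(N_c-1)!}(\rho^2-r_1^2)^{N_c-1}\rho\,e^{-\pi\lambda_{\mathrm{BS}}(\rho^2-r_1^2)}\quad(\rho\ge r_1),\qquad f_{r_1}(\rho)=0\quad(\rho<r_1).$$ **Lemma.** Almost surely $0<R_1<R_{N_c+1}$ and the sums over $R_i\ge\rho$ converge for every $\rho>0$; $R_1$, $R_{N_c+1}$ and the interferences $I(R_1,(R_{N_c+1},\infty))$ and $I(R_1,[R_{N_c+1},\infty))$ are random variables. Moreover: 1. The conditional law of the exclusion radius $R_{N_c+1}$ given $R_1=r_1$ has density $f_{r_1}$, for almost every $r_1$.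 2. For all $r_1,\rho>0$ and $s\ge0$, $\mathbb E\big[e^{-sI(r_1,[\rho,\infty))}\big]=g_{r_1,s}(\rho)$. 3. The target-reflected interference $I_T=I(R_1,(R_{N_c+1},\infty))$ of the BSs outside the exclusion disc of radius $R_{N_c+1}$ around the target has, given $R_1=r_1$, the Laplace transform $$\mathcal L_{I_T}(s)=\int_{r_1}^\infty \exp\Big(-\lambda_{\mathrm{BS}}N_b\theta_b\int_\rho^\infty p_{\mathrm{LOS}}(r)\Big(1-\frac{1}{1+s\frac{P_sG_m^2\lambda^2\sigma_{\mathrm{av,bi}}}{(4\pi)^3r_1^{\alpha_L}r^{\alpha_L}}}\Big)r\,dr\Big)f_{r_1}(\rho)\,d\rho\qquad\text{for all } s\ge0,$$ for almost every $r_1$. 4. If the $(N_c+1)$-th nearest BS, which lies on the rim of that disc, is also counted as an interferer when it belongs to $\Phi_{I_T}$, i.e. for $I_T'=I(R_1,[R_{N_c+1},\infty))$, then for almost every $r_1$ and all $s\ge 0$, given $R_1=r_1$, $$\mathcal L_{I_T'}(s)=\int_{r_1}^\infty\Big(1-\tfrac{N_b\theta_b}{2\pi}\,p_{\mathrm{LOS}}(\rho)\,\ell_{r_1,s}(\rho)\Big)\,g_{r_1,s}(\rho)\,f_{r_1}(\rho)\,d\rho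 .$$ -/

import Mathlib

open MeasureTheory ProbabilityTheory Set

noncomputable section

namespace ISAC

/-- The Euclidean plane. -/
abbrev Plane : Type := EuclideanSpace ℝ (Fin 2)

/-! ### Poisson point processes and independent marking -/

/-- The number of points of the (enumerated) point process `X` that lie in `B`. -/
def pointCount {Ω E : Type*} (X : ℕ → Ω → E) (B : Set E) (ω : Ω) : ℕ∞ :=
  {i : ℕ | X i ω ∈ B}.encard

/-- The random points `X 0, X 1, …` (in any order) form a Poisson point process with intensity
measure `Λ`: the number of points in a measurable set `B` with `Λ B < ∞` is Poisson with mean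
`Λ B`, and the numbers of points in pairwise disjoint such sets are independent. -/
structure IsPoissonPointProcess {Ω E : Type*} [MeasurableSpace Ω] [MeasurableSpace E]
    (μ : Measure Ω) (Λ : Measure E) (X : ℕ → Ω → E) : Prop where
  measurable : ∀ i, Measurable (X i)
  count_law : ∀ B : Set E, MeasurableSet B → Λ B ≠ ⊤ → ∀ n : ℕ,
    μ {ω | pointCount X B ω = n} = poissonMeasure (Λ B).toNNReal {n}
  count_indep : ∀ (k : ℕ) (B : Fin k → Set E), (∀ j, MeasurableSet (B j)) →
    (∀ j, Λ (B j) ≠ ⊤) → Pairwise (fun j l => Disjoint (B j) (B l)) →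
    iIndepFun (fun j ω => pointCount X (B j) ω) μ

/-- Independent marking: conditionally on the whole sequence of points, the marks `M 0, M 1, …`
are independent and the mark of a point located at `x` has law `K x`. -/
structure IsIndependentMarking {Ω E S : Type*} [MeasurableSpace Ω] [MeasurableSpace E]
    [MeasurableSpace S] (μ : Measure Ω) (X : ℕ → Ω → E) (K : E → Measure S)
    (M : ℕ → Ω → S) : Prop where
  measurable : ∀ i, Measurable (M i)
  joint_law : ∀ (A : Set (ℕ → E)), MeasurableSet A → ∀ (J : Finset ℕ) (B : ℕ → Set S),
    (∀ i, MeasurableSet (B i)) →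
    μ {ω | (fun i => X i ω) ∈ A ∧ ∀ i ∈ J, M i ω ∈ B i} =
      ∫⁻ ω in {ω | (fun i => X i ω) ∈ A}, ∏ i ∈ J, K (X i ω) (B i) ∂μ

/-- The distance from `t` to the `n`-th nearest point of the point process `X` (for `n ≥ 1`):
the smallest radius for which the closed disc around `t` holds at least `n` points. -/
def nthDist {Ω : Type*} (X : ℕ → Ω → Plane) (t : Plane) (n : ℕ) (ω : Ω) : ℝ :=
  sInf {r : ℝ | 0 ≤ r ∧ (n : ℕ∞) ≤ pointCount X (Metric.closedBall t r) ω}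

/-! ### The sensing network -/

/-- The parameters of the network. -/
structure Params where
  /-- density of the base stations -/
  lamBS : ℝ
  /-- number of beams of each base station -/
  Nb : ℕ
  /-- beamwidth -/
  thetaB : ℝ
  /-- blockage constant in the line-of-sight probability -/
  etaB : ℝ
  /-- line-of-sight path-loss exponent -/
  alphaL : ℝ
  /-- sensing power -/
  Ps : ℝ
  /-- antenna gain -/
  Gm : ℝ
  /-- wavelength -/
  wavelength : ℝ
  /-- mean bistatic radar cross section -/
  sigmaAv : ℝ
  lamBS_pos : 0 < lamBS
  Nb_pos : 0 < Nb
  thetaB_pos : 0 < thetaB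
  /-- the beams of one base station do not overlap -/
  beams_le : Nb * thetaB ≤ 2 * Real.pi
  etaB_pos : 0 < etaB
  alphaL_pos : 0 < alphaL
  Ps_nonneg : 0 ≤ Ps
  Gm_pos : 0 < Gm
  wavelength_pos : 0 < wavelength
  sigmaAv_pos : 0 < sigmaAv

/-- The probability that a link of length `r` is line-of-sight. -/
def losProb (p : Params) (r : ℝ) : ℝ := Real.exp (-p.etaB * r)

/-- The probability that one of the beams of a base station illuminates the target. -/
def beamProb (p : Params) : ℝ := p.Nb * p.thetaB / (2 * Real.pi)

/-- The marks of a base station: whether its link to the target is line-of-sight, whether one of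
its beams illuminates the target, and the bistatic radar cross section of the target that it
sees. -/
abbrev Mark : Type := Bool × Bool × ℝ

/-- The law of the marks of a base station at `x`, for a target at `t`: the three marks are
independent, the first two Bernoulli with parameters `losProb p (dist x t)` and `beamProb p`, the
third exponential with mean `sigmaAv`. (Both parameters lie in `[0, 1]`, so that `projIcc`
changes nothing.) -/
def markLaw (p : Params) (t x : Plane) : Measure Mark :=
  (bernoulliMeasure true false (projIcc (0 : ℝ) 1 zero_le_one (losProb p (dist x t)))).prod
    ((bernoulliMeasure true false (projIcc (0 : ℝ) 1 zero_le_one (beamProb p))).prod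
      (expMeasure p.sigmaAv⁻¹))

/-- The contribution `σᵢ Rᵢ ^ (-α)` of base station `i`, if it has a line-of-sight link to the
target, illuminates the target, and its distance from the target lies in `D`; else `0`. -/
def echoTerm {Ω : Type*} (p : Params) (t : Plane) (X : ℕ → Ω → Plane) (M : ℕ → Ω → Mark)
    (D : Set ℝ) (i : ℕ) (ω : Ω) : ℝ :=
  open Classical in
  if (M i ω).1 = true ∧ (M i ω).2.1 = true ∧ dist (X i ω) t ∈ D then
    (M i ω).2.2 * dist (X i ω) t ^ (-p.alphaL)
  else 0

/-- The power that a sensing base station at distance `r₁` from the target receives through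
reflections at the target from the illuminating line-of-sight base stations whose distance from
the target lies in `D`. -/
def reflectedPower {Ω : Type*} (p : Params) (t : Plane) (X : ℕ → Ω → Plane)
    (M : ℕ → Ω → Mark) (r₁ : ℝ) (D : Set ℝ) (ω : Ω) : ℝ :=
  p.Ps * p.Gm ^ 2 * p.wavelength ^ 2 / ((4 * Real.pi) ^ 3 * r₁ ^ p.alphaL) *
    ∑' i, echoTerm p t X M D i ω

/-- Target-reflected interference from the illuminating line-of-sight base stations in the
exterior of the exclusion disc, whose radius is the distance `R_{Nc+1}` from the target to its
`(Nc+1)`-th nearest base station. -/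
def interferenceExterior {Ω : Type*} (p : Params) (t : Plane) (Nc : ℕ) (X : ℕ → Ω → Plane)
    (M : ℕ → Ω → Mark) (ω : Ω) : ℝ :=
  reflectedPower p t X M (nthDist X t 1 ω) (Ioi (nthDist X t (Nc + 1) ω)) ω

/-- The same interference with the base station on the rim of the exclusion disc, the
`(Nc+1)`-th nearest one, counted as an interferer (if it illuminates the target over
line-of-sight). -/
def interferenceWithRim {Ω : Type*} (p : Params) (t : Plane) (Nc : ℕ) (X : ℕ → Ω → Plane)
    (M : ℕ → Ω → Mark) (ω : Ω) : ℝ :=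
  reflectedPower p t X M (nthDist X t 1 ω) (Ici (nthDist X t (Nc + 1) ω)) ω

/-! ### The explicit expressions -/

/-- `1 - 1 / (1 + s Pₛ Gₘ² λ² σ_av / ((4π)³ r₁^α r^α))`. -/
def lossFactor (p : Params) (r₁ s r : ℝ) : ℝ :=
  1 - 1 / (1 + s * (p.Ps * p.Gm ^ 2 * p.wavelength ^ 2 * p.sigmaAv /
    ((4 * Real.pi) ^ 3 * r₁ ^ p.alphaL * r ^ p.alphaL)))

/-- The generating functional of the interferers at distance at least `ρ` from the target. -/
def pgflFactor (p : Params) (r₁ s ρ : ℝ) : ℝ :=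
  Real.exp (-(p.lamBS * p.Nb * p.thetaB *
    ∫ r in Ioi ρ, losProb p r * lossFactor p r₁ s r * r))

/-- The density of `R_{Nc+1}` given `R_1 = r₁`. -/
def condDensity (p : Params) (Nc : ℕ) (r₁ ρ : ℝ) : ℝ :=
  open Classical in
  if r₁ ≤ ρ then
    2 * (Real.pi * p.lamBS) ^ Nc / (Nat.factorial (Nc - 1)) * (ρ ^ 2 - r₁ ^ 2) ^ (Nc - 1) * ρ *
      Real.exp (-(Real.pi * p.lamBS * (ρ ^ 2 - r₁ ^ 2)))
  else 0

/-- The explicit Laplace transform: the generating functional averaged over the exclusion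
radius. -/
def explicitLT (p : Params) (Nc : ℕ) (r₁ s : ℝ) : ℝ :=
  ∫ ρ in Ioi r₁, pgflFactor p r₁ s ρ * condDensity p Nc r₁ ρ

/-- The explicit Laplace transform with the additional factor for a base station on the rim of
the exclusion disc. -/
def explicitLTWithRim (p : Params) (Nc : ℕ) (r₁ s : ℝ) : ℝ :=
  ∫ ρ in Ioi r₁, (1 - beamProb p * losProb p ρ * lossFactor p r₁ s ρ) *
    pgflFactor p r₁ s ρ * condDensity p Nc r₁ ρ

end ISAC

end

/-! Three facts about the base stations carry the result. (a) The Laplace functional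
`IsPoissonPointProcess.lintegral_expNeg_pointSum`: the expectation of `exp (-∑ f (Xᵢ))` is `exp (-∫
(1 - exp (-f)) dΛ)`. For a multiple of an indicator it is the generating function of a Poisson
variable; independence on disjoint sets and monotone limits extend it to all measurable `f ≥ 0`. (b)
Marks are independent given the points, so they can be integrated out one by one
(`IsIndependentMarking.lintegral_mul_expNeg_tsum`). The two Bernoulli marks and the exponential
cross section turn `exp (-c · echo)` into `1 - markLoss = exp (-markCost)`, and the random sum of
echoes becomes a sum of a deterministic radial function over the points. (c) A spatial strong Markov
property, `IsPoissonPointProcess.lintegral_radialTail_nthDist`: given `R₁` and `Rₙ`, the points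
beyond `Rₙ` are still Poisson. The radius `Rₙ` is rounded up to a dyadic grid; on the event that the
rounded value is `ρ`, both distances are functions of the points within `ρ`, which are independent
of those beyond `ρ`. Then the grid is refined.

The joint law of `(R₁, R_{Nc+1})` comes from void and annulus counts: `R₁ > a` and `Rₙ > b` say that
the disc of radius `a` is empty and the annulus up to `b` holds fewer than `n` points. The
derivative of the Poisson distribution function in its mean telescopes, so this survival function is
that of the density in the statement (`IsPoissonPointProcess.map_nthDist_one`).

Averaging the exponential from (a) to (c) over the conditional law of the exclusion radius gives the
Laplace transform. With the rim included, almost surely exactly one point lies on it, and it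
contributes one extra factor. Testing against indicators of `R₁` identifies the conditional law for
each `s`; rational `s`, with continuity on one side and monotonicity on the other, give one null set
for all `s`.

Sums and exponentials are handled in `[0, ∞]` with `exp (-∞) = 0`, so convergence is not needed
beforehand. It is derived: the Laplace transform of the total echo tends to `1` as its argument
tends to `0`. -/

noncomputable section

namespace ISAC

open Filter Topology
open scoped ENNReal

/-! ### The function `x ↦ exp (-x)` on `[0, ∞]` -/

/-- `exp (-x)` for an extended nonnegative real `x`, with `exp (-∞) = 0`. -/
def expNeg (x : ℝ≥0∞) : ℝ≥0∞ := EReal.exp (-(x : EReal))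

@[simp] lemma expNeg_zero : expNeg 0 = 1 := by simp [expNeg]

@[simp] lemma expNeg_top : expNeg ∞ = 0 := by simp [expNeg]

lemma expNeg_ofReal {a : ℝ} (ha : 0 ≤ a) :
    expNeg (ENNReal.ofReal a) = ENNReal.ofReal (Real.exp (-a)) := by
  rw [expNeg, EReal.coe_ennreal_ofReal, max_eq_left ha, ← EReal.coe_neg, EReal.exp_coe]

lemma expNeg_of_ne_top {x : ℝ≥0∞} (hx : x ≠ ∞) :
    expNeg x = ENNReal.ofReal (Real.exp (-x.toReal)) := by
  conv_lhs => rw [← ENNReal.ofReal_toReal hx]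
  exact expNeg_ofReal ENNReal.toReal_nonneg

lemma expNeg_add (x y : ℝ≥0∞) : expNeg (x + y) = expNeg x * expNeg y := by
  rcases eq_or_ne x ∞ with rfl | hx
  · simp
  rcases eq_or_ne y ∞ with rfl | hy
  · simp
  rw [expNeg_of_ne_top (ENNReal.add_ne_top.2 ⟨hx, hy⟩), expNeg_of_ne_top hx, expNeg_of_ne_top hy,
    ← ENNReal.ofReal_mul (Real.exp_nonneg _), ← Real.exp_add, ENNReal.toReal_add hx hy, neg_add]

lemma expNeg_sum {ι : Type*} (s : Finset ι) (f : ι → ℝ≥0∞) :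
    expNeg (∑ i ∈ s, f i) = ∏ i ∈ s, expNeg (f i) := by
  classical
  induction s using Finset.induction_on with
  | empty => simp
  | insert a s ha ih => rw [Finset.sum_insert ha, Finset.prod_insert ha, expNeg_add, ih]

lemma continuous_expNeg : Continuous expNeg :=
  ENNReal.continuous_exp.comp (continuous_neg.comp continuous_coe_ennreal_ereal)

lemma measurable_expNeg : Measurable expNeg := continuous_expNeg.measurable

lemma antitone_expNeg : Antitone expNeg := fun _ _ h =>
  EReal.exp_monotone (EReal.neg_le_neg_iff.2 (EReal.coe_ennreal_le_coe_ennreal_iff.2 h))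

lemma expNeg_le_one (x : ℝ≥0∞) : expNeg x ≤ 1 := by
  simpa using antitone_expNeg (zero_le (a := x))

lemma expNeg_natCast_mul (n : ℕ) (c : ℝ≥0∞) : expNeg (n * c) = expNeg c ^ n := by
  have := expNeg_sum (Finset.range n) (fun _ => c)
  simpa using this

/-! ### Counting points -/

section Points

variable {Ω E : Type*}

/-- The sum of `f` over the points of the point process `X`. -/
def pointSum (X : ℕ → Ω → E) (f : E → ℝ≥0∞) (ω : Ω) : ℝ≥0∞ := ∑' i, f (X i ω)

lemma toENNReal_pointCount (X : ℕ → Ω → E) (B : Set E) (ω : Ω) :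
    (pointCount X B ω : ℝ≥0∞) = pointSum X (B.indicator 1) ω := by
  rw [pointCount, ← ENNReal.tsum_set_one, tsum_subtype {i | X i ω ∈ B} fun _ => (1 : ℝ≥0∞),
    pointSum]
  exact tsum_congr fun i => rfl

lemma pointSum_indicator_const (X : ℕ → Ω → E) (B : Set E) (c : ℝ≥0∞) (ω : Ω) :
    pointSum X (B.indicator fun _ => c) ω = pointCount X B ω * c := by
  rw [toENNReal_pointCount, pointSum, pointSum, ← ENNReal.tsum_mul_right]
  refine tsum_congr fun i => ?_
  by_cases h : X i ω ∈ B <;> simp [h]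

lemma pointCount_mono (X : ℕ → Ω → E) {A B : Set E} (h : A ⊆ B) (ω : Ω) :
    pointCount X A ω ≤ pointCount X B ω :=
  Set.encard_le_encard fun _ hi => h hi

/-- The points of `⋃ i, B i` with prescribed membership in each of the sets `B i`. -/
def atomSet {ι : Type*} (B : ι → Set E) (c : ι → Prop) : Set E :=
  {x | (∃ i, x ∈ B i) ∧ ∀ i, x ∈ B i ↔ c i}

lemma disjoint_atomSet {ι : Type*} (A : ι → Set E) (c d : ι → Prop) (hcd : c ≠ d) :
    Disjoint (atomSet A c) (atomSet A d) := by
  refine Set.disjoint_left.2 fun x hx hx' => hcd (funext fun i => propext ?_)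
  rw [← hx.2 i, hx'.2 i]

-- Poisson independence is given for pairwise disjoint sets only, whereas the σ-algebra of a region
-- is generated by counts of overlapping sets. Writing counts as sums over the atoms of a finite
-- family bridges the two.
open Classical in
lemma pointCount_eq_sum_atomSet {ι : Type*} [Fintype ι] (X : ℕ → Ω → E) (B : ι → Set E) (i : ι)
    (ω : Ω) :
    pointCount X (B i) ω = ∑ c : ι → Prop, if c i then pointCount X (atomSet B c) ω else 0 := by
  rw [← ENat.toENNReal_inj]
  have hsum : ((∑ c : ι → Prop, if c i then pointCount X (atomSet B c) ω else 0 : ℕ∞) : ℝ≥0∞) =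
      ∑ c : ι → Prop, ((if c i then pointCount X (atomSet B c) ω else 0 : ℕ∞) : ℝ≥0∞) :=
    map_sum ENat.toENNRealRingHom _ _
  rw [hsum, toENNReal_pointCount]
  have : ∀ c : ι → Prop, ((if c i then pointCount X (atomSet B c) ω else 0 : ℕ∞) : ℝ≥0∞) =
      ∑' j, if c i then (atomSet B c).indicator 1 (X j ω) else 0 := by
    intro c
    split_ifs
    · exact toENNReal_pointCount _ _ _
    · simp
  simp_rw [this]
  rw [pointSum, ← Summable.tsum_finsetSum fun _ _ => ENNReal.summable]
  refine tsum_congr fun j => ?_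
  -- The point `X j ω` can only lie in the atom of its own membership pattern.
  rw [Finset.sum_eq_single (fun l => X j ω ∈ B l)]
  · by_cases h : X j ω ∈ B i
    · have : X j ω ∈ atomSet B fun l => X j ω ∈ B l := ⟨⟨i, h⟩, fun _ => Iff.rfl⟩
      simp [h, this]
    · simp [h]
  · intro c _ hc
    have : X j ω ∉ atomSet B c := fun h => hc (funext fun l => propext (h.2 l).symm)
    simp [this]
  · simp

variable [MeasurableSpace Ω] [MeasurableSpace E]

lemma measurable_pointSum {X : ℕ → Ω → E} (hX : ∀ i, Measurable (X i)) {f : E → ℝ≥0∞}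
    (hf : Measurable f) : Measurable (pointSum X f) :=
  Measurable.tsum fun i => hf.comp (hX i)

lemma measurable_of_toENNReal {f : Ω → ℕ∞} (hf : Measurable fun ω => (f ω : ℝ≥0∞)) :
    Measurable f := by
  refine measurable_to_countable' fun n => ?_
  have : f ⁻¹' {n} = (fun ω => (f ω : ℝ≥0∞)) ⁻¹' {(n : ℝ≥0∞)} := by
    ext ω; simp
  rw [this]
  exact hf (measurableSet_singleton _)

lemma measurable_pointCount {X : ℕ → Ω → E} (hX : ∀ i, Measurable (X i)) {B : Set E}
    (hB : MeasurableSet B) : Measurable (pointCount X B) := by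
  refine measurable_of_toENNReal ?_
  simp_rw [toENNReal_pointCount]
  exact measurable_pointSum hX (measurable_one.indicator hB)

/-! ### Independence of the process on disjoint sets -/

lemma measurableSet_atomSet {ι : Type*} [Finite ι] {B : ι → Set E} (hB : ∀ i, MeasurableSet (B i))
    (c : ι → Prop) : MeasurableSet (atomSet B c) := by
  have : atomSet B c = (⋃ i, B i) ∩ ⋂ i, {x | x ∈ B i ↔ c i} := by
    ext x; simp [atomSet]
  rw [this]
  refine (MeasurableSet.iUnion hB).inter (MeasurableSet.iInter fun i => ?_)
  by_cases h : c i
  · simpa [h] using hB i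
  · simp only [h, iff_false]
    exact (hB i).compl

/-- This is why `atomSet` asks for membership in at least one set: the atom outside all of them
could have infinite intensity. -/
lemma measure_atomSet_ne_top {ι : Type*} [Fintype ι] {Λ : Measure E} {A : ι → Set E}
    (hA : ∀ i, Λ (A i) ≠ ∞) (c : ι → Prop) : Λ (atomSet A c) ≠ ∞ := by
  refine ne_top_of_le_ne_top (ENNReal.sum_ne_top.2 fun i (_ : i ∈ Finset.univ) => hA i)
    ((measure_mono ?_).trans (measure_iUnion_fintype_le Λ A))
  rintro x ⟨h, _⟩
  exact mem_iUnion.2 h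

lemma IsPoissonPointProcess.iIndepFun_pointCount {μ : Measure Ω} {Λ : Measure E}
    {X : ℕ → Ω → E} (hX : IsPoissonPointProcess μ Λ X) {ι : Type*} [Fintype ι] {B : ι → Set E}
    (hB : ∀ i, MeasurableSet (B i)) (hΛ : ∀ i, Λ (B i) ≠ ∞)
    (hd : Pairwise fun i j => Disjoint (B i) (B j)) :
    iIndepFun (fun i => pointCount X (B i)) μ := by
  have e := Fintype.equivFin ι
  have h := hX.count_indep (Fintype.card ι) (fun k => B (e.symm k)) (fun _ => hB _)
    (fun _ => hΛ _) (fun k l hkl => hd (fun h => hkl (e.symm.injective h)))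
  have := h.precomp e.injective
  simpa using this

/-- The atoms of both families together are pairwise disjoint, so their counts are independent. The
two vectors of counts are functions of two disjoint groups of these. -/
lemma IsPoissonPointProcess.indepFun_pointCount_of_disjoint {μ : Measure Ω} {Λ : Measure E}
    {X : ℕ → Ω → E} (hX : IsPoissonPointProcess μ Λ X) {ι κ : Type*} [Fintype ι] [Fintype κ]
    {A : ι → Set E} {B : κ → Set E} (hA : ∀ i, MeasurableSet (A i)) (hB : ∀ i, MeasurableSet (B i))
    (hΛA : ∀ i, Λ (A i) ≠ ∞) (hΛB : ∀ i, Λ (B i) ≠ ∞) (hd : ∀ i j, Disjoint (A i) (B j)) :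
    IndepFun (fun ω i => pointCount X (A i) ω) (fun ω j => pointCount X (B j) ω) μ := by
  classical
  let G : (ι → Prop) ⊕ (κ → Prop) → Set E := Sum.elim (atomSet A) (atomSet B)
  have hGm : ∀ s, MeasurableSet (G s) := by
    rintro (c | c)
    · exact measurableSet_atomSet hA c
    · exact measurableSet_atomSet hB c
  have hind : iIndepFun (fun s => pointCount X (G s)) μ := by
    refine hX.iIndepFun_pointCount hGm ?_ ?_
    · rintro (c | c)
      · exact measure_atomSet_ne_top hΛA c
      · exact measure_atomSet_ne_top hΛB c
    · have hAB : ∀ c d, Disjoint (atomSet A c) (atomSet B d) := fun c d =>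
        Set.disjoint_left.2 fun x ⟨⟨i, hi⟩, _⟩ ⟨⟨j, hj⟩, _⟩ => Set.disjoint_left.1 (hd i j) hi hj
      rintro (c | c) (d | d) hcd
      · exact disjoint_atomSet A c d fun h => hcd (by rw [h])
      · exact hAB c d
      · exact (hAB d c).symm
      · exact disjoint_atomSet B c d fun h => hcd (by rw [h])
  have h2 := hind.indepFun_finset (Finset.univ.map Function.Embedding.inl)
    (Finset.univ.map Function.Embedding.inr) (by
      rw [Finset.disjoint_left]; simp) (fun s => measurable_pointCount hX.measurable (hGm s))
  let φ : ((s : (Finset.univ.map (Function.Embedding.inl : (ι → Prop) ↪ _ ⊕ (κ → Prop)))) → ℕ∞) →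
      ι → ℕ∞ := fun N i => ∑ c : ι → Prop, if c i then N ⟨Sum.inl c, by simp⟩ else 0
  let ψ : ((s : (Finset.univ.map (Function.Embedding.inr : (κ → Prop) ↪ (ι → Prop) ⊕ _))) → ℕ∞) →
      κ → ℕ∞ := fun N i => ∑ c : κ → Prop, if c i then N ⟨Sum.inr c, by simp⟩ else 0
  have hφ : Measurable φ := by
    refine measurable_pi_lambda _ fun i => Finset.measurable_sum _ fun c _ => ?_
    split_ifs
    · exact measurable_pi_apply _
    · exact measurable_const
  have hψ : Measurable ψ := by
    refine measurable_pi_lambda _ fun i => Finset.measurable_sum _ fun c _ => ?_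
    split_ifs
    · exact measurable_pi_apply _
    · exact measurable_const
  have h3 := h2.comp hφ hψ
  convert h3 using 1
  · ext ω i
    exact pointCount_eq_sum_atomSet X A i ω
  · ext ω i
    exact pointCount_eq_sum_atomSet X B i ω

/-- The `σ`-algebra generated by the numbers of points in the subsets of `V` of finite intensity. -/
@[reducible] def countAlgebra (Λ : Measure E) (X : ℕ → Ω → E) (V : Set E) : MeasurableSpace Ω :=
  MeasurableSpace.comap
    (fun ω (B : {B : Set E // MeasurableSet B ∧ B ⊆ V ∧ Λ B ≠ ∞}) => pointCount X B ω)
    MeasurableSpace.pi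

lemma countAlgebra_le {Λ : Measure E} {X : ℕ → Ω → E} (hX : ∀ i, Measurable (X i)) (V : Set E) :
    countAlgebra Λ X V ≤ ‹MeasurableSpace Ω› :=
  Measurable.comap_le (measurable_pi_lambda _ fun B => measurable_pointCount hX B.2.1)

/-- Independence of two families of variables reduces to finite subfamilies, where the atoms apply.
-/
lemma IsPoissonPointProcess.indep_countAlgebra {μ : Measure Ω} [IsProbabilityMeasure μ]
    {Λ : Measure E} {X : ℕ → Ω → E} (hX : IsPoissonPointProcess μ Λ X) {U V : Set E}
    (hd : Disjoint U V) : Indep (countAlgebra Λ X U) (countAlgebra Λ X V) μ := by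
  refine IndepFun.process_indepFun_process
    (X := fun (B : {B : Set E // MeasurableSet B ∧ B ⊆ U ∧ Λ B ≠ ∞}) ω => pointCount X B ω)
    (Y := fun (B : {B : Set E // MeasurableSet B ∧ B ⊆ V ∧ Λ B ≠ ∞}) ω => pointCount X B ω)
    (fun B => measurable_pointCount hX.measurable B.2.1)
    (fun B => measurable_pointCount hX.measurable B.2.1) fun I J => ?_
  exact hX.indepFun_pointCount_of_disjoint (fun i => i.1.2.1) (fun j => j.1.2.1)
    (fun i => i.1.2.2.2) (fun j => j.1.2.2.2) fun i j =>
      hd.mono i.1.2.2.1 j.1.2.2.1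

end Points

lemma measurable_countAlgebra_pointCount {Ω E : Type*} [MeasurableSpace E] {Λ : Measure E}
    {X : ℕ → Ω → E} {B V : Set E}
    (hB : MeasurableSet B) (hBV : B ⊆ V) (hΛ : Λ B ≠ ∞) :
    Measurable[countAlgebra Λ X V] (pointCount X B) := by
  have h := comap_measurable (m := MeasurableSpace.pi)
    (fun ω (B : {B : Set E // MeasurableSet B ∧ B ⊆ V ∧ Λ B ≠ ∞}) => pointCount X B ω)
  exact (measurable_pi_apply (⟨B, hB, hBV, hΛ⟩ : {B : Set E // MeasurableSet B ∧ B ⊆ V ∧ Λ B ≠ ∞})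
    ).comp h

end ISAC

end

noncomputable section

namespace ISAC

open Filter Topology
open scoped ENNReal

/-! ### The Laplace functional of a Poisson point process -/

section Laplace

variable {Ω E : Type*}

lemma pointSum_add (X : ℕ → Ω → E) (f g : E → ℝ≥0∞) (ω : Ω) :
    pointSum X (f + g) ω = pointSum X f ω + pointSum X g ω :=
  ENNReal.tsum_add

lemma pointSum_mono (X : ℕ → Ω → E) {f g : E → ℝ≥0∞} (h : f ≤ g) (ω : Ω) :
    pointSum X f ω ≤ pointSum X g ω :=
  ENNReal.tsum_le_tsum fun i => h (X i ω)

/-- Monotone convergence for the counting measure on the indices. -/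
lemma pointSum_iSup (X : ℕ → Ω → E) {f : ℕ → E → ℝ≥0∞} (hf : Monotone f) (ω : Ω) :
    pointSum X (fun x => ⨆ n, f n x) ω = ⨆ n, pointSum X (f n) ω := by
  simp only [pointSum, ← lintegral_count]
  exact lintegral_iSup (fun _ => measurable_of_countable _) fun n m h i => hf h (X i ω)

lemma indicator_spanningSets_iSup [MeasurableSpace E] (Λ : Measure E) [SigmaFinite Λ]
    (f : E → ℝ≥0∞) :
    (fun x => ⨆ n, (spanningSets Λ n).indicator f x) = f := by
  ext x
  refine le_antisymm (iSup_le fun n => indicator_le_self _ _ _) ?_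
  refine le_iSup_of_le (spanningSetsIndex Λ x) ?_
  rw [indicator_of_mem (mem_spanningSetsIndex Λ x)]

lemma monotone_indicator_spanningSets [MeasurableSpace E] (Λ : Measure E) [SigmaFinite Λ]
    (f : E → ℝ≥0∞) : Monotone fun n => (spanningSets Λ n).indicator f := fun _ _ h =>
  indicator_le_indicator_of_subset (monotone_spanningSets Λ h) fun _ => zero_le

/-- `countAlgebra` records counts of sets of finite intensity only, so a general set is exhausted by
its intersections with `spanningSets` before passing from indicators to functions. -/
lemma measurable_countAlgebra_pointSum [MeasurableSpace E] (Λ : Measure E) [SigmaFinite Λ]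
    (X : ℕ → Ω → E) {V : Set E} (hV : MeasurableSet V) {f : E → ℝ≥0∞} (hf : Measurable f) :
    Measurable[countAlgebra Λ X V] (pointSum X (V.indicator f)) := by
  refine Measurable.ennreal_induction ?_ ?_ ?_ hf
  · intro c B hB
    have : pointSum X (V.indicator (B.indicator fun _ => c)) = fun ω =>
        ⨆ n, (pointCount X (spanningSets Λ n ∩ (V ∩ B)) ω : ℝ≥0∞) * c := by
      ext ω
      conv_lhs => rw [← indicator_spanningSets_iSup Λ (V.indicator (B.indicator fun _ => c))]
      rw [pointSum_iSup X (monotone_indicator_spanningSets Λ _)]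
      refine iSup_congr fun n => ?_
      rw [indicator_indicator, indicator_indicator, pointSum_indicator_const, inter_assoc]
    rw [this]
    refine Measurable.iSup fun n => Measurable.mul_const ?_ _
    refine (measurable_of_countable (fun n : ℕ∞ => (n : ℝ≥0∞))).comp
      (measurable_countAlgebra_pointCount
        ((measurableSet_spanningSets Λ n).inter (hV.inter hB))
        (inter_subset_right.trans inter_subset_left) ?_)
    exact ne_top_of_le_ne_top (measure_spanningSets_lt_top Λ n).ne (measure_mono inter_subset_left)
  · intro f g _ _ _ hf hg
    rw [show V.indicator (f + g) = V.indicator f + V.indicator g from indicator_add' _ _ _]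
    simp_rw [funext (pointSum_add X (V.indicator f) (V.indicator g))]
    exact hf.add hg
  · intro f hf hm h
    have : V.indicator (fun x => ⨆ n, f n x) = fun x => ⨆ n, V.indicator (f n) x := by
      ext x
      by_cases hx : x ∈ V <;> simp [hx]
    rw [this, funext (pointSum_iSup X (f := fun n => V.indicator (f n)) fun n m hnm x =>
      indicator_le_indicator (hm hnm x))]
    exact Measurable.iSup h

/-- The bound `expNeg ≤ 1` makes the constant `1` a dominating function, so no moment assumption is
needed. The factor `F` will hold test functions of the points. -/
lemma tendsto_lintegral_mul_expNeg [MeasurableSpace Ω] {μ : Measure Ω} [IsFiniteMeasure μ]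
    {F : Ω → ℝ≥0∞} (hF : Measurable F) (hF1 : ∀ ω, F ω ≤ 1) {g : ℕ → Ω → ℝ≥0∞} {G : Ω → ℝ≥0∞}
    (hg : ∀ n, Measurable (g n))
    (h : ∀ᵐ ω ∂μ, Tendsto (fun n => g n ω) atTop (𝓝 (G ω))) :
    Tendsto (fun n => ∫⁻ ω, F ω * expNeg (g n ω) ∂μ) atTop
      (𝓝 (∫⁻ ω, F ω * expNeg (G ω) ∂μ)) := by
  refine tendsto_lintegral_of_dominated_convergence (fun _ => 1)
    (fun n => hF.mul (measurable_expNeg.comp (hg n)))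
    (fun n => Eventually.of_forall fun ω => mul_le_one' (hF1 ω) (expNeg_le_one _)) (by simp) ?_
  filter_upwards [h] with ω hω
  refine ENNReal.Tendsto.const_mul ((continuous_expNeg.tendsto _).comp hω) (Or.inr ?_)
  exact ne_top_of_le_ne_top ENNReal.one_ne_top (hF1 ω)

lemma tendsto_lintegral_expNeg [MeasurableSpace Ω] {μ : Measure Ω} [IsFiniteMeasure μ]
    {g : ℕ → Ω → ℝ≥0∞} {G : Ω → ℝ≥0∞} (hg : ∀ n, Measurable (g n))
    (h : ∀ᵐ ω ∂μ, Tendsto (fun n => g n ω) atTop (𝓝 (G ω))) :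
    Tendsto (fun n => ∫⁻ ω, expNeg (g n ω) ∂μ) atTop (𝓝 (∫⁻ ω, expNeg (G ω) ∂μ)) := by
  simpa using tendsto_lintegral_mul_expNeg (F := fun _ => 1) measurable_const (fun _ => le_rfl) hg h

variable [MeasurableSpace Ω] [MeasurableSpace E] {μ : Measure Ω} [IsProbabilityMeasure μ]
  {Λ : Measure E} {X : ℕ → Ω → E}

/-- The Poisson masses at the natural numbers already sum to `1`, which leaves nothing for `⊤`. -/
lemma IsPoissonPointProcess.ae_pointCount_ne_top (hX : IsPoissonPointProcess μ Λ X) {B : Set E}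
    (hB : MeasurableSet B) (hΛ : Λ B ≠ ∞) : ∀ᵐ ω ∂μ, pointCount X B ω ≠ ⊤ := by
  have h : μ (⋃ n : ℕ, {ω | pointCount X B ω = n}) = 1 := by
    rw [measure_iUnion]
    · rw [tsum_congr (hX.count_law B hB hΛ)]
      have h2 := measure_iUnion (μ := poissonMeasure (Λ B).toNNReal) (f := fun n : ℕ => {n})
        (fun i j hij => Set.disjoint_singleton.2 hij) (fun _ => measurableSet_singleton _)
      rw [← h2, iUnion_of_singleton, measure_univ]
    · intro i j hij
      refine Set.disjoint_left.2 fun ω (h : _ = _) (h' : _ = _) => hij ?_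
      rw [h] at h'
      exact_mod_cast h'
    · intro n
      exact measurable_pointCount hX.measurable hB (measurableSet_singleton _)
  have h' : ∀ᵐ ω ∂μ, ω ∈ ⋃ n : ℕ, {ω | pointCount X B ω = n} := by
    refine (prob_compl_eq_zero_iff (MeasurableSet.iUnion fun n => ?_)).2 h
    exact measurable_pointCount hX.measurable hB (measurableSet_singleton _)
  filter_upwards [h'] with ω hω
  obtain ⟨n, hn⟩ := mem_iUnion.1 hω
  rw [show pointCount X B ω = n from hn]
  exact ENat.natCast_ne_top n

lemma IsPoissonPointProcess.lintegral_pointCount (hX : IsPoissonPointProcess μ Λ X) {B : Set E}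
    (hB : MeasurableSet B) (hΛ : Λ B ≠ ∞) (g : ℕ∞ → ℝ≥0∞) :
    ∫⁻ ω, g (pointCount X B ω) ∂μ =
      ∑' n : ℕ, g n * ENNReal.ofReal
        (Real.exp (-(Λ B).toReal) * (Λ B).toReal ^ n / (n.factorial : ℝ)) := by
  have hm := measurable_pointCount hX.measurable hB
  rw [← lintegral_map (f := g) (measurable_of_countable g) hm, lintegral_countable']
  have h0 : (μ.map (pointCount X B)) {⊤} = 0 := by
    rw [Measure.map_apply hm (measurableSet_singleton _)]
    have h := hX.ae_pointCount_ne_top hB hΛ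
    simp only [ae_iff, not_not] at h
    exact h
  have hinj : Function.Injective (fun n : ℕ => (n : ℕ∞)) := Nat.cast_injective
  rw [← hinj.tsum_eq (f := fun a : ℕ∞ => g a * (μ.map (pointCount X B)) {a})]
  · refine tsum_congr fun n => ?_
    rw [Measure.map_apply hm (measurableSet_singleton _)]
    have := hX.count_law B hB hΛ n
    rw [poissonMeasure_singleton] at this
    exact congrArg _ this
  · intro a ha
    induction a with
    | top => exact absurd (show g ⊤ * _ = 0 by rw [h0, mul_zero]) ha
    | coe n => exact ⟨n, rfl⟩

/-- The Poisson generating function at `q = exp (-c)`: summing `q ^ n` against the weights of mean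
`m` gives `exp (-m (1 - q))`. -/
lemma IsPoissonPointProcess.lintegral_expNeg_pointCount (hX : IsPoissonPointProcess μ Λ X)
    {B : Set E} (hB : MeasurableSet B) (hΛ : Λ B ≠ ∞) (c : ℝ≥0∞) :
    ∫⁻ ω, expNeg (pointCount X B ω * c) ∂μ = expNeg (Λ B * (1 - expNeg c)) := by
  rw [hX.lintegral_pointCount hB hΛ fun n => expNeg (n * c)]
  set m := (Λ B).toReal with hm
  set q := (expNeg c).toReal with hq
  have hq1 : expNeg c ≠ ∞ := ne_top_of_le_ne_top ENNReal.one_ne_top (expNeg_le_one c)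
  have hcq : expNeg c = ENNReal.ofReal q := (ENNReal.ofReal_toReal hq1).symm
  have hq0 : 0 ≤ q := ENNReal.toReal_nonneg
  have hqle : q ≤ 1 := by
    have := ENNReal.toReal_mono ENNReal.one_ne_top (expNeg_le_one c)
    simpa using this
  have hm0 : 0 ≤ m := ENNReal.toReal_nonneg
  have hsum : HasSum (fun n : ℕ => Real.exp (-m) * ((m * q) ^ n / (n.factorial : ℝ)))
      (Real.exp (-m) * Real.exp (m * q)) := by
    have := NormedSpace.expSeries_div_hasSum_exp (m * q)
    rw [← Real.exp_eq_exp_ℝ] at this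
    exact this.mul_left _
  have hterm : ∀ n : ℕ, expNeg (((n : ℕ∞) : ℝ≥0∞) * c) *
      ENNReal.ofReal (Real.exp (-m) * m ^ n / (n.factorial : ℝ)) =
      ENNReal.ofReal (Real.exp (-m) * ((m * q) ^ n / (n.factorial : ℝ))) := by
    intro n
    rw [ENat.toENNReal_coe, expNeg_natCast_mul, hcq, ← ENNReal.ofReal_pow hq0,
      ← ENNReal.ofReal_mul (by positivity)]
    congr 1
    rw [mul_pow]
    ring
  simp_rw [hterm]
  rw [← ENNReal.ofReal_tsum_of_nonneg (fun n => by positivity) hsum.summable, hsum.tsum_eq,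
    ← ENNReal.ofReal_toReal hΛ, ← hm, hcq, ← ENNReal.ofReal_one, ← ENNReal.ofReal_sub _ hq0,
    ← ENNReal.ofReal_mul hm0, expNeg_ofReal (mul_nonneg hm0 (sub_nonneg.2 hqle)), ← Real.exp_add]
  congr 2
  ring

/-- The Laplace functional of a Poisson point process. -/
theorem IsPoissonPointProcess.lintegral_expNeg_pointSum [SigmaFinite Λ]
    (hX : IsPoissonPointProcess μ Λ X) {f : E → ℝ≥0∞} (hf : Measurable f) :
    ∫⁻ ω, expNeg (pointSum X f ω) ∂μ = expNeg (∫⁻ x, (1 - expNeg (f x)) ∂Λ) := by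
  -- Both sides of the formula pass to increasing limits: the left by dominated convergence, the
  -- right by monotone convergence under the integral and continuity of `expNeg`.
  have limit : ∀ {f : ℕ → E → ℝ≥0∞}, (∀ n, Measurable (f n)) → Monotone f →
      (∀ n, ∫⁻ ω, expNeg (pointSum X (f n) ω) ∂μ = expNeg (∫⁻ x, (1 - expNeg (f n x)) ∂Λ)) →
      ∫⁻ ω, expNeg (pointSum X (fun x => ⨆ n, f n x) ω) ∂μ =
        expNeg (∫⁻ x, (1 - expNeg (⨆ n, f n x)) ∂Λ) := by
    intro f hf hm h
    have hlim : ∀ x, Tendsto (fun n => f n x) atTop (𝓝 (⨆ n, f n x)) := fun x =>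
      tendsto_atTop_iSup fun n m hnm => hm hnm x
    have h1 : Tendsto (fun n => ∫⁻ ω, expNeg (pointSum X (f n) ω) ∂μ) atTop
        (𝓝 (∫⁻ ω, expNeg (pointSum X (fun x => ⨆ n, f n x) ω) ∂μ)) := by
      refine tendsto_lintegral_expNeg (fun n => measurable_pointSum hX.measurable (hf n))
        (Eventually.of_forall fun ω => ?_)
      rw [pointSum_iSup X hm]
      exact tendsto_atTop_iSup fun n m hnm => pointSum_mono X (hm hnm) ω
    have h2 : Tendsto (fun n => expNeg (∫⁻ x, (1 - expNeg (f n x)) ∂Λ)) atTop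
        (𝓝 (expNeg (∫⁻ x, (1 - expNeg (⨆ n, f n x)) ∂Λ))) := by
      refine (continuous_expNeg.tendsto _).comp
        (lintegral_tendsto_of_tendsto_of_monotone (fun n =>
          (measurable_const.sub (measurable_expNeg.comp (hf n))).aemeasurable)
          (Eventually.of_forall fun x n m hnm =>
            tsub_le_tsub_left (antitone_expNeg (hm hnm x)) _)
          (Eventually.of_forall fun x => ?_))
      exact ENNReal.Tendsto.sub tendsto_const_nhds ((continuous_expNeg.tendsto _).comp (hlim x))
        (Or.inl ENNReal.one_ne_top)
    simp_rw [h] at h1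
    exact tendsto_nhds_unique h1 h2
  refine Measurable.ennreal_induction ?_ ?_ ?_ hf
  · intro c B hB
    rw [← indicator_spanningSets_iSup Λ (B.indicator fun _ => c)]
    refine limit (fun n => (measurable_const.indicator hB).indicator
      (measurableSet_spanningSets Λ n)) (monotone_indicator_spanningSets Λ _) fun n => ?_
    have hm := (measurableSet_spanningSets Λ n).inter hB
    rw [indicator_indicator]
    simp_rw [pointSum_indicator_const]
    rw [hX.lintegral_expNeg_pointCount hm (ne_top_of_le_ne_top
      (measure_spanningSets_lt_top Λ n).ne (measure_mono inter_subset_left))]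
    congr 1
    have : (fun x => 1 - expNeg ((spanningSets Λ n ∩ B).indicator (fun _ => c) x)) =
        (spanningSets Λ n ∩ B).indicator fun _ => 1 - expNeg c := by
      ext x
      by_cases hx : x ∈ spanningSets Λ n ∩ B <;> simp [hx]
    rw [this, lintegral_indicator_const hm, mul_comm]
  -- Disjoint supports: the two point sums depend on the process on `U` and on its complement, so
  -- the expectation of the product factorizes.
  · intro f g hd hf hg ihf ihg
    set U := Function.support f
    have hU : MeasurableSet U := measurableSet_support hf
    have hfU : U.indicator f = f := indicator_support
    have hgU : Uᶜ.indicator g = g := indicator_eq_self.2 (subset_compl_iff_disjoint_left.2 hd)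
    have hmf := measurable_countAlgebra_pointSum Λ X hU hf
    have hmg := measurable_countAlgebra_pointSum Λ X hU.compl hg
    rw [hfU] at hmf
    rw [hgU] at hmg
    simp_rw [pointSum_add, expNeg_add]
    have hmul := lintegral_mul_eq_lintegral_mul_lintegral_of_independent_measurableSpace
      (countAlgebra_le hX.measurable U) (countAlgebra_le hX.measurable Uᶜ)
      (hX.indep_countAlgebra disjoint_compl_right)
      (measurable_expNeg.comp hmf) (measurable_expNeg.comp hmg)
    simp only [Function.comp_apply] at hmul
    rw [hmul, ihf, ihg, ← expNeg_add, ← lintegral_add_left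
      (f := fun x => 1 - expNeg (f x)) (measurable_const.sub (measurable_expNeg.comp hf))]
    congr 1
    refine lintegral_congr fun x => ?_
    -- At each point at most one of `f` and `g` is nonzero, so `1 - expNeg` is additive there.
    by_cases hx : f x = 0
    · simp [hx]
    · have : g x = 0 := by
        by_contra h
        exact Set.disjoint_left.1 hd hx h
      simp [this]
  · intro f hf hm h
    exact limit hf hm h

end Laplace

end ISAC

end

noncomputable section

namespace ISAC

open Filter Topology
open scoped ENNReal

/-! ### Integrating out independent marks -/

section Marks

variable {Ω E S : Type*} [MeasurableSpace Ω] [MeasurableSpace E] [MeasurableSpace S]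

lemma lintegral_pi_prod {ι : Type*} [Fintype ι] (ν : ι → Measure S)
    [∀ i, IsProbabilityMeasure (ν i)] {q : ι → S → ℝ≥0∞} (hq : ∀ i, Measurable (q i)) :
    ∫⁻ m, ∏ i, q i (m i) ∂Measure.pi ν = ∏ i, ∫⁻ m, q i m ∂ν i := by
  have hind := iIndepFun_pi (μ := ν) (X := q) fun i => (hq i).aemeasurable
  rw [lintegral_prod_eq_prod_lintegral_of_indepFun Finset.univ _ hind
    fun i => (hq i).comp (measurable_pi_apply i)]
  refine Finset.prod_congr rfl fun i _ => ?_
  exact (measurePreserving_eval ν i).lintegral_comp (hq i)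

/-- The law of the first `n` marks given the points. -/
def markKernel (K : Kernel E S) [IsMarkovKernel K] (n : ℕ) : Kernel (ℕ → E) (Fin n → S) where
  toFun x := Measure.pi fun i => K (x i)
  measurable' := by
    refine Measurable.measure_of_isPiSystem_of_isProbabilityMeasure generateFrom_pi.symm
      isPiSystem_pi ?_
    rintro _ ⟨B, hB, rfl⟩
    simp_rw [Measure.pi_pi]
    refine Finset.measurable_prod _ fun i _ => ?_
    exact (K.measurable_coe (hB i trivial)).comp (measurable_pi_apply _)

instance (K : Kernel E S) [IsMarkovKernel K] (n : ℕ) : IsMarkovKernel (markKernel K n) :=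
  ⟨fun x => inferInstanceAs (IsProbabilityMeasure (Measure.pi fun i : Fin n => K (x i)))⟩

variable {μ : Measure Ω} [IsProbabilityMeasure μ] {X : ℕ → Ω → E} {M : ℕ → Ω → S}
  {K : Kernel E S} [IsMarkovKernel K]

/-- The law in `joint_law` determines the measure of rectangles, which form a π-system generating
the product σ-algebra. -/
lemma IsIndependentMarking.map_eq_compProd (hX : ∀ i, Measurable (X i))
    (hM : IsIndependentMarking μ X K M) (n : ℕ) :
    μ.map (fun ω => ((fun i => X i ω), (fun i : Fin n => M i ω))) =
      (μ.map fun ω i => X i ω) ⊗ₘ markKernel K n := by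
  have hXm : Measurable fun ω i => X i ω := measurable_pi_lambda _ hX
  have hMm : Measurable fun ω (i : Fin n) => M i ω :=
    measurable_pi_lambda _ fun i => hM.measurable i
  have : IsProbabilityMeasure (μ.map fun ω i => X i ω) :=
    Measure.isProbabilityMeasure_map hXm.aemeasurable
  have : IsProbabilityMeasure (μ.map (fun ω => ((fun i => X i ω), (fun i : Fin n => M i ω)))) :=
    Measure.isProbabilityMeasure_map (hXm.prodMk hMm).aemeasurable
  refine ext_of_generate_finite _ (generateFrom_eq_prod MeasurableSpace.generateFrom_measurableSet
    (generateFrom_pi (α := fun _ : Fin n => S)) isCountablySpanning_measurableSet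
    (IsCountablySpanning.pi fun _ => isCountablySpanning_measurableSet)).symm
    (MeasurableSpace.isPiSystem_measurableSet.prod isPiSystem_pi) ?_ (by simp)
  rintro _ ⟨A, hA, _, ⟨B, hB, rfl⟩, rfl⟩
  replace hA : MeasurableSet A := hA
  have hB' : MeasurableSet (univ.pi B) := MeasurableSet.univ_pi fun i => hB i trivial
  dsimp only
  rw [Measure.map_apply (hXm.prodMk hMm) (MeasurableSet.prod hA hB'),
    Measure.compProd_apply_prod hA hB', setLIntegral_map hA
      ((markKernel K n).measurable_coe hB') hXm]
  -- `joint_law` takes a family indexed by all of `ℕ`, so `B` is padded with `univ`.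
  have h := hM.joint_law A hA (Finset.range n) (fun i => if h : i < n then B ⟨i, h⟩ else univ) (by
    intro i
    split_ifs with h
    · exact hB _ trivial
    · exact MeasurableSet.univ)
  convert h using 1
  · congr 1
    ext ω
    simp only [mem_preimage, mem_prod, mem_univ_pi, mem_ofPred_eq, Finset.mem_range]
    refine and_congr_right fun _ => ⟨fun h i hi => ?_, fun h i => ?_⟩
    · simpa [hi] using h ⟨i, hi⟩
    · simpa using h i i.2
  · refine lintegral_congr fun ω => ?_
    change Measure.pi _ _ = _
    rw [Measure.pi_pi, Finset.prod_range]
    simp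

/-- Given the points, the first `n` marks have a product law, so the inner integral factorizes. The
factors may depend on the whole configuration, as will be the case when they involve the exclusion
radius. -/
lemma IsIndependentMarking.lintegral_mul_prod (hX : ∀ i, Measurable (X i))
    (hM : IsIndependentMarking μ X K M) {F : (ℕ → E) → ℝ≥0∞} (hF : Measurable F)
    {q : ℕ → (ℕ → E) → S → ℝ≥0∞} (hq : ∀ i, Measurable (Function.uncurry (q i))) (n : ℕ) :
    ∫⁻ ω, F (fun j => X j ω) * ∏ i ∈ Finset.range n, q i (fun j => X j ω) (M i ω) ∂μ =
      ∫⁻ ω, F (fun j => X j ω) *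
        ∏ i ∈ Finset.range n, ∫⁻ m, q i (fun j => X j ω) m ∂K (X i ω) ∂μ := by
  have hXm : Measurable fun ω i => X i ω := measurable_pi_lambda _ hX
  have hMm : Measurable fun ω (i : Fin n) => M i ω :=
    measurable_pi_lambda _ fun i => hM.measurable i
  have hG : Measurable fun z : (ℕ → E) × (Fin n → S) => F z.1 * ∏ i : Fin n, q i z.1 (z.2 i) := by
    refine (hF.comp measurable_fst).mul (Finset.measurable_prod _ fun i _ => ?_)
    exact (hq i).comp (measurable_fst.prodMk ((measurable_pi_apply i).comp measurable_snd))
  have h1 := lintegral_map (μ := μ) hG (hXm.prodMk hMm)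
  rw [hM.map_eq_compProd hX, Measure.lintegral_compProd hG, lintegral_map
    hG.lintegral_kernel_prod_right' hXm] at h1
  simp_rw [Finset.prod_range]
  rw [← h1]
  refine lintegral_congr fun ω => ?_
  dsimp only
  rw [lintegral_const_mul]
  · congr 1
    exact lintegral_pi_prod _ fun i => (hq i).comp measurable_prodMk_left
  · exact Finset.measurable_prod _ fun i _ =>
      (hq i).comp (measurable_prodMk_left.comp (measurable_pi_apply i))

/-- Finitely many marks are integrated out by `lintegral_mul_prod`, each leaving its conditional
Laplace transform `expNeg (h i x)`; dominated convergence then gives the infinite sum. -/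
theorem IsIndependentMarking.lintegral_mul_expNeg_tsum (hX : ∀ i, Measurable (X i))
    (hM : IsIndependentMarking μ X K M) {F : (ℕ → E) → ℝ≥0∞} (hF : Measurable F)
    (hF1 : ∀ x, F x ≤ 1)
    {a : ℕ → (ℕ → E) → S → ℝ≥0∞} (ha : ∀ i, Measurable (Function.uncurry (a i)))
    {h : ℕ → (ℕ → E) → ℝ≥0∞} (hm : ∀ i, Measurable (h i))
    (hah : ∀ i x, ∫⁻ m, expNeg (a i x m) ∂K (x i) = expNeg (h i x)) :
    ∫⁻ ω, F (fun j => X j ω) * expNeg (∑' i, a i (fun j => X j ω) (M i ω)) ∂μ =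
      ∫⁻ ω, F (fun j => X j ω) * expNeg (∑' i, h i (fun j => X j ω)) ∂μ := by
  have hXm : Measurable fun ω i => X i ω := measurable_pi_lambda _ hX
  have key : ∀ n, ∫⁻ ω, F (fun j => X j ω) *
        expNeg (∑ i ∈ Finset.range n, a i (fun j => X j ω) (M i ω)) ∂μ =
      ∫⁻ ω, F (fun j => X j ω) * expNeg (∑ i ∈ Finset.range n, h i (fun j => X j ω)) ∂μ := by
    intro n
    simp_rw [expNeg_sum]
    rw [hM.lintegral_mul_prod hX hF (q := fun i x m => expNeg (a i x m))
      (fun i => measurable_expNeg.comp (ha i))]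
    refine lintegral_congr fun ω => ?_
    congr 1
    exact Finset.prod_congr rfl fun i _ => hah i fun j => X j ω
  have h1 := tendsto_lintegral_mul_expNeg (μ := μ) (hF.comp hXm) (fun ω => hF1 _)
    (g := fun n ω => ∑ i ∈ Finset.range n, a i (fun j => X j ω) (M i ω))
    (fun n => Finset.measurable_sum _ fun i _ => (ha i).comp (hXm.prodMk (hM.measurable i)))
    (Eventually.of_forall fun ω => ENNReal.tendsto_nat_tsum _)
  have h2 := tendsto_lintegral_mul_expNeg (μ := μ) (hF.comp hXm) (fun ω => hF1 _)
    (g := fun n ω => ∑ i ∈ Finset.range n, h i (fun j => X j ω))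
    (fun n => Finset.measurable_sum _ fun i _ => (hm i).comp hXm)
    (Eventually.of_forall fun ω => ENNReal.tendsto_nat_tsum _)
  simp only [Function.comp_apply] at h1 h2
  simp_rw [key] at h1
  exact tendsto_nhds_unique h1 h2

end Marks

end ISAC

end

noncomputable section

namespace ISAC

open Filter Topology
open scoped ENNReal NNReal

/-! ### Ordered distances -/

section Distances

variable {Ω : Type*}

/-- The points are at distinct positive distances from `t`, and finitely many of them lie in each
disc around `t`. -/
structure IsGeneric (X : ℕ → Ω → Plane) (t : Plane) (ω : Ω) : Prop where
  finite : ∀ r : ℝ, pointCount X (Metric.closedBall t r) ω ≠ ⊤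
  injective : Function.Injective fun i => dist (X i ω) t
  ne : ∀ i, X i ω ≠ t

lemma IsGeneric.finite_setOf {X : ℕ → Ω → Plane} {t : Plane} {ω : Ω} (h : IsGeneric X t ω)
    (r : ℝ) : {i | dist (X i ω) t ≤ r}.Finite :=
  Set.encard_ne_top_iff.1 (h.finite r)

/-- Guarantees that the infimum in `nthDist` is over a nonempty set: a disc whose radius is the sum
of the first `n` distances contains the first `n` points. -/
lemma exists_le_pointCount (X : ℕ → Ω → Plane) (t : Plane) (ω : Ω) (n : ℕ) :
    ∃ r : ℝ, 0 ≤ r ∧ (n : ℕ∞) ≤ pointCount X (Metric.closedBall t r) ω := by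
  refine ⟨∑ i ∈ Finset.range n, dist (X i ω) t, Finset.sum_nonneg fun _ _ => dist_nonneg, ?_⟩
  have h : (↑(Finset.range n) : Set ℕ) ⊆
      {i | X i ω ∈ Metric.closedBall t (∑ i ∈ Finset.range n, dist (X i ω) t)} := fun i hi =>
    Finset.single_le_sum (f := fun i => dist (X i ω) t) (fun _ _ => dist_nonneg) hi
  have h2 := Set.encard_le_encard h
  rwa [Set.encard_coe_eq_coe_finsetCard, Finset.card_range] at h2

lemma nthDist_nonneg (X : ℕ → Ω → Plane) (t : Plane) (n : ℕ) (ω : Ω) : 0 ≤ nthDist X t n ω :=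
  Real.sInf_nonneg fun _ h => h.1

lemma nthDist_le {X : ℕ → Ω → Plane} {t : Plane} {n : ℕ} {ω : Ω} {r : ℝ} (hr : 0 ≤ r)
    (h : (n : ℕ∞) ≤ pointCount X (Metric.closedBall t r) ω) : nthDist X t n ω ≤ r :=
  csInf_le ⟨0, fun _ h => h.1⟩ ⟨hr, h⟩

lemma le_pointCount_of_nthDist_lt {X : ℕ → Ω → Plane} {t : Plane} {n : ℕ} {ω : Ω} {r : ℝ}
    (h : nthDist X t n ω < r) : (n : ℕ∞) ≤ pointCount X (Metric.closedBall t r) ω := by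
  obtain ⟨r', hr', hlt⟩ := exists_lt_of_csInf_lt (exists_le_pointCount X t ω n) h
  exact hr'.2.trans (pointCount_mono X (Metric.closedBall_subset_closedBall hlt.le) ω)

/-- The infimum is attained: only finitely many distances lie below `r + 1`, so enlarging `r`
slightly catches no new point. -/
lemma IsGeneric.nthDist_le_iff {X : ℕ → Ω → Plane} {t : Plane} {ω : Ω} (h : IsGeneric X t ω)
    {n : ℕ} {r : ℝ} (hr : 0 ≤ r) :
    nthDist X t n ω ≤ r ↔ (n : ℕ∞) ≤ pointCount X (Metric.closedBall t r) ω := by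
  refine ⟨fun hle => ?_, nthDist_le hr⟩
  have hev : ∀ᶠ r' in 𝓝[>] r, ∀ i ∈ {i | dist (X i ω) t ≤ r + 1},
      dist (X i ω) t ≤ r' → dist (X i ω) t ≤ r := by
    rw [eventually_all_finite (h.finite_setOf (r + 1))]
    intro i _
    by_cases hi : dist (X i ω) t ≤ r
    · exact Eventually.of_forall fun _ _ => hi
    · filter_upwards [mem_nhdsWithin_of_mem_nhds (Iio_mem_nhds (not_le.1 hi))] with r' hr' hle
      exact absurd hle (not_le.2 hr')
  have hev2 : ∀ᶠ r' in 𝓝[>] r, r' < r + 1 :=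
    mem_nhdsWithin_of_mem_nhds (Iio_mem_nhds (by linarith))
  obtain ⟨r', h1, h2, h3⟩ := (hev.and (hev2.and self_mem_nhdsWithin)).exists
  refine (le_pointCount_of_nthDist_lt (hle.trans_lt h3)).trans (Set.encard_le_encard ?_)
  intro i (hi : dist (X i ω) t ≤ r')
  exact h1 i (hi.trans h2.le) hi

/-- If no point had exactly this distance, the finitely many points of the disc would fit into a
smaller one, against minimality. The case `n = 0` is excluded because the infimum is then `0`
without any point there. -/
lemma IsGeneric.exists_dist_eq_nthDist {X : ℕ → Ω → Plane} {t : Plane} {ω : Ω}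
    (h : IsGeneric X t ω) {n : ℕ} (hn : 1 ≤ n) : ∃ i, dist (X i ω) t = nthDist X t n ω := by
  by_contra! hne
  set ρ := nthDist X t n ω with hρ
  have hρ0 : 0 ≤ ρ := nthDist_nonneg X t n ω
  have hC : (n : ℕ∞) ≤ pointCount X (Metric.closedBall t ρ) ω := (h.nthDist_le_iff hρ0).1 le_rfl
  have hpos : 0 < ρ := by
    by_contra hle
    have h0 : ρ = 0 := le_antisymm (not_lt.1 hle) hρ0
    have : {i | X i ω ∈ Metric.closedBall t ρ} = ∅ := by
      ext i
      simp [h0, h.ne i]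
    rw [pointCount, this, Set.encard_empty] at hC
    have : n ≤ 0 := by exact_mod_cast hC
    omega
  have hev : ∀ᶠ r' in 𝓝[<] ρ, ∀ i ∈ {i | dist (X i ω) t ≤ ρ}, dist (X i ω) t ≤ r' := by
    rw [eventually_all_finite (h.finite_setOf ρ)]
    intro i (hi : dist (X i ω) t ≤ ρ)
    filter_upwards [mem_nhdsWithin_of_mem_nhds (Ioi_mem_nhds (lt_of_le_of_ne hi (hne i)))]
      with r' hr' using le_of_lt hr'
  have hev2 : ∀ᶠ r' in 𝓝[<] ρ, 0 < r' := mem_nhdsWithin_of_mem_nhds (Ioi_mem_nhds hpos)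
  obtain ⟨r', h1, h2, h3⟩ := (hev.and (hev2.and self_mem_nhdsWithin)).exists
  have : nthDist X t n ω ≤ r' :=
    nthDist_le h2.le (hC.trans (Set.encard_le_encard fun i hi => h1 i hi))
  exact absurd this (not_le.2 h3)

lemma IsGeneric.nthDist_pos {X : ℕ → Ω → Plane} {t : Plane} {ω : Ω} (h : IsGeneric X t ω)
    {n : ℕ} (hn : 1 ≤ n) : 0 < nthDist X t n ω := by
  obtain ⟨i, hi⟩ := h.exists_dist_eq_nthDist hn
  rw [← hi]
  exact dist_pos.2 (h.ne i)

/-- Otherwise the disc of radius `R₁` would hold two points; both would be at distance exactly `R₁`,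
a tie. -/
lemma IsGeneric.nthDist_one_lt {X : ℕ → Ω → Plane} {t : Plane} {ω : Ω} (h : IsGeneric X t ω)
    {n : ℕ} (hn : 2 ≤ n) : nthDist X t 1 ω < nthDist X t n ω := by
  by_contra hle
  rw [not_lt, h.nthDist_le_iff (nthDist_nonneg _ _ _ _)] at hle
  have h2 : (1 : ℕ∞) < pointCount X (Metric.closedBall t (nthDist X t 1 ω)) ω :=
    lt_of_lt_of_le (by exact_mod_cast hn) hle
  obtain ⟨i, j, hi, hj, hij⟩ := Set.one_lt_encard_iff.1 h2
  have key : ∀ i, nthDist X t 1 ω ≤ dist (X i ω) t := fun i => by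
    refine nthDist_le dist_nonneg ?_
    have : ({i} : Set ℕ) ⊆ {j | X j ω ∈ Metric.closedBall t (dist (X i ω) t)} := by
      simp
    simpa [pointCount] using Set.encard_le_encard this
  have hi' : dist (X i ω) t ≤ _ := hi
  have hj' : dist (X j ω) t ≤ _ := hj
  exact hij (h.injective ((hi'.antisymm (key i)).trans (hj'.antisymm (key j)).symm))

/-- The distance from `t` to the `n`-th nearest point as an extended nonnegative real. -/
def nthEDist (X : ℕ → Ω → Plane) (t : Plane) (n : ℕ) (ω : Ω) : ℝ≥0∞ :=
  ⨅ r : {r : ℝ≥0 // (n : ℕ∞) ≤ pointCount X (Metric.closedBall t r) ω}, ((r : ℝ≥0) : ℝ≥0∞)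

lemma nthDist_eq_toReal (X : ℕ → Ω → Plane) (t : Plane) (n : ℕ) (ω : Ω) :
    nthDist X t n ω = (nthEDist X t n ω).toReal := by
  rw [nthEDist, ENNReal.toReal_iInf fun _ => ENNReal.coe_ne_top, nthDist, iInf]
  congr 1
  ext r
  constructor
  · rintro ⟨h0, h⟩
    exact ⟨⟨⟨r, h0⟩, h⟩, rfl⟩
  · rintro ⟨⟨⟨r, h0⟩, h⟩, rfl⟩
    exact ⟨h0, h⟩

lemma nthEDist_ne_top (X : ℕ → Ω → Plane) (t : Plane) (n : ℕ) (ω : Ω) :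
    nthEDist X t n ω ≠ ∞ := by
  obtain ⟨r, hr, h⟩ := exists_le_pointCount X t ω n
  refine ne_top_of_le_ne_top ENNReal.coe_ne_top
    (iInf_le _ (⟨⟨r, hr⟩, h⟩ : {r : ℝ≥0 // (n : ℕ∞) ≤ pointCount X (Metric.closedBall t r) ω}))

/-- Counts grow with the radius, so rational radii suffice; this makes the distances measurable
through countable unions. -/
lemma nthEDist_lt_iff (X : ℕ → Ω → Plane) (t : Plane) (n : ℕ) (ω : Ω) (a : ℝ≥0∞) :
    nthEDist X t n ω < a ↔ ∃ q : ℚ, 0 ≤ q ∧ ENNReal.ofReal q < a ∧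
      (n : ℕ∞) ≤ pointCount X (Metric.closedBall t q) ω := by
  rw [nthEDist, iInf_lt_iff]
  constructor
  · rintro ⟨⟨r, hr⟩, h⟩
    obtain ⟨q, hq0, hrq, hqa⟩ := ENNReal.lt_iff_exists_rat_btwn.1 h
    have hrq' : (r : ℝ) ≤ q := by
      have : r < Real.toNNReal q := by exact_mod_cast hrq
      exact (Real.lt_toNNReal_iff_coe_lt.1 this).le
    exact ⟨q, hq0, hqa, hr.trans (pointCount_mono X (Metric.closedBall_subset_closedBall hrq') ω)⟩
  · rintro ⟨q, hq0, hqa, h⟩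
    have hq0' : (0 : ℝ) ≤ q := by exact_mod_cast hq0
    refine ⟨⟨Real.toNNReal q, ?_⟩, hqa⟩
    rwa [Real.coe_toNNReal _ hq0']

lemma measurable_nthEDist [MeasurableSpace Ω] {X : ℕ → Ω → Plane} (hX : ∀ i, Measurable (X i))
    (t : Plane) (n : ℕ) : Measurable (nthEDist X t n) := by
  refine measurable_of_Iio fun a => ?_
  have : nthEDist X t n ⁻¹' Iio a = ⋃ q : ℚ, {ω | 0 ≤ q ∧ ENNReal.ofReal q < a ∧
      (n : ℕ∞) ≤ pointCount X (Metric.closedBall t q) ω} := by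
    ext ω
    simp [nthEDist_lt_iff]
  rw [this]
  refine MeasurableSet.iUnion fun q => ?_
  refine (MeasurableSet.const _).inter ((MeasurableSet.const _).inter ?_)
  exact measurable_pointCount hX Metric.isClosed_closedBall.measurableSet
    (MeasurableSet.of_discrete (s := Ici (n : ℕ∞)))

lemma measurable_nthDist [MeasurableSpace Ω] {X : ℕ → Ω → Plane} (hX : ∀ i, Measurable (X i))
    (t : Plane) (n : ℕ) : Measurable (nthDist X t n) := by
  rw [funext (nthDist_eq_toReal X t n)]
  exact (measurable_nthEDist hX t n).ennreal_toReal

/-- Truncated at `ρ`, the `n`-th distance is known from the points within `ρ`: for `a ≤ ρ`, being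
below `a` only involves discs of radius less than `a`. This locality drives the Markov property
outside the exclusion disc. -/
lemma measurable_countAlgebra_min_nthEDist {Λ : Measure Plane} [IsLocallyFiniteMeasure Λ]
    (X : ℕ → Ω → Plane) (t : Plane) (n : ℕ) (ρ : ℝ) :
    Measurable[countAlgebra Λ X (Metric.closedBall t ρ)]
      fun ω => min (nthEDist X t n ω) (ENNReal.ofReal ρ) := by
  let _ := countAlgebra Λ X (Metric.closedBall t ρ)
  refine measurable_of_Iio fun a => ?_
  rcases lt_or_ge (ENNReal.ofReal ρ) a with ha | ha
  · have : (fun ω => min (nthEDist X t n ω) (ENNReal.ofReal ρ)) ⁻¹' Iio a = univ := by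
      ext ω; simp [ha]
    rw [this]
    exact MeasurableSet.univ
  have : (fun ω => min (nthEDist X t n ω) (ENNReal.ofReal ρ)) ⁻¹' Iio a =
      ⋃ q : ℚ, ⋃ _ : 0 ≤ q ∧ ENNReal.ofReal q < a,
        pointCount X (Metric.closedBall t q) ⁻¹' Ici (n : ℕ∞) := by
    ext ω
    simp [nthEDist_lt_iff, not_lt.2 ha, and_assoc]
  rw [this]
  refine MeasurableSet.iUnion fun q => MeasurableSet.iUnion fun hq => ?_
  refine measurable_countAlgebra_pointCount Metric.isClosed_closedBall.measurableSet
    (Metric.closedBall_subset_closedBall ?_) (isCompact_closedBall t (q : ℝ)).measure_lt_top.ne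
    MeasurableSet.of_discrete
  exact ((ENNReal.ofReal_lt_ofReal_iff').1 (hq.2.trans_le ha)).1.le

end Distances

end ISAC

end

/-! ### Poisson tail sums, absence of ties, and the survival function of the ordered distances. -/

noncomputable section

namespace ISAC

open Filter Topology
open scoped ENNReal NNReal

/-- `∑ k < n, exp (-m) m ^ k / k!`, the probability that a Poisson variable with mean `m` is less
than `n`. -/
def poissonBelow (n : ℕ) (m : ℝ) : ℝ :=
  ∑ k ∈ Finset.range n, Real.exp (-m) * m ^ k / (k.factorial : ℝ)

lemma poissonBelow_succ (n : ℕ) (m : ℝ) :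
    poissonBelow (n + 1) m = poissonBelow n m + Real.exp (-m) * m ^ n / (n.factorial : ℝ) :=
  Finset.sum_range_succ _ _

lemma poissonBelow_nonneg (n : ℕ) {m : ℝ} (hm : 0 ≤ m) : 0 ≤ poissonBelow n m :=
  Finset.sum_nonneg fun _ _ => by positivity

@[simp] lemma poissonBelow_one (m : ℝ) : poissonBelow 1 m = Real.exp (-m) := by
  simp [poissonBelow]

lemma poissonBelow_zero_right {n : ℕ} (hn : 1 ≤ n) : poissonBelow n 0 = 1 := by
  obtain ⟨n, rfl⟩ := Nat.exists_eq_add_of_le' hn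
  rw [poissonBelow, Finset.sum_range_succ']
  simp

lemma IsPoissonPointProcess.measure_pointCount_lt {Ω E : Type*} [MeasurableSpace Ω]
    [MeasurableSpace E] {μ : Measure Ω} {Λ : Measure E} {X : ℕ → Ω → E}
    (hX : IsPoissonPointProcess μ Λ X) {B : Set E} (hB : MeasurableSet B)
    (hΛ : Λ B ≠ ∞) (n : ℕ) :
    μ {ω | pointCount X B ω < n} = ENNReal.ofReal (poissonBelow n (Λ B).toReal) := by
  have hset : {ω | pointCount X B ω < n} =
      ⋃ k ∈ Finset.range n, {ω | pointCount X B ω = k} := by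
    ext ω
    simp only [mem_ofPred_eq, mem_iUnion, Finset.mem_range, exists_prop]
    constructor
    · intro h
      obtain ⟨k, hk⟩ := ENat.ne_top_iff_exists.1 h.ne_top
      rw [← hk] at h ⊢
      exact ⟨k, by exact_mod_cast h, rfl⟩
    · rintro ⟨k, hk, h⟩
      rw [h]
      exact_mod_cast hk
  rw [hset, measure_biUnion_finset]
  · rw [poissonBelow, ENNReal.ofReal_sum_of_nonneg fun k _ => by positivity]
    refine Finset.sum_congr rfl fun k _ => ?_
    rw [hX.count_law B hB hΛ, poissonMeasure_singleton]
    rfl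
  · intro i _ j _ hij
    refine Set.disjoint_left.2 fun ω (h : _ = _) (h' : _ = _) => hij ?_
    rw [h] at h'
    exact_mod_cast h'
  · intro k _
    exact measurable_pointCount hX.measurable hB (measurableSet_singleton _)

lemma pointCount_sdiff_of_eq_zero {Ω E : Type*} {X : ℕ → Ω → E} {A B : Set E} {ω : Ω}
    (h : pointCount X A ω = 0) : pointCount X (B \ A) ω = pointCount X B ω := by
  rw [pointCount, Set.encard_eq_zero] at h
  have h' : ∀ i, X i ω ∉ A := fun i hi => by
    have : i ∈ ({i | X i ω ∈ A} : Set ℕ) := hi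
    rw [h] at this
    exact this
  simp [pointCount, h']

section Plane

variable {Ω : Type*} [MeasurableSpace Ω] {μ : Measure Ω} [IsProbabilityMeasure μ] {lam : ℝ}
  {X : ℕ → Ω → Plane}

/-- The intensity of the part of the plane within distance `r`. -/
lemma intensity_closedBall (hlam : 0 ≤ lam) (t : Plane) {r : ℝ} (hr : 0 ≤ r) :
    (ENNReal.ofReal lam • volume : Measure Plane) (Metric.closedBall t r) =
      ENNReal.ofReal (Real.pi * lam * r ^ 2) := by
  rw [Measure.smul_apply, EuclideanSpace.volume_closedBall_fin_two, smul_eq_mul,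
    ← ENNReal.ofReal_pow hr, ← ENNReal.ofReal_mul (by positivity), ← ENNReal.ofReal_mul hlam]
  congr 1
  ring

lemma intensity_annulus (hlam : 0 ≤ lam) (t : Plane) {a b : ℝ} (ha : 0 ≤ a) (hab : a ≤ b) :
    (ENNReal.ofReal lam • volume : Measure Plane) (Metric.closedBall t b \ Metric.closedBall t a) =
      ENNReal.ofReal (Real.pi * lam * (b ^ 2 - a ^ 2)) := by
  rw [measure_sdiff (Metric.closedBall_subset_closedBall hab)
    Metric.isClosed_closedBall.nullMeasurableSet
    (by rw [intensity_closedBall hlam t ha]; exact ENNReal.ofReal_ne_top),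
    intensity_closedBall hlam t ha, intensity_closedBall hlam t (ha.trans hab),
    ← ENNReal.ofReal_sub _ (by positivity)]
  congr 1
  ring

/-- From `exp (-m) ≥ 1 - m` one gets `1 - (1 + m) exp (-m) ≤ 1 - (1 + m)(1 - m) = m²`. The square is
what makes ties negligible. -/
lemma one_sub_poissonBelow_two_le {m : ℝ} (hm : 0 ≤ m) : 1 - poissonBelow 2 m ≤ m ^ 2 := by
  have h1 : 1 - m ≤ Real.exp (-m) := by linarith [Real.add_one_le_exp (-m)]
  have h2 : poissonBelow 2 m = Real.exp (-m) * (1 + m) := by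
    rw [poissonBelow_succ, poissonBelow_one]
    simp
    ring
  rw [h2]
  nlinarith

lemma IsPoissonPointProcess.measure_two_le_pointCount_le {E : Type*} [MeasurableSpace E]
    {Λ : Measure E} {X : ℕ → Ω → E} (hX : IsPoissonPointProcess μ Λ X) {B : Set E}
    (hB : MeasurableSet B) (hΛ : Λ B ≠ ∞) :
    μ {ω | 2 ≤ pointCount X B ω} ≤ Λ B ^ 2 := by
  have hc : {ω | 2 ≤ pointCount X B ω} = {ω | pointCount X B ω < (2 : ℕ)}ᶜ := by
    ext ω
    exact (not_lt (a := pointCount X B ω) (b := 2)).symm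
  have hm : MeasurableSet {ω | pointCount X B ω < (2 : ℕ)} :=
    measurable_pointCount hX.measurable hB (MeasurableSet.of_discrete (s := Iio ((2 : ℕ) : ℕ∞)))
  rw [hc, prob_compl_eq_one_sub hm, hX.measure_pointCount_lt hB hΛ, ← ENNReal.ofReal_one,
    ← ENNReal.ofReal_sub _ (poissonBelow_nonneg 2 ENNReal.toReal_nonneg)]
  refine (ENNReal.ofReal_le_ofReal (one_sub_poissonBelow_two_le ENNReal.toReal_nonneg)).trans ?_
  rw [ENNReal.ofReal_pow ENNReal.toReal_nonneg, ENNReal.ofReal_toReal hΛ]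

/-- A tie puts two points into one of `n` annuli of equal area. Each annulus holds two points with
probability at most `(πλK/n)²`, so a tie has probability at most `(πλK)²/n`, for every `n`. -/
lemma IsPoissonPointProcess.ae_no_ties (hlam : 0 < lam)
    (hX : IsPoissonPointProcess μ (ENNReal.ofReal lam • volume) X) (t : Plane) (K : ℕ) :
    ∀ᵐ ω ∂μ, ¬ ∃ i j, i ≠ j ∧ dist (X i ω) t = dist (X j ω) t ∧ 0 < dist (X i ω) t ∧
      dist (X i ω) t ^ 2 ≤ K := by
  -- `A n j` is the `j`-th of `n` annuli of equal area
  let A : ℕ → ℕ → Set Plane := fun n j =>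
    Metric.closedBall t (√(K * (j + 1) / n)) \ Metric.closedBall t (√(K * j / n))
  have hA : ∀ n j, MeasurableSet (A n j) := fun n j =>
    measurableSet_closedBall.diff measurableSet_closedBall
  have hΛ : ∀ n j, (ENNReal.ofReal lam • volume : Measure Plane) (A n j) =
      ENNReal.ofReal (Real.pi * lam * K / n) := fun n j => by
    rw [intensity_annulus hlam.le t (Real.sqrt_nonneg _) (Real.sqrt_le_sqrt (by gcongr; linarith)),
      Real.sq_sqrt (by positivity), Real.sq_sqrt (by positivity)]
    congr 1
    ring
  set T : Set Ω := {ω | ∃ i j, i ≠ j ∧ dist (X i ω) t = dist (X j ω) t ∧ 0 < dist (X i ω) t ∧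
      dist (X i ω) t ^ 2 ≤ K} with hT
  have hsub : ∀ n : ℕ, 0 < n → T ⊆ ⋃ j ∈ Finset.range n, {ω | 2 ≤ pointCount X (A n j) ω} := by
    rintro n hn ω ⟨i, j, hij, hd, hpos, hK⟩
    set d := dist (X i ω) t with hd'
    have hn' : (0 : ℝ) < n := by exact_mod_cast hn
    have hK0 : (0 : ℝ) < K := lt_of_lt_of_le (by positivity) hK
    -- The annuli contain their outer and not their inner circle, so the index for distance `d` is
    -- `⌈d² n / K⌉ - 1`. Positivity of `d` makes this ceiling nonzero; the centre `t` lies in no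
    -- annulus.
    have hk0 : 0 < ⌈d ^ 2 * n / K⌉₊ := Nat.ceil_pos.2 (by positivity)
    obtain ⟨k, hk⟩ := Nat.exists_eq_add_of_le' hk0
    have hle := Nat.le_ceil (d ^ 2 * n / K)
    have hlt : (k : ℝ) < d ^ 2 * n / K := Nat.lt_ceil.1 (by omega)
    rw [hk] at hle
    push_cast at hle
    have hkn : k < n := by
      have : ⌈d ^ 2 * n / K⌉₊ ≤ n := Nat.ceil_le.2 (by
        rw [div_le_iff₀ hK0, mul_comm (n : ℝ)]
        gcongr)
      omega
    have hmem : ∀ x : Plane, dist x t = d → x ∈ A n k := by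
      intro x hx
      refine ⟨?_, ?_⟩
      · rw [Metric.mem_closedBall, hx]
        refine Real.le_sqrt_of_sq_le ?_
        rw [div_le_iff₀ hK0] at hle
        rw [le_div_iff₀ hn']
        linarith
      · rw [Metric.mem_closedBall, hx, not_le, Real.sqrt_lt' hpos, div_lt_iff₀ hn']
        rw [lt_div_iff₀ hK0] at hlt
        linarith
    refine mem_iUnion₂.2 ⟨k, Finset.mem_range.2 hkn, ?_⟩
    have : ({i, j} : Set ℕ) ⊆ {l | X l ω ∈ A n k} := by
      rintro l (rfl | rfl)
      · exact hmem _ rfl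
      · exact hmem _ hd.symm
    rw [mem_ofPred_eq, pointCount, ← Set.encard_pair hij]
    exact Set.encard_le_encard this
  have hbound : ∀ n : ℕ, 0 < n → μ T ≤ ENNReal.ofReal ((Real.pi * lam * K) ^ 2 / n) := by
    intro n hn
    have hn' : (0 : ℝ) < n := by exact_mod_cast hn
    calc μ T ≤ ∑ j ∈ Finset.range n, μ {ω | 2 ≤ pointCount X (A n j) ω} :=
          (measure_mono (hsub n hn)).trans (measure_biUnion_finset_le _ _)
      _ ≤ ∑ j ∈ Finset.range n, ENNReal.ofReal (Real.pi * lam * K / n) ^ 2 := by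
          refine Finset.sum_le_sum fun j _ => ?_
          rw [← hΛ n j]
          exact hX.measure_two_le_pointCount_le (hA n j) (by rw [hΛ]; exact ENNReal.ofReal_ne_top)
      _ = ENNReal.ofReal ((Real.pi * lam * K) ^ 2 / n) := by
          rw [Finset.sum_const, Finset.card_range, nsmul_eq_mul,
            ← ENNReal.ofReal_pow (by positivity), ← ENNReal.ofReal_natCast,
            ← ENNReal.ofReal_mul hn'.le]
          congr 1
          field_simp
  have hlim : Tendsto (fun n : ℕ => ENNReal.ofReal ((Real.pi * lam * K) ^ 2 / n)) atTop (𝓝 0) := by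
    have := ENNReal.tendsto_ofReal (tendsto_const_div_atTop_nhds_zero_nat ((Real.pi * lam * K) ^ 2))
    simpa using this
  have h0 : μ T = 0 := le_antisymm (ge_of_tendsto hlim
    ((eventually_gt_atTop 0).mono fun n hn => hbound n hn)) zero_le
  exact measure_eq_zero_iff_ae_notMem.1 h0

/-- Integer radii reduce everything to countably many null events. The centre `t` is free of points
because a single point has intensity zero. -/
lemma IsPoissonPointProcess.ae_isGeneric (hlam : 0 < lam)
    (hX : IsPoissonPointProcess μ (ENNReal.ofReal lam • volume) X) (t : Plane) :
    ∀ᵐ ω ∂μ, IsGeneric X t ω := by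
  have hfin : ∀ᵐ ω ∂μ, ∀ k : ℕ, pointCount X (Metric.closedBall t k) ω ≠ ⊤ :=
    ae_all_iff.2 fun k => hX.ae_pointCount_ne_top measurableSet_closedBall
      (by rw [intensity_closedBall hlam.le t k.cast_nonneg]; exact ENNReal.ofReal_ne_top)
  have h0 : (ENNReal.ofReal lam • volume : Measure Plane) {t} = 0 := by simp
  have hne : ∀ᵐ ω ∂μ, pointCount X {t} ω < (1 : ℕ) := by
    refine (prob_compl_eq_zero_iff ?_).2 ?_
    · exact measurable_pointCount hX.measurable (measurableSet_singleton t)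
        (MeasurableSet.of_discrete (s := Iio ((1 : ℕ) : ℕ∞)))
    · rw [hX.measure_pointCount_lt (measurableSet_singleton t) (by simp [h0]), h0]
      simp
  filter_upwards [hfin, hne, ae_all_iff.2 fun K => hX.ae_no_ties hlam t K] with ω h1 h2 h3
  have hne' : ∀ i, X i ω ≠ t := by
    intro i hi
    have : ({i} : Set ℕ) ⊆ {j | X j ω ∈ ({t} : Set Plane)} := by
      rintro j rfl
      exact hi
    have h := Set.encard_le_encard this
    rw [Set.encard_singleton] at h
    exact absurd h2 (not_lt.2 (by exact_mod_cast h))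
  refine ⟨fun r => ?_, fun i j hij => ?_, hne'⟩
  · obtain ⟨k, hk⟩ := exists_nat_ge r
    exact ne_top_of_le_ne_top (h1 k)
      (pointCount_mono X (Metric.closedBall_subset_closedBall hk) ω)
  · by_contra hne
    obtain ⟨K, hK⟩ := exists_nat_ge (dist (X i ω) t ^ 2)
    exact h3 K ⟨i, j, hne, hij, dist_pos.2 (hne' i), hK⟩

/-- `R₁ > a` means that the disc of radius `a` is empty; given this, `Rₙ > b` means that the annulus
between `a` and `b` holds fewer than `n` points. The two counts are independent. -/
lemma IsPoissonPointProcess.measure_nthDist_gt (hlam : 0 < lam)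
    (hX : IsPoissonPointProcess μ (ENNReal.ofReal lam • volume) X) (t : Plane) (n : ℕ)
    {a b : ℝ} (ha : 0 ≤ a) (hab : a ≤ b) :
    μ {ω | a < nthDist X t 1 ω ∧ b < nthDist X t n ω} =
      ENNReal.ofReal (Real.exp (-(Real.pi * lam * a ^ 2)) *
        poissonBelow n (Real.pi * lam * (b ^ 2 - a ^ 2))) := by
  set A := Metric.closedBall t a
  set B := Metric.closedBall t b \ A
  have hA : MeasurableSet A := measurableSet_closedBall
  have hB : MeasurableSet B := measurableSet_closedBall.diff hA
  have hΛA := intensity_closedBall hlam.le t ha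
  have hΛB := intensity_annulus hlam.le t ha hab
  have hab2 : 0 ≤ b ^ 2 - a ^ 2 := by nlinarith
  have hind : IndepFun (pointCount X A) (pointCount X B) μ := by
    have h := hX.iIndepFun_pointCount (B := fun c : Bool => bif c then A else B)
      (by rintro (_ | _); exacts [hB, hA])
      (by
        rintro (_ | _)
        · exact hΛB ▸ ENNReal.ofReal_ne_top
        · exact hΛA ▸ ENNReal.ofReal_ne_top)
      (by
        rintro (_ | _) (_ | _) h
        · exact absurd rfl h
        · exact disjoint_sdiff_left
        · exact disjoint_sdiff_right
        · exact absurd rfl h)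
    exact h.indepFun (i := true) (j := false) (by simp)
  have hset : ({ω | a < nthDist X t 1 ω ∧ b < nthDist X t n ω} : Set Ω) =ᵐ[μ]
      (pointCount X A ⁻¹' Iio ((1 : ℕ) : ℕ∞) ∩ pointCount X B ⁻¹' Iio (n : ℕ∞) : Set Ω) := by
    filter_upwards [hX.ae_isGeneric hlam t] with ω hω
    refine propext ?_
    change (a < _ ∧ b < _) ↔ (pointCount X A ω < _ ∧ pointCount X B ω < _)
    rw [← not_le, ← not_le (b := b), hω.nthDist_le_iff ha, hω.nthDist_le_iff (ha.trans hab),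
      not_le, not_le]
    refine and_congr_right fun h => ?_
    rw [pointCount_sdiff_of_eq_zero (by simpa using h)]
  rw [measure_congr hset, hind.measure_inter_preimage_eq_mul _ _ .of_discrete .of_discrete]
  have h1 := hX.measure_pointCount_lt hA (hΛA ▸ ENNReal.ofReal_ne_top) 1
  have h2 := hX.measure_pointCount_lt hB (hΛB ▸ ENNReal.ofReal_ne_top) n
  rw [hΛA, ENNReal.toReal_ofReal (by positivity), poissonBelow_one] at h1
  rw [hΛB, ENNReal.toReal_ofReal (by positivity)] at h2
  rw [ENNReal.ofReal_mul (Real.exp_nonneg _), ← h1, ← h2]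
  rfl

end Plane

end ISAC

end

noncomputable section

namespace ISAC

open Filter Topology
open scoped ENNReal NNReal

/-! ### The joint law of the smallest distance and the exclusion radius -/

/-- The derivatives of consecutive terms telescope and only the last one survives. -/
lemma hasDerivAt_poissonBelow (n : ℕ) (m : ℝ) :
    HasDerivAt (poissonBelow (n + 1)) (-(Real.exp (-m) * m ^ n / (n.factorial : ℝ))) m := by
  have hexp : HasDerivAt (fun m : ℝ => Real.exp (-m)) (-Real.exp (-m)) m := by
    simpa using (hasDerivAt_neg m).exp
  induction n with
  | zero =>
    have : poissonBelow (0 + 1) = fun m => Real.exp (-m) := funext fun m => poissonBelow_one m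
    rw [this]
    simpa using hexp
  | succ n ih =>
    rw [show poissonBelow (n + 1 + 1) = fun m => poissonBelow (n + 1) m +
      Real.exp (-m) * m ^ (n + 1) / ((n + 1).factorial : ℝ) from
        funext fun m => poissonBelow_succ (n + 1) m]
    have h2 := ((hexp.mul (hasDerivAt_pow (n + 1) m)).div_const ((n + 1).factorial : ℝ))
    refine (ih.add h2).congr_deriv ?_
    have hf : ((n + 1).factorial : ℝ) = (n + 1) * n.factorial := by
      rw [Nat.factorial_succ]; push_cast; ring
    have hn : (n.factorial : ℝ) ≠ 0 := by positivity
    have hn1 : (n : ℝ) + 1 ≠ 0 := by positivity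
    rw [hf]
    field_simp
    push_cast
    ring

lemma tendsto_poissonBelow (n : ℕ) : Tendsto (poissonBelow n) atTop (𝓝 0) := by
  have : Tendsto (fun m : ℝ => ∑ k ∈ Finset.range n, Real.exp (-m) * m ^ k / (k.factorial : ℝ))
      atTop (𝓝 (∑ k ∈ Finset.range n, (0 : ℝ))) := by
    refine tendsto_finsetSum _ fun k _ => ?_
    have := (Real.tendsto_pow_mul_exp_neg_atTop_nhds_zero k).div_const (k.factorial : ℝ)
    simpa [mul_comm] using this
  rw [Finset.sum_const_zero] at this
  exact this

section Density

variable (p : Params)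

lemma measurable_condDensity (n : ℕ) : Measurable (Function.uncurry (condDensity p n)) := by
  unfold condDensity Function.uncurry
  refine Measurable.ite (measurableSet_le measurable_fst measurable_snd) ?_ measurable_const
  fun_prop

lemma condDensity_nonneg (n : ℕ) {r ρ : ℝ} (hr : 0 ≤ r) : 0 ≤ condDensity p n r ρ := by
  unfold condDensity
  split_ifs with h
  · have h1 : 0 ≤ ρ ^ 2 - r ^ 2 := by nlinarith
    have h2 := p.lamBS_pos
    have h3 : 0 ≤ ρ := hr.trans h
    positivity
  · exact le_rfl

lemma condDensity_of_lt (n : ℕ) {r ρ : ℝ} (h : ρ < r) : condDensity p n r ρ = 0 :=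
  if_neg (not_le.2 h)

/-- The density is the derivative in `ρ` of `-poissonBelow n (πλ(ρ² - r²))`, which tends to `0` at
infinity. -/
lemma setLIntegral_condDensity_Ioi_of_le {n : ℕ} (hn : 1 ≤ n) {r c : ℝ} (hr : 0 ≤ r)
    (hrc : r ≤ c) :
    ∫⁻ ρ in Ioi c, ENNReal.ofReal (condDensity p n r ρ) =
      ENNReal.ofReal (poissonBelow n (Real.pi * p.lamBS * (c ^ 2 - r ^ 2))) := by
  obtain ⟨n, rfl⟩ := Nat.exists_eq_add_of_le' hn
  have hlam := p.lamBS_pos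
  set g : ℝ → ℝ := fun ρ => -poissonBelow (n + 1) (Real.pi * p.lamBS * (ρ ^ 2 - r ^ 2)) with hg
  have hderiv : ∀ ρ ∈ Ici c, HasDerivAt g (condDensity p (n + 1) r ρ) ρ := by
    intro ρ hρ
    have hin : HasDerivAt (fun ρ : ℝ => Real.pi * p.lamBS * (ρ ^ 2 - r ^ 2))
        (Real.pi * p.lamBS * (2 * ρ)) ρ := by
      have := ((hasDerivAt_pow 2 ρ).sub_const (r ^ 2)).const_mul (Real.pi * p.lamBS)
      simpa using this
    have h := ((hasDerivAt_poissonBelow n _).comp ρ hin).neg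
    refine h.congr_deriv ?_
    rw [condDensity, if_pos (hrc.trans hρ)]
    simp only [Nat.add_sub_cancel]
    rw [mul_pow]
    ring
  have hnn : ∀ ρ ∈ Ioi c, 0 ≤ condDensity p (n + 1) r ρ := fun ρ _ => condDensity_nonneg p _ hr
  have hlim : Tendsto g atTop (𝓝 0) := by
    have h1 : Tendsto (fun ρ : ℝ => Real.pi * p.lamBS * (ρ ^ 2 - r ^ 2)) atTop atTop := by
      refine Tendsto.const_mul_atTop (by positivity) ?_
      exact tendsto_atTop_add_const_right _ _ (tendsto_pow_atTop (by norm_num))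
    simpa using ((tendsto_poissonBelow (n + 1)).comp h1).neg
  rw [← ofReal_integral_eq_lintegral_ofReal (integrableOn_Ioi_deriv_of_nonneg' hderiv hnn hlim)
    (Eventually.of_forall fun ρ => condDensity_nonneg p _ hr),
    integral_Ioi_of_hasDerivAt_of_nonneg' hderiv hnn hlim]
  simp [hg]

lemma setLIntegral_condDensity_Ioi {n : ℕ} (hn : 1 ≤ n) {r : ℝ} (hr : 0 ≤ r) (b : ℝ) :
    ∫⁻ ρ in Ioi b, ENNReal.ofReal (condDensity p n r ρ) =
      ENNReal.ofReal (poissonBelow n (Real.pi * p.lamBS * (max b r ^ 2 - r ^ 2))) := by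
  rcases le_total r b with h | h
  · rw [max_eq_left h, setLIntegral_condDensity_Ioi_of_le p hn hr h]
  -- The endpoint `r` is discarded as a null set, since for `n = 1` the density need not vanish
  -- there.
  · rw [max_eq_right h, ← setLIntegral_condDensity_Ioi_of_le p hn hr le_rfl,
      ← Ioc_union_Ioi_eq_Ioi h, lintegral_union measurableSet_Ioi Ioc_disjoint_Ioi_same,
      ← restrict_Ioo_eq_restrict_Ioc]
    rw [setLIntegral_congr_fun (g := fun _ => 0) measurableSet_Ioo fun ρ hρ => by
      rw [condDensity_of_lt p n hρ.2, ENNReal.ofReal_zero]]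
    simp

lemma lintegral_condDensity {n : ℕ} (hn : 1 ≤ n) {r : ℝ} (hr : 0 ≤ r) :
    ∫⁻ ρ, ENNReal.ofReal (condDensity p n r ρ) = 1 := by
  have h := setLIntegral_condDensity_Ioi p hn hr (r - 1)
  rw [max_eq_right (by linarith), sub_self, mul_zero, poissonBelow_zero_right hn,
    ENNReal.ofReal_one] at h
  rw [← h, ← lintegral_indicator measurableSet_Ioi]
  refine lintegral_congr fun ρ => ?_
  by_cases hρ : ρ ∈ Ioi (r - 1)
  · rw [indicator_of_mem hρ]
  · rw [indicator_of_notMem hρ, condDensity_of_lt p n (by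
      have : ρ ≤ r - 1 := not_lt.1 hρ
      linarith), ENNReal.ofReal_zero]

/-- The conditional law of the exclusion radius, as a kernel. For negative arguments, which do not
occur as distances, it is the one at `0`. -/
def radiusKernel (n : ℕ) : Kernel ℝ ℝ :=
  (Kernel.const ℝ volume).withDensity fun r ρ => ENNReal.ofReal (condDensity p n (max r 0) ρ)

lemma measurable_radiusKernel_density (n : ℕ) :
    Measurable (Function.uncurry fun r ρ => ENNReal.ofReal (condDensity p n (max r 0) ρ)) := by
  refine ENNReal.measurable_ofReal.comp ?_
  exact (measurable_condDensity p n).comp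
    ((measurable_fst.max measurable_const).prodMk measurable_snd)

lemma radiusKernel_eq (n : ℕ) {r : ℝ} (hr : 0 ≤ r) :
    radiusKernel p n r = volume.withDensity fun ρ => ENNReal.ofReal (condDensity p n r ρ) := by
  rw [radiusKernel, Kernel.withDensity_apply _ (measurable_radiusKernel_density p n),
    Kernel.const_apply, max_eq_left hr]

lemma radiusKernel_of_neg (n : ℕ) {r : ℝ} (hr : r ≤ 0) :
    radiusKernel p n r = radiusKernel p n 0 := by
  rw [radiusKernel, Kernel.withDensity_apply _ (measurable_radiusKernel_density p n),
    Kernel.withDensity_apply _ (measurable_radiusKernel_density p n),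
    Kernel.const_apply, Kernel.const_apply, max_eq_right hr, max_self]

lemma isMarkovKernel_radiusKernel {n : ℕ} (hn : 1 ≤ n) : IsMarkovKernel (radiusKernel p n) := by
  have h : ∀ r, 0 ≤ r → IsProbabilityMeasure (radiusKernel p n r) := fun r hr => ⟨by
    rw [radiusKernel_eq p n hr, withDensity_apply _ MeasurableSet.univ, setLIntegral_univ,
      lintegral_condDensity p hn hr]⟩
  refine ⟨fun r => ?_⟩
  rcases le_total 0 r with hr | hr
  · exact h r hr
  · rw [radiusKernel_of_neg p n hr]
    exact h 0 le_rfl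

lemma radiusKernel_Ioi {n : ℕ} (hn : 1 ≤ n) {r : ℝ} (hr : 0 ≤ r) (b : ℝ) :
    radiusKernel p n r (Ioi b) =
      ENNReal.ofReal (poissonBelow n (Real.pi * p.lamBS * (max b r ^ 2 - r ^ 2))) := by
  rw [radiusKernel_eq p n hr, withDensity_apply _ measurableSet_Ioi,
    setLIntegral_condDensity_Ioi p hn hr]

/-- The density of `R₁` itself is the conditional formula with one further point and starting radius
`0`. -/
lemma condDensity_one_zero {r : ℝ} (hr : 0 ≤ r) :
    condDensity p 1 0 r =
      2 * (Real.pi * p.lamBS) * r * Real.exp (-(Real.pi * p.lamBS * r ^ 2)) := by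
  simp [condDensity, hr]

/-- Matches `IsPoissonPointProcess.measure_nthDist_gt`. For `r > b` the kernel puts its whole mass
beyond `b`, which contributes `exp (-πλb²)`; on `(a, b]` the integrand has an explicit primitive. -/
lemma setLIntegral_radiusKernel_Ioi {n : ℕ} (hn : 1 ≤ n) {a b : ℝ} (ha : 0 ≤ a) (hab : a ≤ b) :
    ∫⁻ r in Ioi a, ENNReal.ofReal (condDensity p 1 0 r) * radiusKernel p n r (Ioi b) =
      ENNReal.ofReal (Real.exp (-(Real.pi * p.lamBS * a ^ 2)) *
        poissonBelow (n + 1) (Real.pi * p.lamBS * (b ^ 2 - a ^ 2))) := by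
  have hlam := p.lamBS_pos
  have hm : ∀ r, 0 ≤ r → r ≤ b → 0 ≤ Real.pi * p.lamBS * (b ^ 2 - r ^ 2) := fun r h0 hr =>
    mul_nonneg (by positivity) (by nlinarith)
  have hright : ∫⁻ r in Ioi b, ENNReal.ofReal (condDensity p 1 0 r) * radiusKernel p n r (Ioi b) =
      ENNReal.ofReal (Real.exp (-(Real.pi * p.lamBS * b ^ 2))) := by
    rw [setLIntegral_congr_fun (g := fun r => ENNReal.ofReal (condDensity p 1 0 r))
      measurableSet_Ioi fun r (hr : b < r) => by
        dsimp only
        rw [radiusKernel_Ioi p hn ((ha.trans hab).trans hr.le), max_eq_right hr.le, sub_self,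
          mul_zero, poissonBelow_zero_right hn, ENNReal.ofReal_one, mul_one]]
    rw [setLIntegral_condDensity_Ioi_of_le p le_rfl le_rfl (ha.trans hab), poissonBelow_one]
    simp
  have hleft : ∫⁻ r in Ioc a b, ENNReal.ofReal (condDensity p 1 0 r) * radiusKernel p n r (Ioi b) =
      ENNReal.ofReal (Real.exp (-(Real.pi * p.lamBS * a ^ 2)) *
        poissonBelow (n + 1) (Real.pi * p.lamBS * (b ^ 2 - a ^ 2)) -
          Real.exp (-(Real.pi * p.lamBS * b ^ 2))) := by
    set h : ℝ → ℝ := fun r =>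
      2 * (Real.pi * p.lamBS) * r * Real.exp (-(Real.pi * p.lamBS * r ^ 2)) *
      poissonBelow n (Real.pi * p.lamBS * (b ^ 2 - r ^ 2)) with hh
    rw [setLIntegral_congr_fun (g := fun r => ENNReal.ofReal (h r)) measurableSet_Ioc
      fun r (hr : a < r ∧ r ≤ b) => by
        have hr0 := ha.trans hr.1.le
        dsimp only
        rw [radiusKernel_Ioi p hn hr0, max_eq_left hr.2, condDensity_one_zero p hr0,
          ← ENNReal.ofReal_mul (by positivity)]]
    have hcont : Continuous h := by
      unfold h poissonBelow
      fun_prop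
    -- By the product rule, the derivative of the Poisson sum removes its top term, so `poissonBelow
    -- (n + 1)` in the primitive becomes `poissonBelow n` in the integrand.
    have hderiv : ∀ r ∈ uIcc a b, HasDerivAt (fun r => -(Real.exp (-(Real.pi * p.lamBS * r ^ 2)) *
        poissonBelow (n + 1) (Real.pi * p.lamBS * (b ^ 2 - r ^ 2)))) (h r) r := by
      intro r _
      have h1 : HasDerivAt (fun r : ℝ => Real.pi * p.lamBS * (b ^ 2 - r ^ 2))
          (Real.pi * p.lamBS * (-(2 * r))) r := by
        have := ((hasDerivAt_pow 2 r).const_sub (b ^ 2)).const_mul (Real.pi * p.lamBS)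
        simpa using this
      have h2 : HasDerivAt (fun r : ℝ => -(Real.pi * p.lamBS * r ^ 2))
          (-(Real.pi * p.lamBS * (2 * r))) r := by
        have := (hasDerivAt_pow 2 r).const_mul (-(Real.pi * p.lamBS))
        simpa using this
      have h3 := (h2.exp.mul ((hasDerivAt_poissonBelow n _).comp r h1)).neg
      refine h3.congr_deriv ?_
      simp only [hh, Function.comp_apply, poissonBelow_succ]
      ring
    have hint := intervalIntegral.integral_eq_sub_of_hasDerivAt hderiv
      (hcont.intervalIntegrable a b)
    rw [← ofReal_integral_eq_lintegral_ofReal, ← intervalIntegral.integral_of_le hab, hint]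
    · congr 1
      simp only [sub_self, mul_zero]
      rw [poissonBelow_zero_right (Nat.le_add_left 1 n)]
      ring
    · exact (intervalIntegrable_iff_integrableOn_Ioc_of_le hab).1 (hcont.intervalIntegrable a b)
    · refine (ae_restrict_iff' measurableSet_Ioc).2 (Eventually.of_forall fun r hr => ?_)
      have hr0 := ha.trans hr.1.le
      have := poissonBelow_nonneg n (hm r hr0 hr.2)
      change 0 ≤ h r
      positivity
  rw [← Ioc_union_Ioi_eq_Ioi hab, lintegral_union measurableSet_Ioi Ioc_disjoint_Ioi_same,
    hleft, hright, ← ENNReal.ofReal_add _ (Real.exp_nonneg _), sub_add_cancel]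
  -- Adding inside `ENNReal.ofReal` needs a nonnegative difference: the term `k = 0` of the Poisson
  -- sum, times `exp (-πλa²)`, is already `exp (-πλb²)`.
  rw [sub_nonneg]
  have h1 : Real.exp (-(Real.pi * p.lamBS * (b ^ 2 - a ^ 2))) ≤
      poissonBelow (n + 1) (Real.pi * p.lamBS * (b ^ 2 - a ^ 2)) := by
    rw [poissonBelow, Finset.sum_range_succ']
    simp only [pow_zero, mul_one, Nat.factorial_zero, Nat.cast_one, div_one]
    have := hm a ha hab
    refine le_add_of_nonneg_left (Finset.sum_nonneg fun k _ => ?_)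
    positivity
  refine le_trans (le_of_eq ?_) (mul_le_mul_of_nonneg_left h1 (Real.exp_nonneg _))
  rw [← Real.exp_add]
  congr 1
  ring

lemma isCountablySpanning_range_Ioi : IsCountablySpanning (range (Ioi : ℝ → Set ℝ)) := by
  refine ⟨fun n => Ioi (-n), fun n => ⟨_, rfl⟩, ?_⟩
  refine eq_univ_of_forall fun x => mem_iUnion.2 ?_
  obtain ⟨n, hn⟩ := exists_nat_gt (-x)
  exact ⟨n, by simp only [mem_Ioi]; linarith⟩

lemma ext_of_Ioi_prod_Ioi {ν ν' : Measure (ℝ × ℝ)} [IsProbabilityMeasure ν]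
    [IsProbabilityMeasure ν'] (h : ∀ a b : ℝ, ν (Ioi a ×ˢ Ioi b) = ν' (Ioi a ×ˢ Ioi b)) :
    ν = ν' := by
  have hb : MeasurableSpace.generateFrom (range (Ioi : ℝ → Set ℝ)) = Real.measurableSpace := by
    rw [← borel_eq_generateFrom_Ioi ℝ]
    exact (BorelSpace.measurable_eq (α := ℝ)).symm
  refine ext_of_generate_finite _ (generateFrom_eq_prod hb hb isCountablySpanning_range_Ioi
    isCountablySpanning_range_Ioi).symm (isPiSystem_Ioi.prod isPiSystem_Ioi) ?_ (by simp)
  rintro _ ⟨_, ⟨a, rfl⟩, _, ⟨b, rfl⟩, rfl⟩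
  exact h a b

end Density

section JointLaw

variable {Ω : Type*} [MeasurableSpace Ω] {μ : Measure Ω} [IsProbabilityMeasure μ] {p : Params}
  {X : ℕ → Ω → Plane}

/-- Open quadrants determine a probability law on the plane, and both sides are known on those with
`0 ≤ a ≤ b`. The others reduce to these because `0 < R₁ < R_{n+1}` almost surely. -/
lemma IsPoissonPointProcess.map_nthDist_prod
    (hX : IsPoissonPointProcess μ (ENNReal.ofReal p.lamBS • volume) X) (t : Plane) {n : ℕ}
    (hn : 1 ≤ n) :
    μ.map (fun ω => (nthDist X t 1 ω, nthDist X t (n + 1) ω)) =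
      (volume.withDensity fun r => ENNReal.ofReal (condDensity p 1 0 r)) ⊗ₘ radiusKernel p n := by
  have hlam := p.lamBS_pos
  have hm1 := measurable_nthDist hX.measurable t 1
  have hm2 := measurable_nthDist hX.measurable t (n + 1)
  have := isMarkovKernel_radiusKernel p hn
  have hdm : Measurable fun r => ENNReal.ofReal (condDensity p 1 0 r) :=
    ENNReal.measurable_ofReal.comp ((measurable_condDensity p 1).comp measurable_prodMk_left)
  have : IsProbabilityMeasure (volume.withDensity fun r => ENNReal.ofReal (condDensity p 1 0 r)) :=
    ⟨by rw [withDensity_apply _ MeasurableSet.univ, setLIntegral_univ,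
      lintegral_condDensity p le_rfl le_rfl]⟩
  have : IsProbabilityMeasure (μ.map (fun ω => (nthDist X t 1 ω, nthDist X t (n + 1) ω))) :=
    Measure.isProbabilityMeasure_map (hm1.prodMk hm2).aemeasurable
  refine ext_of_Ioi_prod_Ioi fun a b => ?_
  rw [Measure.map_apply (hm1.prodMk hm2) (measurableSet_Ioi.prod measurableSet_Ioi),
    Measure.compProd_apply_prod measurableSet_Ioi measurableSet_Ioi,
    setLIntegral_withDensity_eq_setLIntegral_mul _ hdm
      (Kernel.measurable_coe _ measurableSet_Ioi) measurableSet_Ioi]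
  simp only [Pi.mul_apply]
  -- reduce to `0 ≤ a ≤ b`
  set a' := max a 0 with ha'
  set b' := max b a' with hb'
  have h0 : 0 ≤ a' := le_max_right _ _
  have hab : a' ≤ b' := le_max_right _ _
  have hleft : μ ((fun ω => (nthDist X t 1 ω, nthDist X t (n + 1) ω)) ⁻¹' Ioi a ×ˢ Ioi b) =
      μ {ω | a' < nthDist X t 1 ω ∧ b' < nthDist X t (n + 1) ω} := by
    refine measure_congr ?_
    filter_upwards [hX.ae_isGeneric hlam t] with ω hω
    refine propext ?_
    have h1 := hω.nthDist_pos le_rfl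
    have h2 := hω.nthDist_one_lt (n := n + 1) (by omega)
    change (a < _ ∧ b < _) ↔ (a' < _ ∧ b' < _)
    simp only [ha', hb', max_lt_iff]
    constructor
    · rintro ⟨h3, h4⟩
      exact ⟨⟨h3, h1⟩, h4, h3.trans h2, h1.trans h2⟩
    · rintro ⟨⟨h3, _⟩, h4, _⟩
      exact ⟨h3, h4⟩
  have hright : ∫⁻ r in Ioi a, ENNReal.ofReal (condDensity p 1 0 r) * radiusKernel p n r (Ioi b) =
      ∫⁻ r in Ioi a', ENNReal.ofReal (condDensity p 1 0 r) * radiusKernel p n r (Ioi b') := by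
    rw [← lintegral_indicator measurableSet_Ioi, ← lintegral_indicator measurableSet_Ioi]
    refine lintegral_congr_ae ?_
    filter_upwards [compl_mem_ae_iff.2 (measure_singleton (0 : ℝ))] with r hr0
    rcases lt_or_gt_of_ne (show r ≠ 0 from hr0) with hr | hr
    · simp only [indicator_apply, condDensity_of_lt p 1 hr, ENNReal.ofReal_zero, zero_mul, ite_self]
    · by_cases har : a < r
      · have har' : a' < r := max_lt har hr
        rw [indicator_of_mem (show r ∈ Ioi a from har),
          indicator_of_mem (show r ∈ Ioi a' from har'), radiusKernel_Ioi p hn hr.le,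
          radiusKernel_Ioi p hn hr.le, hb', max_assoc, max_eq_right har'.le]
      · rw [indicator_of_notMem (show r ∉ Ioi a from har), indicator_of_notMem]
        exact fun h => har ((le_max_left _ _).trans_lt h)
  rw [hleft, hright, hX.measure_nthDist_gt hlam t (n + 1) h0 hab,
    setLIntegral_radiusKernel_Ioi p hn h0 hab]

/-- The first marginal of the explicit law is the law of `R₁`. In this form the kernel disintegrates
the joint law, as the identification with `condDistrib` requires. -/
lemma IsPoissonPointProcess.map_nthDist_one
    (hX : IsPoissonPointProcess μ (ENNReal.ofReal p.lamBS • volume) X) (t : Plane) {n : ℕ}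
    (hn : 1 ≤ n) :
    μ.map (fun ω => (nthDist X t 1 ω, nthDist X t (n + 1) ω)) =
      μ.map (nthDist X t 1) ⊗ₘ radiusKernel p n := by
  have hm2 := measurable_nthDist hX.measurable t (n + 1)
  have := isMarkovKernel_radiusKernel p hn
  have h := congrArg Measure.fst (hX.map_nthDist_prod t hn)
  rw [Measure.fst_map_prodMk hm2, Measure.fst_compProd] at h
  rw [h]
  exact hX.map_nthDist_prod t hn

end JointLaw

end ISAC

end

noncomputable section

namespace ISAC

open Filter Topology
open scoped ENNReal NNReal

/-! ### The process outside the exclusion disc -/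

/-- The smallest multiple of `2⁻ᵏ` that is greater than `x`, for `x ≥ 0`. -/
def dyadicAbove (k : ℕ) (x : ℝ) : ℝ := ((⌊2 ^ k * x⌋₊ : ℝ) + 1) / 2 ^ k

/-- Strictness matters: a distance lies strictly below its rounded value `ρ`, hence it is not
altered by truncation at `ρ`. -/
lemma lt_dyadicAbove (k : ℕ) (x : ℝ) : x < dyadicAbove k x := by
  rw [dyadicAbove, lt_div_iff₀ (by positivity), mul_comm]
  exact Nat.lt_floor_add_one _

lemma dyadicAbove_le (k : ℕ) {x : ℝ} (hx : 0 ≤ x) : dyadicAbove k x ≤ x + 1 / 2 ^ k := by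
  rw [dyadicAbove, add_div]
  gcongr
  rw [div_le_iff₀ (by positivity), mul_comm]
  exact Nat.floor_le (by positivity)

lemma dyadicAbove_succ_le (k : ℕ) {x : ℝ} (hx : 0 ≤ x) :
    dyadicAbove (k + 1) x ≤ dyadicAbove k x := by
  have h : ⌊2 ^ (k + 1) * x⌋₊ < 2 * (⌊2 ^ k * x⌋₊ + 1) := by
    rw [Nat.floor_lt (by positivity)]
    push_cast
    have := Nat.lt_floor_add_one (2 ^ k * x)
    rw [pow_succ]
    linarith
  have h' : (⌊2 ^ (k + 1) * x⌋₊ : ℝ) + 1 ≤ 2 * (⌊2 ^ k * x⌋₊ + 1) := by exact_mod_cast h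
  rw [dyadicAbove, dyadicAbove, pow_succ, div_le_div_iff₀ (by positivity) (by positivity)]
  rw [pow_succ] at h'
  have h2 : (0 : ℝ) < 2 ^ k := by positivity
  nlinarith

lemma antitone_dyadicAbove {x : ℝ} (hx : 0 ≤ x) : Antitone fun k => dyadicAbove k x :=
  antitone_nat_of_succ_le fun k => dyadicAbove_succ_le k hx

lemma tendsto_dyadicAbove {x : ℝ} (hx : 0 ≤ x) :
    Tendsto (fun k => dyadicAbove k x) atTop (𝓝[>] x) := by
  refine tendsto_nhdsWithin_iff.2 ⟨?_, Eventually.of_forall fun k => lt_dyadicAbove k x⟩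
  have h : Tendsto (fun k : ℕ => x + 1 / (2 : ℝ) ^ k) atTop (𝓝 x) := by
    have := (tendsto_pow_atTop_nhds_zero_of_lt_one (r := (1 / 2 : ℝ)) (by norm_num)
      (by norm_num)).const_add x
    simpa using this
  exact tendsto_of_tendsto_of_tendsto_of_le_of_le tendsto_const_nhds h
    (fun k => (lt_dyadicAbove k x).le) fun k => dyadicAbove_le k hx

lemma measurable_dyadicAbove (k : ℕ) : Measurable (dyadicAbove k) := by
  unfold dyadicAbove
  fun_prop

/-- A radial function, cut off to the exterior of the disc of radius `ρ` around `t`. -/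
def radialTail (t : Plane) (h : ℝ → ℝ → ℝ≥0∞) (a ρ : ℝ) (x : Plane) : ℝ≥0∞ :=
  (Ioi ρ).indicator (h a) (dist x t)

/-- The exponent in the Laplace functional of the process outside the disc of radius `ρ`. -/
def tailExponent (lam : ℝ) (t : Plane) (h : ℝ → ℝ → ℝ≥0∞) (a ρ : ℝ) : ℝ≥0∞ :=
  ∫⁻ x, (1 - expNeg (radialTail t h a ρ x)) ∂(ENNReal.ofReal lam • volume)

lemma lintegral_congr_of_fibers {Ω ι : Type*} [MeasurableSpace Ω] {μ : Measure Ω} [Countable ι]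
    [MeasurableSpace ι]
    [MeasurableSingletonClass ι] {g : Ω → ι} (hg : Measurable g) {F G : Ω → ℝ≥0∞}
    (hFG : ∀ i, ∫⁻ ω in g ⁻¹' {i}, F ω ∂μ = ∫⁻ ω in g ⁻¹' {i}, G ω ∂μ) :
    ∫⁻ ω, F ω ∂μ = ∫⁻ ω, G ω ∂μ := by
  have hU : ⋃ i, g ⁻¹' {i} = univ := by
    rw [← preimage_iUnion, iUnion_of_singleton, preimage_univ]
  have hm : ∀ i, MeasurableSet (g ⁻¹' {i}) := fun i => hg (measurableSet_singleton i)
  have hd : Pairwise fun i j => Disjoint (g ⁻¹' {i}) (g ⁻¹' {j}) := fun i j hij =>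
    (disjoint_singleton.2 hij).preimage g
  rw [← setLIntegral_univ F, ← setLIntegral_univ G, ← hU, lintegral_iUnion hm hd,
    lintegral_iUnion hm hd]
  exact tsum_congr hFG

instance isLocallyFiniteMeasure_intensity (lam : ℝ) :
    IsLocallyFiniteMeasure (ENNReal.ofReal lam • volume : Measure Plane) := by
  refine ⟨fun x => ⟨Metric.ball x 1, Metric.ball_mem_nhds x one_pos, ?_⟩⟩
  rw [Measure.smul_apply, smul_eq_mul]
  exact ENNReal.mul_lt_top ENNReal.ofReal_lt_top measure_ball_lt_top

section Tail

variable {t : Plane} {h : ℝ → ℝ → ℝ≥0∞}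

lemma measurable_radialTail (hm : Measurable (Function.uncurry h)) :
    Measurable fun z : (ℝ × ℝ) × Plane => radialTail t h z.1.1 z.1.2 z.2 := by
  have hd : Measurable fun z : (ℝ × ℝ) × Plane => dist z.2 t := by fun_prop
  have : (fun z : (ℝ × ℝ) × Plane => radialTail t h z.1.1 z.1.2 z.2) =
      {z | z.1.2 < dist z.2 t}.indicator fun z => h z.1.1 (dist z.2 t) := by
    ext z
    simp [radialTail, indicator_apply]
  rw [this]
  refine Measurable.indicator ?_ (measurableSet_lt (by fun_prop) hd)
  exact hm.comp ((measurable_fst.comp measurable_fst).prodMk hd)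

lemma measurable_radialTail_right (hm : Measurable (Function.uncurry h)) (a ρ : ℝ) :
    Measurable (radialTail t h a ρ) :=
  (measurable_radialTail hm).comp (measurable_prodMk_left (x := (a, ρ)))

lemma measurable_tailExponent (lam : ℝ) (hm : Measurable (Function.uncurry h)) :
    Measurable (Function.uncurry (tailExponent lam t h)) :=
  Measurable.lintegral_prod_right'
    (f := fun z : (ℝ × ℝ) × Plane => 1 - expNeg (radialTail t h z.1.1 z.1.2 z.2))
    (measurable_const.sub (measurable_expNeg.comp (measurable_radialTail hm)))

/-- Refining the grid lowers both rounded values: the cut-off admits more points and the antitone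
`h` grows. Hence monotone convergence applies to point sums and exponents alike. -/
lemma monotone_radialTail_dyadicAbove (hanti : ∀ d, 0 ≤ d → AntitoneOn (fun a => h a d) (Ioi 0))
    {r ρ : ℝ} (hr : 0 ≤ r) (hρ : 0 ≤ ρ) :
    Monotone fun k => radialTail t h (dyadicAbove k r) (dyadicAbove k ρ) := by
  intro k l hkl x
  have h1 : Ioi (dyadicAbove k ρ) ⊆ Ioi (dyadicAbove l ρ) :=
    Ioi_subset_Ioi (antitone_dyadicAbove hρ hkl)
  refine (indicator_le_indicator_of_subset h1 (fun _ => zero_le) _).trans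
    (indicator_le_indicator ?_)
  exact hanti _ dist_nonneg (hr.trans_lt (lt_dyadicAbove l r)) (hr.trans_lt (lt_dyadicAbove k r))
    (antitone_dyadicAbove hr hkl)

/-- The open tail suits approximation from above: a point strictly beyond `ρ` is eventually beyond
the rounded radius, and a point on the rim never is. -/
lemma tendsto_radialTail_dyadicAbove {r ρ : ℝ} (hr : 0 ≤ r) (hρ : 0 ≤ ρ)
    (hcont : ∀ d, 0 ≤ d → Tendsto (fun a => h a d) (𝓝[>] r) (𝓝 (h r d))) (x : Plane) :
    Tendsto (fun k => radialTail t h (dyadicAbove k r) (dyadicAbove k ρ) x) atTop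
      (𝓝 (radialTail t h r ρ x)) := by
  by_cases hx : ρ < dist x t
  · have hev : ∀ᶠ k in atTop, dyadicAbove k ρ < dist x t :=
      ((tendsto_dyadicAbove hρ).mono_right nhdsWithin_le_nhds).eventually (Iio_mem_nhds hx)
    rw [radialTail, indicator_of_mem (show dist x t ∈ Ioi ρ from hx)]
    refine ((hcont (dist x t) dist_nonneg).comp (tendsto_dyadicAbove hr)).congr' ?_
    filter_upwards [hev] with k hk
    rw [radialTail, indicator_of_mem (show dist x t ∈ Ioi _ from hk)]
    rfl
  · have : ∀ k, radialTail t h (dyadicAbove k r) (dyadicAbove k ρ) x = 0 := fun k =>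
      indicator_of_notMem (fun hk => hx ((lt_dyadicAbove k ρ).trans hk)) _
    simp_rw [this]
    rw [radialTail, indicator_of_notMem (show dist x t ∉ Ioi ρ from hx)]
    exact tendsto_const_nhds

lemma tendsto_tailExponent_dyadicAbove (lam : ℝ) (hm : Measurable (Function.uncurry h))
    (hanti : ∀ d, 0 ≤ d → AntitoneOn (fun a => h a d) (Ioi 0)) {r ρ : ℝ} (hr : 0 ≤ r) (hρ : 0 ≤ ρ)
    (hcont : ∀ d, 0 ≤ d → Tendsto (fun a => h a d) (𝓝[>] r) (𝓝 (h r d))) :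
    Tendsto (fun k => tailExponent lam t h (dyadicAbove k r) (dyadicAbove k ρ)) atTop
      (𝓝 (tailExponent lam t h r ρ)) := by
  refine lintegral_tendsto_of_tendsto_of_monotone (fun k => ?_)
    (Eventually.of_forall fun x k l hkl => tsub_le_tsub_left
      (antitone_expNeg (monotone_radialTail_dyadicAbove hanti hr hρ hkl x)) _)
    (Eventually.of_forall fun x => ?_)
  · exact (measurable_const.sub (measurable_expNeg.comp
      (measurable_radialTail_right hm _ _))).aemeasurable
  · exact ENNReal.Tendsto.sub tendsto_const_nhds ((continuous_expNeg.tendsto _).comp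
      (tendsto_radialTail_dyadicAbove hr hρ hcont x)) (Or.inl ENNReal.one_ne_top)

variable {Ω : Type*}

lemma tendsto_pointSum_radialTail_dyadicAbove (X : ℕ → Ω → Plane)
    (hanti : ∀ d, 0 ≤ d → AntitoneOn (fun a => h a d) (Ioi 0)) {r ρ : ℝ} (hr : 0 ≤ r) (hρ : 0 ≤ ρ)
    (hcont : ∀ d, 0 ≤ d → Tendsto (fun a => h a d) (𝓝[>] r) (𝓝 (h r d))) (ω : Ω) :
    Tendsto (fun k => pointSum X (radialTail t h (dyadicAbove k r) (dyadicAbove k ρ)) ω) atTop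
      (𝓝 (pointSum X (radialTail t h r ρ) ω)) := by
  simp only [pointSum, ← lintegral_count]
  exact lintegral_tendsto_of_tendsto_of_monotone
    (fun k => (measurable_of_countable _).aemeasurable)
    (Eventually.of_forall fun i k l hkl =>
      monotone_radialTail_dyadicAbove hanti hr hρ hkl (X i ω))
    (Eventually.of_forall fun i => tendsto_radialTail_dyadicAbove hr hρ hcont (X i ω))

variable [MeasurableSpace Ω] {μ : Measure Ω} [IsProbabilityMeasure μ] {lam : ℝ}
  {X : ℕ → Ω → Plane}

lemma measurable_pointSum_radialTail (hX : ∀ i, Measurable (X i))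
    (hm : Measurable (Function.uncurry h)) {A B : Ω → ℝ} (hA : Measurable A) (hB : Measurable B) :
    Measurable fun ω => pointSum X (radialTail t h (A ω) (B ω)) ω :=
  Measurable.tsum fun i => (measurable_radialTail hm).comp ((hA.prodMk hB).prodMk (hX i))

lemma measurableSet_floor_eq (k i : ℕ) : MeasurableSet {x : ℝ | ⌊2 ^ k * x⌋₊ = i} := by
  have : Measurable fun x : ℝ => ⌊2 ^ k * x⌋₊ := by fun_prop
  exact this (measurableSet_singleton i)

/-- On this event `Rₙ < ρ`, so the event and both distances are determined by the points within `ρ`.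
The tail beyond `ρ` is independent of these, and its Laplace functional factors out. -/
lemma IsPoissonPointProcess.lintegral_radialTail_of_floor (hlam : 0 < lam)
    (hX : IsPoissonPointProcess μ (ENNReal.ofReal lam • volume) X) {n : ℕ} (hn : 2 ≤ n)
    (hm : Measurable (Function.uncurry h)) {φ : ℝ × ℝ → ℝ≥0∞} (hφ : Measurable φ) (k i j : ℕ)
    (a : ℝ) :
    ∫⁻ ω in {ω | ⌊2 ^ k * nthDist X t 1 ω⌋₊ = i ∧ ⌊2 ^ k * nthDist X t n ω⌋₊ = j},
        φ (nthDist X t 1 ω, nthDist X t n ω) *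
          expNeg (pointSum X (radialTail t h a (((j : ℝ) + 1) / 2 ^ k)) ω) ∂μ =
      ∫⁻ ω in {ω | ⌊2 ^ k * nthDist X t 1 ω⌋₊ = i ∧ ⌊2 ^ k * nthDist X t n ω⌋₊ = j},
        φ (nthDist X t 1 ω, nthDist X t n ω) *
          expNeg (tailExponent lam t h a (((j : ℝ) + 1) / 2 ^ k)) ∂μ := by
  set ρ : ℝ := ((j : ℝ) + 1) / 2 ^ k with hρ
  let Λ : Measure Plane := ENNReal.ofReal lam • volume
  have : IsLocallyFiniteMeasure Λ := isLocallyFiniteMeasure_intensity lam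
  have hm1 := measurable_nthDist hX.measurable t 1
  have hmn := measurable_nthDist hX.measurable t n
  set S : Set Ω := {ω | ⌊2 ^ k * nthDist X t 1 ω⌋₊ = i ∧ ⌊2 ^ k * nthDist X t n ω⌋₊ = j} with hS
  have hSm : MeasurableSet S :=
    (hm1 (measurableSet_floor_eq k i)).inter (hmn (measurableSet_floor_eq k j))
  -- the restriction of `φ` to `S` is a function of the points within distance `ρ`
  let s' : Set (ℝ≥0∞ × ℝ≥0∞) := {z | z.2 < ENNReal.ofReal ρ ∧ ⌊2 ^ k * z.1.toReal⌋₊ = i ∧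
      ⌊2 ^ k * z.2.toReal⌋₊ = j}
  have hs' : MeasurableSet s' := by
    refine (measurableSet_lt measurable_snd measurable_const).inter
      (MeasurableSet.inter ?_ ?_)
    · exact (ENNReal.measurable_toReal.comp measurable_fst) (measurableSet_floor_eq k i)
    · exact (ENNReal.measurable_toReal.comp measurable_snd) (measurableSet_floor_eq k j)
  let Ψ : ℝ≥0∞ × ℝ≥0∞ → ℝ≥0∞ := s'.indicator fun z => φ (z.1.toReal, z.2.toReal)
  have hΨ : Measurable Ψ := by
    refine Measurable.indicator (hφ.comp ?_) hs'
    exact (ENNReal.measurable_toReal.comp measurable_fst).prodMk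
      (ENNReal.measurable_toReal.comp measurable_snd)
  -- Truncation at `ρ` makes `W` depend on the points of the disc only. The strict inequality in
  -- `s'` makes `W` vanish whenever `Rₙ` was really truncated, so nothing is lost.
  let W : Ω → ℝ≥0∞ := fun ω => Ψ (min (nthEDist X t 1 ω) (ENNReal.ofReal ρ),
    min (nthEDist X t n ω) (ENNReal.ofReal ρ))
  have hWm : Measurable[countAlgebra Λ X (Metric.closedBall t ρ)] W :=
    hΨ.comp (Measurable.prodMk (measurable_countAlgebra_min_nthEDist X t 1 ρ)
      (measurable_countAlgebra_min_nthEDist X t n ρ))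
  have hW : ∀ᵐ ω ∂μ, S.indicator (fun ω => φ (nthDist X t 1 ω, nthDist X t n ω)) ω = W ω := by
    filter_upwards [hX.ae_isGeneric hlam t] with ω hω
    have hlt := hω.nthDist_one_lt hn
    have e1 : nthEDist X t 1 ω = ENNReal.ofReal (nthDist X t 1 ω) := by
      rw [nthDist_eq_toReal, ENNReal.ofReal_toReal (nthEDist_ne_top X t 1 ω)]
    have en : nthEDist X t n ω = ENNReal.ofReal (nthDist X t n ω) := by
      rw [nthDist_eq_toReal, ENNReal.ofReal_toReal (nthEDist_ne_top X t n ω)]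
    by_cases hc : nthDist X t n ω < ρ
    · have hρ0 : 0 < ρ := by positivity
      have hcn : nthEDist X t n ω < ENNReal.ofReal ρ := by
        rw [en]; exact (ENNReal.ofReal_lt_ofReal_iff hρ0).2 hc
      have hc1 : nthEDist X t 1 ω ≤ ENNReal.ofReal ρ := by
        rw [e1]; exact ENNReal.ofReal_le_ofReal (hlt.trans hc).le
      simp only [W, Ψ, min_eq_left hc1, min_eq_left hcn.le]
      by_cases hω' : ω ∈ S
      · have : (nthEDist X t 1 ω, nthEDist X t n ω) ∈ s' := by
          refine ⟨hcn, ?_⟩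
          simp only [← nthDist_eq_toReal]
          exact hω'
        rw [indicator_of_mem hω', indicator_of_mem this]
        simp only [← nthDist_eq_toReal]
      · have : (nthEDist X t 1 ω, nthEDist X t n ω) ∉ s' := by
          rintro ⟨_, h2⟩
          simp only [← nthDist_eq_toReal] at h2
          exact hω' h2
        rw [indicator_of_notMem hω', indicator_of_notMem this]
    · have hω' : ω ∉ S := by
        rintro ⟨_, h2⟩
        apply hc
        rw [hρ, ← h2]
        exact lt_dyadicAbove k _
      have hcn : ENNReal.ofReal ρ ≤ nthEDist X t n ω := by
        rw [en]; exact ENNReal.ofReal_le_ofReal (not_lt.1 hc)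
      rw [indicator_of_notMem hω']
      refine (indicator_of_notMem ?_ _).symm
      rintro ⟨h2, _⟩
      simp only [min_eq_right hcn] at h2
      exact absurd h2 (lt_irrefl _)
  have hf : Measurable (radialTail t h a ρ) := 
    measurable_radialTail_right hm a ρ
  have hpm : Measurable[countAlgebra Λ X (Metric.closedBall t ρ)ᶜ]
      (pointSum X (radialTail t h a ρ)) := by
    have h1 := measurable_countAlgebra_pointSum Λ X
      (measurableSet_closedBall (x := t) (ε := ρ)).compl hf
    rwa [indicator_eq_self.2] at h1
    intro x hx
    by_contra hx'
    refine hx (indicator_of_notMem ?_ _)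
    simpa using hx'
  have hmul := lintegral_mul_eq_lintegral_mul_lintegral_of_independent_measurableSpace
    (countAlgebra_le hX.measurable (Metric.closedBall t ρ))
    (countAlgebra_le hX.measurable (Metric.closedBall t ρ)ᶜ)
    (hX.indep_countAlgebra disjoint_compl_right) hWm (measurable_expNeg.comp hpm)
  simp only [Function.comp_apply] at hmul
  rw [hX.lintegral_expNeg_pointSum hf] at hmul
  have hWm' : Measurable W := hWm.mono (countAlgebra_le hX.measurable _) le_rfl
  rw [← lintegral_indicator hSm, ← lintegral_indicator hSm]
  calc _ = ∫⁻ ω, W ω * expNeg (pointSum X (radialTail t h a ρ) ω) ∂μ := by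
        refine lintegral_congr_ae (hW.mono fun ω hω => ?_)
        dsimp only
        rw [← hω, indicator_mul_left]
    _ = (∫⁻ ω, W ω ∂μ) * expNeg (tailExponent lam t h a ρ) := hmul
    _ = ∫⁻ ω, W ω * expNeg (tailExponent lam t h a ρ) ∂μ := (lintegral_mul_const _ hWm').symm
    _ = _ := by
        refine lintegral_congr_ae (hW.mono fun ω hω => ?_)
        dsimp only
        rw [← hω]
        by_cases hmem : ω ∈ S <;> simp [hmem]

/-- Given the distances `R₁ < Rₙ`, the points beyond distance `Rₙ` form a Poisson process. -/
theorem IsPoissonPointProcess.lintegral_radialTail_nthDist (hlam : 0 < lam)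
    (hX : IsPoissonPointProcess μ (ENNReal.ofReal lam • volume) X) {n : ℕ} (hn : 2 ≤ n)
    (hm : Measurable (Function.uncurry h))
    (hanti : ∀ d, 0 ≤ d → AntitoneOn (fun a => h a d) (Ioi 0))
    (hcont : ∀ d r, 0 ≤ d → 0 < r → Tendsto (fun a => h a d) (𝓝[>] r) (𝓝 (h r d)))
    {φ : ℝ × ℝ → ℝ≥0∞} (hφ : Measurable φ) (hφ1 : ∀ z, φ z ≤ 1) :
    ∫⁻ ω, φ (nthDist X t 1 ω, nthDist X t n ω) *
        expNeg (pointSum X (radialTail t h (nthDist X t 1 ω) (nthDist X t n ω)) ω) ∂μ =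
      ∫⁻ ω, φ (nthDist X t 1 ω, nthDist X t n ω) *
        expNeg (tailExponent lam t h (nthDist X t 1 ω) (nthDist X t n ω)) ∂μ := by
  have hm1 := measurable_nthDist hX.measurable t 1
  have hmn := measurable_nthDist hX.measurable t n
  -- At level `k` the rounded distances take countably many values and are constants on each fibre.
  have key : ∀ k, ∫⁻ ω, φ (nthDist X t 1 ω, nthDist X t n ω) *
        expNeg (pointSum X (radialTail t h (dyadicAbove k (nthDist X t 1 ω))
          (dyadicAbove k (nthDist X t n ω))) ω) ∂μ =
      ∫⁻ ω, φ (nthDist X t 1 ω, nthDist X t n ω) *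
        expNeg (tailExponent lam t h (dyadicAbove k (nthDist X t 1 ω))
          (dyadicAbove k (nthDist X t n ω))) ∂μ := by
    intro k
    have hfl : Measurable fun x : ℝ => ⌊2 ^ k * x⌋₊ := by fun_prop
    refine lintegral_congr_of_fibers
      (g := fun ω => (⌊2 ^ k * nthDist X t 1 ω⌋₊, ⌊2 ^ k * nthDist X t n ω⌋₊))
      ((hfl.comp hm1).prodMk (hfl.comp hmn)) ?_
    rintro ⟨i, j⟩
    have hset : (fun ω => (⌊2 ^ k * nthDist X t 1 ω⌋₊, ⌊2 ^ k * nthDist X t n ω⌋₊)) ⁻¹' {(i, j)} =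
        {ω | ⌊2 ^ k * nthDist X t 1 ω⌋₊ = i ∧ ⌊2 ^ k * nthDist X t n ω⌋₊ = j} := by
      ext ω
      simp
    have hSm : MeasurableSet
        {ω | ⌊2 ^ k * nthDist X t 1 ω⌋₊ = i ∧ ⌊2 ^ k * nthDist X t n ω⌋₊ = j} :=
      (hm1 (measurableSet_floor_eq k i)).inter (hmn (measurableSet_floor_eq k j))
    have h2 := hX.lintegral_radialTail_of_floor (t := t) hlam hn hm hφ k i j
      (((i : ℝ) + 1) / 2 ^ k)
    rw [hset]
    refine Eq.trans (setLIntegral_congr_fun hSm ?_) (h2.trans (setLIntegral_congr_fun hSm ?_).symm)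
    · rintro ω ⟨rfl, rfl⟩
      rfl
    · rintro ω ⟨rfl, rfl⟩
      rfl
  have hφm : Measurable fun ω => φ (nthDist X t 1 ω, nthDist X t n ω) := hφ.comp (hm1.prodMk hmn)
  -- Both sides of `key` converge as the grid is refined. Right continuity of `h` in its first
  -- argument is available at positive points only, which suffices since `R₁ > 0` almost surely.
  have l1 := tendsto_lintegral_mul_expNeg (μ := μ) hφm (fun ω => hφ1 _)
    (fun k => measurable_pointSum_radialTail (t := t) hX.measurable hm
      ((measurable_dyadicAbove k).comp hm1) ((measurable_dyadicAbove k).comp hmn))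
    (by
      filter_upwards [hX.ae_isGeneric hlam t] with ω hω
      exact tendsto_pointSum_radialTail_dyadicAbove X hanti (nthDist_nonneg X t 1 ω)
        (nthDist_nonneg X t n ω) (fun d hd => hcont d _ hd (hω.nthDist_pos le_rfl)) ω)
  have l2 := tendsto_lintegral_mul_expNeg (μ := μ) hφm (fun ω => hφ1 _)
    (fun k => (measurable_tailExponent (t := t) lam hm).comp
      (((measurable_dyadicAbove k).comp hm1).prodMk ((measurable_dyadicAbove k).comp hmn)))
    (by
      filter_upwards [hX.ae_isGeneric hlam t] with ω hω
      exact tendsto_tailExponent_dyadicAbove lam hm hanti (nthDist_nonneg X t 1 ω)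
        (nthDist_nonneg X t n ω) (fun d hd => hcont d _ hd (hω.nthDist_pos le_rfl)))
  simp only [Function.comp_apply, Function.uncurry] at l1 l2
  simp_rw [key] at l1
  exact tendsto_nhds_unique l1 l2

end Tail

end ISAC

end

noncomputable section

namespace ISAC

open Filter Topology
open scoped ENNReal NNReal

/-! ### The marks of the network -/

section MarkLaw

variable (p : Params)

lemma losProb_pos (r : ℝ) : 0 < losProb p r := Real.exp_pos _

lemma losProb_le_one {r : ℝ} (hr : 0 ≤ r) : losProb p r ≤ 1 :=
  Real.exp_le_one_iff.2 (by have := p.etaB_pos; nlinarith)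

lemma measurable_losProb : Measurable (losProb p) := by
  unfold losProb
  fun_prop

lemma beamProb_pos : 0 < beamProb p := by
  have := p.thetaB_pos
  have h : (0 : ℝ) < p.Nb := by exact_mod_cast p.Nb_pos
  unfold beamProb
  positivity

lemma beamProb_le_one : beamProb p ≤ 1 := by
  rw [beamProb, div_le_one (by positivity)]
  exact p.beams_le

instance isProbabilityMeasure_sigma : IsProbabilityMeasure (expMeasure p.sigmaAv⁻¹) :=
  isProbabilityMeasure_expMeasure (inv_pos.2 p.sigmaAv_pos)

lemma lintegral_bernoulliMeasure_projIcc {q : ℝ} (h0 : 0 ≤ q) (h1 : q ≤ 1) (f : Bool → ℝ≥0∞) :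
    ∫⁻ b, f b ∂(bernoulliMeasure true false (projIcc (0 : ℝ) 1 zero_le_one q)) =
      ENNReal.ofReal q * f true + ENNReal.ofReal (1 - q) * f false := by
  have hq : projIcc (0 : ℝ) 1 zero_le_one q = ⟨q, h0, h1⟩ := projIcc_of_mem _ ⟨h0, h1⟩
  have e1 : (unitInterval.toNNReal (⟨q, h0, h1⟩ : unitInterval) : ℝ≥0∞) = ENNReal.ofReal q := by
    rw [ENNReal.ofReal_eq_coe_nnreal h0]; rfl
  have e2 : (unitInterval.toNNReal (unitInterval.symm (⟨q, h0, h1⟩ : unitInterval)) : ℝ≥0∞) =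
      ENNReal.ofReal (1 - q) := by
    rw [ENNReal.ofReal_eq_coe_nnreal (sub_nonneg.2 h1)]; rfl
  rw [bernoulliMeasure_def, lintegral_add_measure, hq]
  simp only [lintegral_smul_measure, lintegral_dirac]
  rw [← e1, ← e2]
  rfl

lemma lintegral_markLaw (t x : Plane) {f : Mark → ℝ≥0∞} (hf : Measurable f) :
    ∫⁻ m, f m ∂markLaw p t x =
      ENNReal.ofReal (losProb p (dist x t)) *
          (ENNReal.ofReal (beamProb p) * ∫⁻ σ, f (true, true, σ) ∂expMeasure p.sigmaAv⁻¹ +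
            ENNReal.ofReal (1 - beamProb p) * ∫⁻ σ, f (true, false, σ) ∂expMeasure p.sigmaAv⁻¹) +
        ENNReal.ofReal (1 - losProb p (dist x t)) *
          (ENNReal.ofReal (beamProb p) * ∫⁻ σ, f (false, true, σ) ∂expMeasure p.sigmaAv⁻¹ +
            ENNReal.ofReal (1 - beamProb p) *
              ∫⁻ σ, f (false, false, σ) ∂expMeasure p.sigmaAv⁻¹) := by
  have h : ∀ b : Bool, ∫⁻ z, f (b, z) ∂((bernoulliMeasure true false
      (projIcc (0 : ℝ) 1 zero_le_one (beamProb p))).prod (expMeasure p.sigmaAv⁻¹)) =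
      ENNReal.ofReal (beamProb p) * ∫⁻ σ, f (b, true, σ) ∂expMeasure p.sigmaAv⁻¹ +
        ENNReal.ofReal (1 - beamProb p) * ∫⁻ σ, f (b, false, σ) ∂expMeasure p.sigmaAv⁻¹ := by
    intro b
    rw [lintegral_prod (fun z => f (b, z)) (hf.comp measurable_prodMk_left).aemeasurable,
      lintegral_bernoulliMeasure_projIcc (beamProb_pos p).le (beamProb_le_one p)
        fun b' => ∫⁻ σ, f (b, b', σ) ∂expMeasure p.sigmaAv⁻¹]
  rw [markLaw, lintegral_prod _ hf.aemeasurable, lintegral_bernoulliMeasure_projIcc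
    (losProb_pos p _).le (losProb_le_one p dist_nonneg) fun b => ∫⁻ z, f (b, z)
      ∂((bernoulliMeasure true false
      (projIcc (0 : ℝ) 1 zero_le_one (beamProb p))).prod (expMeasure p.sigmaAv⁻¹)), h, h]

instance isProbabilityMeasure_markLaw (t x : Plane) : IsProbabilityMeasure (markLaw p t x) := by
  unfold markLaw
  infer_instance

/-- The law of the marks as a kernel. -/
def markLawKernel (t : Plane) : Kernel Plane Mark where
  toFun := markLaw p t
  measurable' := by
    refine Measure.measurable_of_measurable_coe _ fun B hB => ?_
    have h : (fun x => markLaw p t x B) = fun x => ∫⁻ m, B.indicator 1 m ∂markLaw p t x := by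
      ext x
      rw [lintegral_indicator_one hB]
    rw [h]
    simp_rw [lintegral_markLaw p t _ (measurable_one.indicator hB)]
    have := measurable_losProb p
    fun_prop

instance isMarkovKernel_markLawKernel (t : Plane) : IsMarkovKernel (markLawKernel p t) :=
  ⟨fun x => isProbabilityMeasure_markLaw p t x⟩

/-- Exponential tilting: `exp (-cσ)` times the density of rate `r` is `r / (r + c)` times the
density of rate `r + c`. -/
lemma lintegral_expMeasure_expNeg {r c : ℝ} (hr : 0 < r) (hc : 0 ≤ c) :
    ∫⁻ σ, expNeg (ENNReal.ofReal (c * σ)) ∂expMeasure r = ENNReal.ofReal (r / (r + c)) := by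
  have hrc : 0 < r + c := by linarith
  have hpm : ∀ r, Measurable (exponentialPDF r) := fun r =>
    (measurable_exponentialPDFReal r).ennreal_ofReal
  have hμ : expMeasure r = volume.withDensity (exponentialPDF r) := rfl
  have hm : Measurable fun σ : ℝ => expNeg (ENNReal.ofReal (c * σ)) :=
    measurable_expNeg.comp (by fun_prop)
  rw [hμ, lintegral_withDensity_eq_lintegral_mul _ (hpm r) hm]
  have : ∀ σ, (exponentialPDF r * fun σ => expNeg (ENNReal.ofReal (c * σ))) σ =
      ENNReal.ofReal (r / (r + c)) * exponentialPDF (r + c) σ := by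
    intro σ
    rw [Pi.mul_apply, exponentialPDF_eq, exponentialPDF_eq]
    split_ifs with h
    · rw [expNeg_ofReal (mul_nonneg hc h), ← ENNReal.ofReal_mul (by positivity),
        ← ENNReal.ofReal_mul (by positivity), mul_assoc, ← Real.exp_add, ← mul_assoc,
        div_mul_cancel₀ _ hrc.ne']
      congr 3
      ring
    · simp
  rw [lintegral_congr this, lintegral_const_mul _ (hpm _), lintegral_exponentialPDF_eq_one hrc,
    mul_one]

lemma expMeasure_ae_nonneg {r : ℝ} : ∀ᵐ σ ∂expMeasure r, 0 ≤ σ := by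
  have hμ : expMeasure r = volume.withDensity (exponentialPDF r) := rfl
  have h : (expMeasure r) (Iio 0) = 0 := by
    rw [hμ, withDensity_apply _ measurableSet_Iio]
    rw [setLIntegral_congr_fun (g := fun _ => 0) measurableSet_Iio fun σ (hσ : σ < 0) => by
      simp [exponentialPDF_eq, not_le.2 hσ]]
    simp
  rw [ae_iff]
  convert h using 2
  ext σ
  simp

/-- The contribution of a base station at `x` with mark `m`. -/
def echo (t : Plane) (D : Set ℝ) (x : Plane) (m : Mark) : ℝ :=
  open Classical in
  if m.1 = true ∧ m.2.1 = true ∧ dist x t ∈ D then m.2.2 * dist x t ^ (-p.alphaL) else 0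

/-- The expected loss `1 - 𝔼 exp (-c σ d ^ (-α))` over the marks of a base station at distance
`d`. -/
def markLoss (c d : ℝ) : ℝ :=
  beamProb p * losProb p d * (1 - 1 / (1 + c * d ^ (-p.alphaL) * p.sigmaAv))

/-- The number `h` with `exp (-h) = 1 - markLoss p c d`. -/
def markCost (c d : ℝ) : ℝ≥0∞ := ENNReal.ofReal (-Real.log (1 - markLoss p c d))

lemma measurable_markLoss : Measurable (Function.uncurry (markLoss p)) := by
  unfold markLoss losProb Function.uncurry
  fun_prop

lemma measurable_markCost : Measurable (Function.uncurry (markCost p)) :=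
  ENNReal.measurable_ofReal.comp
    ((Real.measurable_log.comp (measurable_const.sub (measurable_markLoss p))).neg)

variable {p} {c d : ℝ}

lemma markArg_nonneg (hc : 0 ≤ c) (hd : 0 ≤ d) : 0 ≤ c * d ^ (-p.alphaL) * p.sigmaAv := by
  have := p.sigmaAv_pos
  positivity

lemma markLoss_nonneg (hc : 0 ≤ c) (hd : 0 ≤ d) : 0 ≤ markLoss p c d := by
  have h := markArg_nonneg (p := p) hc hd
  have h1 := beamProb_pos p
  have h2 := losProb_pos p d
  have h3 : 0 ≤ 1 - 1 / (1 + c * d ^ (-p.alphaL) * p.sigmaAv) := by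
    rw [sub_nonneg, div_le_one (by positivity)]
    linarith
  unfold markLoss
  positivity

/-- Strictness keeps the argument of the logarithm in `markCost` positive; at zero the convention
`Real.log 0 = 0` would falsify `expNeg_markCost`. -/
lemma markLoss_lt_one (hc : 0 ≤ c) (hd : 0 ≤ d) : markLoss p c d < 1 := by
  have h := markArg_nonneg (p := p) hc hd
  have h1 := beamProb_pos p
  have h2 := losProb_pos p d
  have h3 : 0 < 1 / (1 + c * d ^ (-p.alphaL) * p.sigmaAv) := by positivity
  have h4 : beamProb p * losProb p d ≤ 1 :=
    mul_le_one₀ (beamProb_le_one p) h2.le (losProb_le_one p hd)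
  unfold markLoss
  have h5 : 0 < beamProb p * losProb p d := by positivity
  nlinarith

lemma expNeg_markCost (hc : 0 ≤ c) (hd : 0 ≤ d) :
    expNeg (markCost p c d) = ENNReal.ofReal (1 - markLoss p c d) := by
  have h1 := markLoss_nonneg (p := p) hc hd
  have h2 := markLoss_lt_one (p := p) hc hd
  have hlog : Real.log (1 - markLoss p c d) ≤ 0 := Real.log_nonpos (by linarith) (by linarith)
  rw [markCost, expNeg_ofReal (by linarith), neg_neg, Real.exp_log (by linarith)]

lemma markLoss_mono {c' : ℝ} (hc : 0 ≤ c) (hcc : c ≤ c') (hd : 0 ≤ d) :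
    markLoss p c d ≤ markLoss p c' d := by
  have h := markArg_nonneg (p := p) hc hd
  have h1 := beamProb_pos p
  have h2 := losProb_pos p d
  have h3 := p.sigmaAv_pos
  unfold markLoss
  gcongr

lemma markCost_mono {c' : ℝ} (hc : 0 ≤ c) (hcc : c ≤ c') (hd : 0 ≤ d) :
    markCost p c d ≤ markCost p c' d := by
  refine ENNReal.ofReal_le_ofReal (neg_le_neg (Real.log_le_log ?_ ?_))
  · linarith [markLoss_lt_one (p := p) (hc.trans hcc) hd]
  · linarith [markLoss_mono (p := p) hc hcc hd]

lemma continuousAt_markCost (hc : 0 ≤ c) (hd : 0 ≤ d) :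
    ContinuousAt (fun c => markCost p c d) c := by
  have h := markArg_nonneg (p := p) hc hd
  have h2 := markLoss_lt_one (p := p) hc hd
  have h3 : ContinuousAt (fun c => markLoss p c d) c := by
    unfold markLoss
    refine ContinuousAt.mul continuousAt_const (ContinuousAt.sub continuousAt_const ?_)
    refine ContinuousAt.div continuousAt_const (by fun_prop) (by positivity)
  exact ENNReal.continuous_ofReal.continuousAt.comp
    ((continuousAt_const.sub h3).log (show 1 - markLoss p c d ≠ 0 by linarith)).neg

/-- Only a line-of-sight station that illuminates the target echoes; the other three combinations of
Boolean marks contribute the integrand `1`. The exponential cross section gives `1 / (1 + c d^(-α)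
σ_av)`. -/
lemma lintegral_markLaw_expNeg_echo (t x : Plane) (D : Set ℝ) (hc : 0 ≤ c) :
    ∫⁻ m, expNeg (ENNReal.ofReal c * ENNReal.ofReal (echo p t D x m)) ∂markLaw p t x =
      expNeg (D.indicator (markCost p c) (dist x t)) := by
  by_cases hD : dist x t ∈ D
  swap
  · simp [echo, hD]
  have hσ := p.sigmaAv_pos
  set d := dist x t with hd
  have hd0 : 0 ≤ d := dist_nonneg
  have harg := markArg_nonneg (p := p) hc hd0
  have hmeas : Measurable fun m => expNeg (ENNReal.ofReal c * ENNReal.ofReal (echo p t D x m)) := by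
    refine measurable_expNeg.comp (measurable_const.mul (ENNReal.measurable_ofReal.comp ?_))
    unfold echo
    refine Measurable.ite ?_ (by fun_prop) measurable_const
    have hb : MeasurableSet {m : Mark | m.1 = true} := measurable_fst (measurableSet_singleton true)
    have hb2 : MeasurableSet {m : Mark | m.2.1 = true} :=
      (measurable_fst.comp measurable_snd) (measurableSet_singleton true)
    exact hb.inter (hb2.inter (MeasurableSet.const _))
  rw [lintegral_markLaw p t x hmeas, indicator_of_mem hD, expNeg_markCost hc hd0, ← hd]
  have e1 : ∫⁻ σ, expNeg (ENNReal.ofReal c * ENNReal.ofReal (echo p t D x (true, true, σ)))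
      ∂expMeasure p.sigmaAv⁻¹ =
      ENNReal.ofReal (1 / (1 + c * d ^ (-p.alphaL) * p.sigmaAv)) := by
    have : ∀ σ, expNeg (ENNReal.ofReal c * ENNReal.ofReal (echo p t D x (true, true, σ))) =
        expNeg (ENNReal.ofReal (c * d ^ (-p.alphaL) * σ)) := by
      intro σ
      rw [← ENNReal.ofReal_mul hc]
      simp only [echo, ← hd, hD, and_self, if_true]
      congr 2
      ring
    rw [lintegral_congr this, lintegral_expMeasure_expNeg (inv_pos.2 hσ) (by positivity)]
    congr 1
    field_simp
  have hl0 := losProb_pos p d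
  have hl1 := losProb_le_one p hd0
  have hb0 := beamProb_pos p
  have hb1 := beamProb_le_one p
  rw [e1]
  simp only [echo, ← hd, Bool.false_eq_true, false_and, and_false, if_false, ENNReal.ofReal_zero,
    mul_zero, expNeg_zero, lintegral_const, measure_univ, mul_one]
  rw [← ENNReal.ofReal_mul hb0.le, ← ENNReal.ofReal_add (by positivity) (by linarith),
    ← ENNReal.ofReal_add hb0.le (by linarith), ← ENNReal.ofReal_mul hl0.le,
    ← ENNReal.ofReal_mul (by linarith), ← ENNReal.ofReal_add]
  · congr 1
    unfold markLoss
    ring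
  · have : 0 ≤ 1 - beamProb p := by linarith
    positivity
  · have : 0 ≤ 1 - losProb p d := by linarith
    have : 0 ≤ 1 - beamProb p := by linarith
    positivity

lemma markLaw_ae_nonneg (t x : Plane) : ∀ᵐ m ∂markLaw p t x, 0 ≤ m.2.2 := by
  have hm : MeasurableSet {m : Mark | m.2.2 < 0} :=
    measurableSet_lt (by fun_prop) measurable_const
  have h0 : (expMeasure p.sigmaAv⁻¹) {σ | σ < 0} = 0 := by
    have := expMeasure_ae_nonneg (r := p.sigmaAv⁻¹)
    rw [ae_iff] at this
    simpa using this
  have h := lintegral_markLaw p t x (measurable_one.indicator hm)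
  have h1 : ∀ b b' : Bool, ∫⁻ σ, ({m : Mark | m.2.2 < 0}.indicator 1 (b, b', σ) : ℝ≥0∞)
      ∂expMeasure p.sigmaAv⁻¹ = 0 := by
    intro b b'
    have : (fun σ => ({m : Mark | m.2.2 < 0}.indicator 1 (b, b', σ) : ℝ≥0∞)) =
        {σ : ℝ | σ < 0}.indicator 1 := by
      ext σ
      simp [indicator_apply]
    have hI : MeasurableSet {σ : ℝ | σ < 0} := measurableSet_Iio
    rw [this, lintegral_indicator_one hI, h0]
  rw [lintegral_indicator_one hm] at h
  simp only [h1, mul_zero, add_zero] at h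
  rw [ae_iff]
  simpa using h

end MarkLaw

end ISAC

end

noncomputable section

namespace ISAC

open Filter Topology
open scoped ENNReal NNReal

/-! ### The exponents as radial integrals -/

section Radial

/-- Polar coordinates around `t`, after a translation to the origin. -/
lemma lintegral_radial {lam : ℝ} (hlam : 0 ≤ lam) (t : Plane) {g : ℝ → ℝ}
    (h0 : ∀ y, 0 ≤ y → 0 ≤ g y) (hint : IntegrableOn (fun y => y * g y) (Ioi 0)) :
    ∫⁻ x, ENNReal.ofReal (g (dist x t)) ∂(ENNReal.ofReal lam • volume : Measure Plane) =
      ENNReal.ofReal (lam * (2 * Real.pi * ∫ y in Ioi 0, y * g y)) := by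
  have hdim : Module.finrank ℝ Plane = 2 := by simp
  have hi : Integrable (fun x : Plane => g ‖x‖) := by
    rw [integrable_fun_norm_addHaar, hdim]
    simpa using hint
  have hball : (volume : Measure Plane).real (Metric.ball 0 1) = Real.pi := by
    rw [Measure.real, EuclideanSpace.volume_ball_fin_two]
    simp [Real.pi_pos.le]
  have hval : ∫ x : Plane, g ‖x‖ = 2 * Real.pi * ∫ y in Ioi 0, y * g y := by
    rw [integral_fun_norm_addHaar, hdim, hball]
    simp
    ring
  rw [lintegral_smul_measure, smul_eq_mul, ENNReal.ofReal_mul hlam, ← hval,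
    ofReal_integral_eq_lintegral_ofReal hi (Eventually.of_forall fun x => h0 _ (norm_nonneg x))]
  congr 1
  simp_rw [dist_eq_norm]
  exact lintegral_sub_right_eq_self (fun x : Plane => ENNReal.ofReal (g ‖x‖)) t

variable (p : Params)

lemma integrableOn_mul_losProb : IntegrableOn (fun r => losProb p r * r) (Ioi 0) := by
  have h := integrableOn_rpow_mul_exp_neg_mul_rpow (s := 1) (p := 1) (b := p.etaB) (by norm_num)
    one_pos p.etaB_pos
  refine h.congr_fun (fun r _ => ?_) measurableSet_Ioi
  simp [losProb, mul_comm]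

variable {p} {c : ℝ}

lemma markLoss_le_losProb (hc : 0 ≤ c) {r : ℝ} (hr : 0 ≤ r) : markLoss p c r ≤ losProb p r := by
  have h := markArg_nonneg (p := p) hc hr
  have h1 := beamProb_pos p
  have h2 := losProb_pos p r
  have h3 : 0 ≤ 1 / (1 + c * r ^ (-p.alphaL) * p.sigmaAv) := by positivity
  have h4 : 1 / (1 + c * r ^ (-p.alphaL) * p.sigmaAv) ≤ 1 := by
    rw [div_le_one (by positivity)]; linarith
  unfold markLoss
  have h5 := beamProb_le_one p
  calc beamProb p * losProb p r * (1 - 1 / (1 + c * r ^ (-p.alphaL) * p.sigmaAv))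
      ≤ 1 * losProb p r * 1 := by
        gcongr
        linarith
    _ = losProb p r := by ring

/-- Blockage alone provides integrability: the loss is at most the line-of-sight probability `exp
(-η r)`. Hence no lower bound on the path-loss exponent is needed beyond positivity. -/
lemma integrableOn_markLoss_mul (hc : 0 ≤ c) :
    IntegrableOn (fun r => markLoss p c r * r) (Ioi 0) := by
  refine (integrableOn_mul_losProb p).mono' ?_ ?_
  · exact (((measurable_markLoss p).comp measurable_prodMk_left).mul measurable_id
      ).aestronglyMeasurable
  · refine (ae_restrict_iff' measurableSet_Ioi).2 (Eventually.of_forall fun r (hr : 0 < r) => ?_)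
    have h1 := markLoss_nonneg (p := p) hc hr.le
    rw [Real.norm_of_nonneg (by positivity)]
    exact mul_le_mul_of_nonneg_right (markLoss_le_losProb hc hr.le) hr.le

lemma lintegral_one_sub_expNeg_markCost (t : Plane) (hc : 0 ≤ c) {D : Set ℝ}
    (hD : MeasurableSet D) :
    ∫⁻ x, (1 - expNeg (D.indicator (markCost p c) (dist x t)))
        ∂(ENNReal.ofReal p.lamBS • volume : Measure Plane) =
      ENNReal.ofReal (p.lamBS * (2 * Real.pi * ∫ r in Ioi 0 ∩ D, markLoss p c r * r)) := by
  have h1 : ∀ x : Plane, 1 - expNeg (D.indicator (markCost p c) (dist x t)) =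
      ENNReal.ofReal (D.indicator (markLoss p c) (dist x t)) := by
    intro x
    by_cases hx : dist x t ∈ D
    · rw [indicator_of_mem hx, indicator_of_mem hx, expNeg_markCost hc dist_nonneg,
        ← ENNReal.ofReal_one, ← ENNReal.ofReal_sub _ (by
          linarith [markLoss_lt_one (p := p) hc (dist_nonneg (x := x) (y := t))]), sub_sub_cancel]
    · simp [hx]
  have h2 : (fun y => y * D.indicator (markLoss p c) y) =
      D.indicator fun y => markLoss p c y * y := by
    ext y
    by_cases hy : y ∈ D <;> simp [hy, mul_comm]
  have h3 := lintegral_radial p.lamBS_pos.le t (g := D.indicator (markLoss p c))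
    (fun y hy => indicator_apply_nonneg fun _ => markLoss_nonneg hc hy) (by
      rw [h2]
      exact (integrableOn_markLoss_mul hc).indicator hD)
  rw [lintegral_congr h1, h3, h2, setIntegral_indicator hD]

end Radial

/-! ### The explicit expressions -/

section Explicit

variable (p : Params)

/-- The factor in front of the sum of the echoes. -/
def echoGain (r₁ : ℝ) : ℝ :=
  p.Ps * p.Gm ^ 2 * p.wavelength ^ 2 / ((4 * Real.pi) ^ 3 * r₁ ^ p.alphaL)

lemma echoGain_nonneg {r₁ : ℝ} (h : 0 ≤ r₁) : 0 ≤ echoGain p r₁ := by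
  have := p.Ps_nonneg
  unfold echoGain
  positivity

lemma measurable_echoGain : Measurable (echoGain p) := by
  unfold echoGain
  fun_prop

lemma echoGain_antitoneOn : AntitoneOn (echoGain p) (Ioi 0) := by
  intro a (ha : 0 < a) b _ hab
  have := p.Ps_nonneg
  have := p.alphaL_pos
  unfold echoGain
  gcongr

lemma continuousAt_echoGain {r : ℝ} (hr : 0 < r) : ContinuousAt (echoGain p) r := by
  unfold echoGain
  refine ContinuousAt.div continuousAt_const (ContinuousAt.mul continuousAt_const
    (Real.continuousAt_rpow_const _ _ (Or.inl hr.ne'))) ?_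
  have := Real.rpow_pos_of_pos hr p.alphaL
  positivity

lemma markLoss_eq_lossFactor (r₁ s : ℝ) {r : ℝ} (hr : 0 ≤ r) :
    markLoss p (s * echoGain p r₁) r = beamProb p * losProb p r * lossFactor p r₁ s r := by
  rw [markLoss, lossFactor, echoGain, Real.rpow_neg hr]
  congr 4
  simp only [div_eq_mul_inv, mul_inv]
  ring

/-- The cost of a base station at distance `d`, when the sensing one is at distance `a`. -/
def echoCost (s a d : ℝ) : ℝ≥0∞ := markCost p (s * echoGain p a) d

lemma measurable_echoCost (s : ℝ) : Measurable (Function.uncurry (echoCost p s)) :=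
  (measurable_markCost p).comp
    (((measurable_echoGain p).comp measurable_fst).const_mul s |>.prodMk measurable_snd)

variable {p} {s : ℝ}

/-- A more distant sensing station receives weaker echoes. Together with `tendsto_echoCost` this
supplies the monotonicity and right continuity that rounding `R₁` upwards demands. -/
lemma antitoneOn_echoCost (hs : 0 ≤ s) {d : ℝ} (hd : 0 ≤ d) :
    AntitoneOn (fun a => echoCost p s a d) (Ioi 0) := fun _ ha _ hb hab =>
  markCost_mono (mul_nonneg hs (echoGain_nonneg p (le_of_lt hb)))
    (mul_le_mul_of_nonneg_left (echoGain_antitoneOn p ha hb hab) hs) hd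

lemma tendsto_echoCost (hs : 0 ≤ s) {d r : ℝ} (hd : 0 ≤ d) (hr : 0 < r) :
    Tendsto (fun a => echoCost p s a d) (𝓝[>] r) (𝓝 (echoCost p s r d)) := by
  have h : ContinuousAt (fun a => echoCost p s a d) r :=
    ContinuousAt.comp (f := fun a => s * echoGain p a) (g := fun c => markCost p c d)
      (continuousAt_markCost (mul_nonneg hs (echoGain_nonneg p hr.le)) hd)
      ((continuousAt_echoGain p hr).const_mul s)
  exact h.tendsto.mono_left nhdsWithin_le_nhds

lemma echoCost_mono {s' a d : ℝ} (hs : 0 ≤ s) (hss : s ≤ s') (ha : 0 ≤ a) (hd : 0 ≤ d) :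
    echoCost p s a d ≤ echoCost p s' a d :=
  markCost_mono (mul_nonneg hs (echoGain_nonneg p ha))
    (mul_le_mul_of_nonneg_right hss (echoGain_nonneg p ha)) hd

lemma expNeg_echoCost {a d : ℝ} (hs : 0 ≤ s) (ha : 0 ≤ a) (hd : 0 ≤ d) :
    expNeg (echoCost p s a d) =
      ENNReal.ofReal (1 - beamProb p * losProb p d * lossFactor p a s d) := by
  rw [echoCost, expNeg_markCost (mul_nonneg hs (echoGain_nonneg p ha)) hd,
    markLoss_eq_lossFactor p a s hd]

/-- The `2π` of polar coordinates cancels the denominator of `beamProb`. -/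
lemma integral_markLoss_eq (a s : ℝ) {ρ : ℝ} (hρ : 0 ≤ ρ) :
    p.lamBS * (2 * Real.pi * ∫ r in Ioi ρ, markLoss p (s * echoGain p a) r * r) =
      p.lamBS * p.Nb * p.thetaB * ∫ r in Ioi ρ, losProb p r * lossFactor p a s r * r := by
  have : ∫ r in Ioi ρ, markLoss p (s * echoGain p a) r * r =
      beamProb p * ∫ r in Ioi ρ, losProb p r * lossFactor p a s r * r := by
    rw [← integral_const_mul]
    refine setIntegral_congr_fun measurableSet_Ioi fun r (hr : ρ < r) => ?_
    rw [markLoss_eq_lossFactor p a s (hρ.trans hr.le)]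
    ring
  rw [this, beamProb]
  have := Real.pi_pos
  field_simp

lemma integral_markLoss_nonneg {c ρ : ℝ} (hc : 0 ≤ c) (hρ : 0 ≤ ρ) :
    0 ≤ p.lamBS * (2 * Real.pi * ∫ r in Ioi ρ, markLoss p c r * r) := by
  have := p.lamBS_pos
  have h : 0 ≤ ∫ r in Ioi ρ, markLoss p c r * r :=
    setIntegral_nonneg measurableSet_Ioi fun r (hr : ρ < r) =>
      mul_nonneg (markLoss_nonneg hc (hρ.trans hr.le)) (hρ.trans hr.le)
  positivity

/-- The intensity does not see the rim, so the open and the closed tail share one generating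
functional. -/
lemma expNeg_lintegral_eq_pgflFactor (t : Plane) {a ρ : ℝ} (hs : 0 ≤ s) (ha : 0 ≤ a) (hρ : 0 ≤ ρ)
    {D : Set ℝ} (hDm : MeasurableSet D) (hD : D =ᵐ[volume] Ioi ρ) :
    expNeg (∫⁻ x, (1 - expNeg (D.indicator (echoCost p s a) (dist x t)))
        ∂(ENNReal.ofReal p.lamBS • volume : Measure Plane)) =
      ENNReal.ofReal (pgflFactor p a s ρ) := by
  have hc := mul_nonneg hs (echoGain_nonneg p ha)
  have h := lintegral_one_sub_expNeg_markCost (p := p) t hc hDm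
  have hset : (Ioi 0 ∩ D : Set ℝ) =ᵐ[volume] Ioi ρ := by
    have h2 := (ae_eq_refl (Ioi (0 : ℝ))).inter hD
    rwa [Ioi_inter_Ioi, max_eq_right hρ] at h2
  rw [setIntegral_congr_set hset] at h
  change expNeg (∫⁻ x, (1 - expNeg (D.indicator (markCost p (s * echoGain p a)) (dist x t)))
        ∂(ENNReal.ofReal p.lamBS • volume : Measure Plane)) = _
  rw [h, expNeg_ofReal (integral_markLoss_nonneg hc hρ), integral_markLoss_eq a s hρ, pgflFactor]

lemma expNeg_tailExponent (t : Plane) {a ρ : ℝ} (hs : 0 ≤ s) (ha : 0 ≤ a) (hρ : 0 ≤ ρ) :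
    expNeg (tailExponent p.lamBS t (echoCost p s) a ρ) = ENNReal.ofReal (pgflFactor p a s ρ) :=
  expNeg_lintegral_eq_pgflFactor t hs ha hρ measurableSet_Ioi (ae_eq_refl _)

lemma tailExponent_mono (t : Plane) {s' a : ℝ} (hs : 0 ≤ s) (hss : s ≤ s') (ha : 0 ≤ a) (ρ : ℝ) :
    tailExponent p.lamBS t (echoCost p s) a ρ ≤ tailExponent p.lamBS t (echoCost p s') a ρ :=
  lintegral_mono fun _ => tsub_le_tsub_left (antitone_expNeg
    (indicator_le_indicator (echoCost_mono hs hss ha dist_nonneg))) _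

lemma lintegral_radiusKernel {n : ℕ} (hn : 1 ≤ n) {a : ℝ} (ha : 0 ≤ a) {G : ℝ → ℝ≥0∞}
    (hG : Measurable G) (hG1 : ∀ ρ, G ρ ≤ 1) :
    ∫⁻ ρ, G ρ ∂radiusKernel p n a =
      ENNReal.ofReal (∫ ρ in Ioi a, (G ρ).toReal * condDensity p n a ρ) := by
  have hdm : Measurable (condDensity p n a) :=
    (measurable_condDensity p n).comp measurable_prodMk_left
  have hGt : ∀ ρ, G ρ ≠ ∞ := fun ρ => ne_top_of_le_ne_top ENNReal.one_ne_top (hG1 ρ)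
  have hint : Integrable fun ρ => (G ρ).toReal * condDensity p n a ρ := by
    have hd : Integrable (condDensity p n a) := by
      refine ⟨hdm.aestronglyMeasurable, ?_⟩
      rw [hasFiniteIntegral_iff_ofReal (Eventually.of_forall fun ρ => condDensity_nonneg p n ha),
        lintegral_condDensity p hn ha]
      exact ENNReal.one_lt_top
    refine hd.mono' (hG.ennreal_toReal.mul hdm).aestronglyMeasurable
      (Eventually.of_forall fun ρ => ?_)
    have h1 := condDensity_nonneg p n (ρ := ρ) ha
    rw [Real.norm_of_nonneg (mul_nonneg ENNReal.toReal_nonneg h1)]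
    refine mul_le_of_le_one_left h1 ?_
    simpa using ENNReal.toReal_mono ENNReal.one_ne_top (hG1 ρ)
  -- The density vanishes off `[a, ∞)` but not necessarily at `a`, so `Ioi a` is first enlarged to
  -- `Ici a`.
  rw [radiusKernel_eq p n ha, lintegral_withDensity_eq_lintegral_mul _ hdm.ennreal_ofReal hG,
    ← integral_Ici_eq_integral_Ioi, setIntegral_eq_integral_of_forall_compl_eq_zero]
  · rw [ofReal_integral_eq_lintegral_ofReal hint (Eventually.of_forall fun ρ =>
      mul_nonneg ENNReal.toReal_nonneg (condDensity_nonneg p n ha))]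
    refine lintegral_congr fun ρ => ?_
    rw [Pi.mul_apply, ENNReal.ofReal_mul ENNReal.toReal_nonneg, ENNReal.ofReal_toReal (hGt ρ),
      mul_comm]
  · intro ρ hρ
    rw [condDensity_of_lt p n (not_le.1 hρ), mul_zero]

lemma pgflFactor_nonneg (a s ρ : ℝ) : 0 ≤ pgflFactor p a s ρ := Real.exp_nonneg _

lemma lintegral_radiusKernel_explicitLT (t : Plane) {n : ℕ} (hn : 1 ≤ n) {a : ℝ} (ha : 0 ≤ a)
    (hs : 0 ≤ s) :
    ∫⁻ ρ, expNeg (tailExponent p.lamBS t (echoCost p s) a ρ) ∂radiusKernel p n a =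
      ENNReal.ofReal (explicitLT p n a s) := by
  rw [lintegral_radiusKernel hn ha
    (G := fun ρ => expNeg (tailExponent p.lamBS t (echoCost p s) a ρ)) (measurable_expNeg.comp
    ((measurable_tailExponent p.lamBS (measurable_echoCost p s)).comp measurable_prodMk_left))
    fun ρ => expNeg_le_one _]
  rw [explicitLT]
  congr 1
  refine setIntegral_congr_fun measurableSet_Ioi fun ρ (hρ : a < ρ) => ?_
  rw [expNeg_tailExponent t hs ha (ha.trans hρ.le), ENNReal.toReal_ofReal (pgflFactor_nonneg _ _ _)]

lemma lintegral_radiusKernel_explicitLTWithRim (t : Plane) {n : ℕ} (hn : 1 ≤ n) {a : ℝ}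
    (ha : 0 ≤ a) (hs : 0 ≤ s) :
    ∫⁻ ρ, expNeg (echoCost p s a ρ) * expNeg (tailExponent p.lamBS t (echoCost p s) a ρ)
        ∂radiusKernel p n a =
      ENNReal.ofReal (explicitLTWithRim p n a s) := by
  rw [lintegral_radiusKernel hn ha (G := fun ρ => expNeg (echoCost p s a ρ) *
    expNeg (tailExponent p.lamBS t (echoCost p s) a ρ))
    ((measurable_expNeg.comp ((measurable_echoCost p s).comp
    measurable_prodMk_left)).mul (measurable_expNeg.comp
    ((measurable_tailExponent p.lamBS (measurable_echoCost p s)).comp measurable_prodMk_left)))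
    fun ρ => mul_le_one' (expNeg_le_one _) (expNeg_le_one _)]
  rw [explicitLTWithRim]
  congr 1
  refine setIntegral_congr_fun measurableSet_Ioi fun ρ (hρ : a < ρ) => ?_
  have hρ0 := ha.trans hρ.le
  have h1 := markLoss_lt_one (p := p) (mul_nonneg hs (echoGain_nonneg p ha)) hρ0
  rw [markLoss_eq_lossFactor p a s hρ0] at h1
  rw [expNeg_tailExponent t hs ha hρ0, expNeg_echoCost hs ha hρ0, ENNReal.toReal_mul,
    ENNReal.toReal_ofReal (pgflFactor_nonneg _ _ _), ENNReal.toReal_ofReal (by linarith)]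

lemma explicitLT_nonneg (n : ℕ) {a : ℝ} (ha : 0 ≤ a) (s : ℝ) : 0 ≤ explicitLT p n a s :=
  setIntegral_nonneg measurableSet_Ioi fun _ _ =>
    mul_nonneg (pgflFactor_nonneg _ _ _) (condDensity_nonneg p n ha)

lemma explicitLTWithRim_nonneg (n : ℕ) {a : ℝ} (ha : 0 ≤ a) (hs : 0 ≤ s) :
    0 ≤ explicitLTWithRim p n a s := by
  refine setIntegral_nonneg measurableSet_Ioi fun ρ (hρ : a < ρ) => ?_
  have hρ0 := ha.trans hρ.le
  have h1 := markLoss_lt_one (p := p) (mul_nonneg hs (echoGain_nonneg p ha)) hρ0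
  rw [markLoss_eq_lossFactor p a s hρ0] at h1
  exact mul_nonneg (mul_nonneg (by linarith) (pgflFactor_nonneg _ _ _)) (condDensity_nonneg p n ha)

end Explicit

end ISAC

end

noncomputable section

namespace ISAC

open Filter Topology
open scoped ENNReal NNReal

/-! ### Conditional Laplace transforms -/

section CondLaplace

variable {Ω : Type*} [MeasurableSpace Ω] {μ : Measure Ω} [IsProbabilityMeasure μ]

lemma measurable_expNeg_ofReal_mul (s : ℝ) :
    Measurable fun y : ℝ => expNeg (ENNReal.ofReal (s * y)) :=
  measurable_expNeg.comp (by fun_prop)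

lemma continuous_lintegral_expNeg (ν : Measure ℝ) [IsFiniteMeasure ν] :
    Continuous fun s : ℝ => ∫⁻ y, expNeg (ENNReal.ofReal (s * y)) ∂ν := by
  refine continuous_iff_continuousAt.2 fun s => ?_
  refine tendsto_lintegral_filter_of_dominated_convergence (fun _ => 1)
    (Eventually.of_forall fun s => measurable_expNeg_ofReal_mul s)
    (Eventually.of_forall fun s => Eventually.of_forall fun y => expNeg_le_one _) (by simp)
    (Eventually.of_forall fun y => ?_)
  exact (continuous_expNeg.comp (ENNReal.continuous_ofReal.comp
    (continuous_id.mul continuous_const))).tendsto s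

/-- A continuous and an antitone function on `[0, ∞)` agree if they agree at the rationals. -/
lemma eq_of_forall_rat_eq {L J : ℝ → ℝ≥0∞} (hL : Continuous L) (hJ : AntitoneOn J (Ici 0))
    (h : ∀ q : ℚ, 0 ≤ q → L q = J q) {s : ℝ} (hs : 0 ≤ s) : L s = J s := by
  rcases hs.eq_or_lt with rfl | hs0
  · simpa using h 0 le_rfl
  refine le_antisymm ?_ ?_
  -- If `J s < L s`, then `J s < L q = J q` for a rational `q` slightly above `s`, against
  -- monotonicity. The other case uses a rational slightly below `s`.
  · by_contra hlt
    obtain ⟨l, u, ⟨_, hu⟩, hsub⟩ := mem_nhds_iff_exists_Ioo_subset.1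
      (hL.continuousAt.eventually (lt_mem_nhds (not_le.1 hlt)))
    obtain ⟨q, hq1, hq2⟩ := exists_rat_btwn hu
    have hq0 : (0 : ℝ) ≤ q := hs.trans hq1.le
    have h1 : J s < L q := hsub ⟨by linarith, hq2⟩
    rw [h q (by exact_mod_cast hq0)] at h1
    exact absurd (hJ hs hq0 hq1.le) (not_le.2 h1)
  · by_contra hlt
    obtain ⟨l, u, ⟨hl, _⟩, hsub⟩ := mem_nhds_iff_exists_Ioo_subset.1
      (hL.continuousAt.eventually (gt_mem_nhds (not_le.1 hlt)))
    obtain ⟨q, hq1, hq2⟩ := exists_rat_btwn (max_lt hl hs0)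
    have hq0 : (0 : ℝ) ≤ q := (le_max_right _ _).trans hq1.le
    have h1 : L q < J s := hsub ⟨(le_max_left _ _).trans_lt hq1, by linarith⟩
    rw [h q (by exact_mod_cast hq0)] at h1
    exact absurd (hJ hq0 hs hq2.le) (not_le.2 h1)

/-- A function of `R` is determined almost everywhere by its integrals over the events `R ∈ A`, and
`condDistrib` disintegrates the joint law of `R` and `I`. -/
lemma lintegral_condDistrib_ae_eq {R I : Ω → ℝ} (hR : Measurable R) (hI : AEMeasurable I μ)
    {f : ℝ → ℝ≥0∞} (hf : Measurable f) {J : ℝ → ℝ≥0∞} (hJ : Measurable J)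
    (h : ∀ A, MeasurableSet A → ∫⁻ ω, A.indicator 1 (R ω) * f (I ω) ∂μ =
      ∫⁻ ω, A.indicator 1 (R ω) * J (R ω) ∂μ) :
    ∀ᵐ ω ∂μ, ∫⁻ y, f y ∂condDistrib I R μ (R ω) = J (R ω) := by
  have : IsProbabilityMeasure (μ.map R) := Measure.isProbabilityMeasure_map hR.aemeasurable
  refine ae_of_ae_map hR.aemeasurable (p := fun a => ∫⁻ y, f y ∂condDistrib I R μ a = J a) ?_
  have hLm : Measurable fun a => ∫⁻ y, f y ∂condDistrib I R μ a := hf.lintegral_kernel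
  refine ae_eq_of_forall_setLIntegral_eq_of_sigmaFinite hLm hJ fun A hA _ => ?_
  have hAm : Measurable (A.indicator (1 : ℝ → ℝ≥0∞)) := measurable_one.indicator hA
  have hg : Measurable fun z : ℝ × ℝ => A.indicator 1 z.1 * f z.2 :=
    (hAm.comp measurable_fst).mul (hf.comp measurable_snd)
  have h1 : ∫⁻ z, A.indicator 1 z.1 * f z.2 ∂(μ.map R ⊗ₘ condDistrib I R μ) =
      ∫⁻ ω, A.indicator 1 (R ω) * f (I ω) ∂μ := by
    rw [compProd_map_condDistrib hI, lintegral_map' hg.aemeasurable (hR.aemeasurable.prodMk hI)]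
  have ind : ∀ (G : ℝ → ℝ≥0∞), ∫⁻ a in A, G a ∂μ.map R =
      ∫⁻ a, A.indicator 1 a * G a ∂μ.map R := fun G => by
    rw [← lintegral_indicator hA]
    refine lintegral_congr fun a => ?_
    by_cases ha : a ∈ A <;> simp [ha]
  rw [ind, ind, lintegral_map (f := fun a => A.indicator 1 a * J a) (hAm.mul hJ) hR,
    ← h A hA, ← h1, Measure.lintegral_compProd hg]
  exact lintegral_congr fun a => (lintegral_const_mul _ hf).symm

/-- For each `s` the identity holds off a null set depending on `s`. Rational `s` give a common null
set, and `eq_of_forall_rat_eq` extends the identity to all `s ≥ 0`. -/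
lemma ae_integral_exp_condDistrib {R I : Ω → ℝ} (hR : Measurable R) (hR0 : ∀ ω, 0 ≤ R ω)
    (hI : AEMeasurable I μ) (hI0 : ∀ᵐ ω ∂μ, 0 ≤ I ω) {J : ℝ → ℝ → ℝ≥0∞}
    (hJ : ∀ s, 0 ≤ s → Measurable (J s))
    (hanti : ∀ a, 0 ≤ a → AntitoneOn (fun s => J s a) (Ici 0))
    (h : ∀ s, 0 ≤ s → ∀ A, MeasurableSet A →
      ∫⁻ ω, A.indicator 1 (R ω) * expNeg (ENNReal.ofReal (s * I ω)) ∂μ =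
        ∫⁻ ω, A.indicator 1 (R ω) * J s (R ω) ∂μ) :
    ∀ᵐ ω ∂μ, ∀ s : ℝ, 0 ≤ s →
      ∫ y, Real.exp (-(s * y)) ∂condDistrib I R μ (R ω) = (J s (R ω)).toReal := by
  have : IsProbabilityMeasure (μ.map R) := Measure.isProbabilityMeasure_map hR.aemeasurable
  have hrat : ∀ᵐ ω ∂μ, ∀ q : ℚ, 0 ≤ q →
      ∫⁻ y, expNeg (ENNReal.ofReal ((q : ℝ) * y)) ∂condDistrib I R μ (R ω) = J q (R ω) := by
    refine ae_all_iff.2 fun q => ?_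
    by_cases hq : 0 ≤ q
    · have hq' : (0 : ℝ) ≤ q := by exact_mod_cast hq
      filter_upwards [lintegral_condDistrib_ae_eq hR hI (measurable_expNeg_ofReal_mul q)
        (hJ q hq') (h q hq')] with ω hω _ using hω
    · exact Eventually.of_forall fun ω h => absurd h hq
  -- `expNeg (ENNReal.ofReal (s * y))` agrees with `exp (-(s * y))` only when `s * y ≥ 0`, so the
  -- conditional law must live on `[0, ∞)`.
  have hnn : ∀ᵐ ω ∂μ, ∀ᵐ y ∂condDistrib I R μ (R ω), 0 ≤ y := by
    refine ae_of_ae_map hR.aemeasurable (p := fun a => ∀ᵐ y ∂condDistrib I R μ a, 0 ≤ y) ?_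
    have h2 : ∀ᵐ z ∂(μ.map R ⊗ₘ condDistrib I R μ), 0 ≤ z.2 := by
      rw [compProd_map_condDistrib hI, ae_map_iff (hR.aemeasurable.prodMk hI)
        (measurableSet_le measurable_const measurable_snd)]
      exact hI0
    exact Measure.ae_ae_of_ae_compProd h2
  filter_upwards [hrat, hnn] with ω h1 h2 s hs
  have heq := eq_of_forall_rat_eq (continuous_lintegral_expNeg (condDistrib I R μ (R ω)))
    (hanti (R ω) (hR0 ω)) h1 hs
  rw [← heq, integral_eq_lintegral_of_nonneg_ae (Eventually.of_forall fun y => Real.exp_nonneg _)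
    (by fun_prop)]
  congr 1
  refine lintegral_congr_ae (h2.mono fun y hy => ?_)
  exact (expNeg_ofReal (mul_nonneg hs hy)).symm

end CondLaplace

/-! ### The total echo -/

section Echo

variable {Ω : Type*} {p : Params} {t : Plane} {X : ℕ → Ω → Plane} {M : ℕ → Ω → Mark}

/-- The sum of the echoes as an extended nonnegative real. -/
def totalEcho (p : Params) (t : Plane) (X : ℕ → Ω → Plane) (M : ℕ → Ω → Mark) (D : Set ℝ)
    (ω : Ω) : ℝ≥0∞ := ∑' i, ENNReal.ofReal (echoTerm p t X M D i ω)

lemma echoTerm_nonneg {D : Set ℝ} {ω : Ω} (h : ∀ i, 0 ≤ (M i ω).2.2) (i : ℕ) :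
    0 ≤ echoTerm p t X M D i ω := by
  unfold echoTerm
  split_ifs
  · exact mul_nonneg (h i) (Real.rpow_nonneg dist_nonneg _)
  · exact le_rfl

lemma echoTerm_mono {D D' : Set ℝ} (hD : D ⊆ D') {ω : Ω} (h : ∀ i, 0 ≤ (M i ω).2.2) (i : ℕ) :
    echoTerm p t X M D i ω ≤ echoTerm p t X M D' i ω := by
  by_cases hc : (M i ω).1 = true ∧ (M i ω).2.1 = true ∧ dist (X i ω) t ∈ D
  · rw [echoTerm, echoTerm, if_pos hc, if_pos ⟨hc.1, hc.2.1, hD hc.2.2⟩]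
  · rw [echoTerm, if_neg hc]
    exact echoTerm_nonneg h i

lemma totalEcho_mono {D D' : Set ℝ} (hD : D ⊆ D') {ω : Ω} (h : ∀ i, 0 ≤ (M i ω).2.2) :
    totalEcho p t X M D ω ≤ totalEcho p t X M D' ω :=
  ENNReal.tsum_le_tsum fun i => ENNReal.ofReal_le_ofReal (echoTerm_mono hD h i)

lemma tsum_echoTerm_eq {D : Set ℝ} {ω : Ω} (h : ∀ i, 0 ≤ (M i ω).2.2) :
    ∑' i, echoTerm p t X M D i ω = (totalEcho p t X M D ω).toReal := by
  rw [totalEcho, ENNReal.tsum_toReal_eq fun _ => ENNReal.ofReal_ne_top]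
  exact tsum_congr fun i => (ENNReal.toReal_ofReal (echoTerm_nonneg h i)).symm

lemma reflectedPower_eq {D : Set ℝ} {ω : Ω} (h : ∀ i, 0 ≤ (M i ω).2.2) (r₁ : ℝ) :
    reflectedPower p t X M r₁ D ω = echoGain p r₁ * (totalEcho p t X M D ω).toReal := by
  rw [reflectedPower, tsum_echoTerm_eq h, echoGain]

lemma reflectedPower_nonneg {D : Set ℝ} {ω : Ω} (h : ∀ i, 0 ≤ (M i ω).2.2) {r₁ : ℝ}
    (hr : 0 ≤ r₁) : 0 ≤ reflectedPower p t X M r₁ D ω := by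
  rw [reflectedPower_eq h]
  exact mul_nonneg (echoGain_nonneg p hr) ENNReal.toReal_nonneg

/-- Finiteness is essential: a divergent real sum is `0` by convention, which would give the value
`1` instead of `exp (-∞) = 0`. -/
lemma expNeg_reflectedPower {D : Set ℝ} {ω : Ω} (h : ∀ i, 0 ≤ (M i ω).2.2)
    (hfin : totalEcho p t X M D ω ≠ ∞) {r₁ s : ℝ} (hr : 0 ≤ r₁) (hs : 0 ≤ s) :
    expNeg (ENNReal.ofReal (s * reflectedPower p t X M r₁ D ω)) =
      expNeg (ENNReal.ofReal (s * echoGain p r₁) * totalEcho p t X M D ω) := by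
  rw [reflectedPower_eq h, ← mul_assoc, ENNReal.ofReal_mul (mul_nonneg hs (echoGain_nonneg p hr)),
    ENNReal.ofReal_toReal hfin]

lemma measurable_echo {α : Type*} [MeasurableSpace α] {D : α → Set ℝ}
    (hD : MeasurableSet {z : α × ℝ | z.2 ∈ D z.1}) {x : α → Plane} (hx : Measurable x)
    {m : α → Mark} (hm : Measurable m) : Measurable fun a => echo p t (D a) (x a) (m a) := by
  unfold echo
  refine Measurable.ite ?_ ?_ measurable_const
  · have h1 : MeasurableSet {a | (m a).1 = true} :=
      (measurable_fst.comp hm) (measurableSet_singleton true)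
    have h2 : MeasurableSet {a | (m a).2.1 = true} :=
      (measurable_fst.comp (measurable_snd.comp hm)) (measurableSet_singleton true)
    have hd : Measurable fun a => (a, dist (x a) t) := measurable_id.prodMk (by fun_prop)
    have h3 : MeasurableSet {a | dist (x a) t ∈ D a} := hd hD
    exact h1.inter (h2.inter h3)
  · fun_prop

lemma summable_echoTerm {D : Set ℝ} {ω : Ω} (h : ∀ i, 0 ≤ (M i ω).2.2)
    (hfin : totalEcho p t X M D ω ≠ ∞) : Summable fun i => echoTerm p t X M D i ω := by
  refine (ENNReal.summable_toReal hfin).congr fun i => ?_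
  exact ENNReal.toReal_ofReal (echoTerm_nonneg h i)

variable [MeasurableSpace Ω] {μ : Measure Ω}

lemma measurable_totalEcho (hX : ∀ i, Measurable (X i)) (hM : ∀ i, Measurable (M i))
    {D : Ω → Set ℝ} (hD : MeasurableSet {z : Ω × ℝ | z.2 ∈ D z.1}) :
    Measurable fun ω => totalEcho p t X M (D ω) ω :=
  Measurable.tsum fun i => ENNReal.measurable_ofReal.comp (measurable_echo hD (hX i) (hM i))

variable [IsProbabilityMeasure μ]

lemma IsIndependentMarking.ae_nonneg (hM : IsIndependentMarking μ X (markLaw p t) M) :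
    ∀ᵐ ω ∂μ, ∀ i, 0 ≤ (M i ω).2.2 := by
  refine ae_all_iff.2 fun i => ?_
  have hm : MeasurableSet {m : Mark | 0 ≤ m.2.2} := measurableSet_le measurable_const (by fun_prop)
  have h := hM.joint_law univ MeasurableSet.univ {i} (fun _ => {m : Mark | 0 ≤ m.2.2}) fun _ => hm
  have h1 : ∀ x, markLaw p t x {m : Mark | 0 ≤ m.2.2} = 1 := fun x =>
    (prob_compl_eq_zero_iff hm).1 (markLaw_ae_nonneg t x)
  have h2 : μ {ω | 0 ≤ (M i ω).2.2} = 1 := by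
    simpa [h1] using h
  exact (prob_compl_eq_zero_iff (hM.measurable i hm)).2 h2

/-- The gain `c` and the range `D` may depend on all points, so that `R₁` and the exclusion radius
can be inserted. -/
lemma IsIndependentMarking.lintegral_mul_expNeg_totalEcho (hX : ∀ i, Measurable (X i))
    (hM : IsIndependentMarking μ X (markLaw p t) M) {F : (ℕ → Plane) → ℝ≥0∞} (hF : Measurable F)
    (hF1 : ∀ x, F x ≤ 1) {c : (ℕ → Plane) → ℝ} (hc : Measurable c) (hc0 : ∀ x, 0 ≤ c x)
    {D : (ℕ → Plane) → Set ℝ} (hD : MeasurableSet {z : (ℕ → Plane) × ℝ | z.2 ∈ D z.1}) :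
    ∫⁻ ω, F (fun j => X j ω) * expNeg (ENNReal.ofReal (c fun j => X j ω) *
        totalEcho p t X M (D fun j => X j ω) ω) ∂μ =
      ∫⁻ ω, F (fun j => X j ω) * expNeg (pointSum X (fun x =>
        (D fun j => X j ω).indicator (markCost p (c fun j => X j ω)) (dist x t)) ω) ∂μ := by
  have hM' : IsIndependentMarking μ X (markLawKernel p t) M := hM
  have key := hM'.lintegral_mul_expNeg_tsum hX hF hF1
    (a := fun i x m => ENNReal.ofReal (c x) * ENNReal.ofReal (echo p t (D x) (x i) m))
    (h := fun i x => (D x).indicator (markCost p (c x)) (dist (x i) t)) ?_ ?_ ?_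
  · simp_rw [ENNReal.tsum_mul_left] at key
    exact key
  · intro i
    have hD' : MeasurableSet {z : ((ℕ → Plane) × Mark) × ℝ | z.2 ∈ D z.1.1} := by
      have : Measurable fun z : ((ℕ → Plane) × Mark) × ℝ => (z.1.1, z.2) := by fun_prop
      exact this hD
    refine (ENNReal.measurable_ofReal.comp (hc.comp measurable_fst)).mul
      (ENNReal.measurable_ofReal.comp ?_)
    exact measurable_echo (D := fun z : (ℕ → Plane) × Mark => D z.1) hD'
      ((measurable_pi_apply i).comp measurable_fst) measurable_snd
  · intro i
    have hd : Measurable fun x : ℕ → Plane => dist (x i) t := by fun_prop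
    have hmc : Measurable fun x : ℕ → Plane => markCost p (c x) (dist (x i) t) :=
      (measurable_markCost p).comp (g := fun z : ℝ × ℝ => markCost p z.1 z.2)
        (f := fun x : ℕ → Plane => (c x, dist (x i) t)) (hc.prodMk hd)
    have hpair : Measurable fun x : ℕ → Plane => (x, dist (x i) t) := measurable_id.prodMk hd
    have hDs : MeasurableSet {x : ℕ → Plane | dist (x i) t ∈ D x} := hpair hD
    convert hmc.indicator hDs using 2 with x
    by_cases hx : dist (x i) t ∈ D x
    · rw [indicator_of_mem hx, indicator_of_mem (by exact hx)]
    · rw [indicator_of_notMem hx, indicator_of_notMem (by exact hx)]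
  · intro i x
    exact lintegral_markLaw_expNeg_echo t (x i) (D x) (hc0 x)

lemma lintegral_expNeg_totalEcho
    (hX : IsPoissonPointProcess μ (ENNReal.ofReal p.lamBS • volume) X)
    (hM : IsIndependentMarking μ X (markLaw p t) M) {c : ℝ} (hc : 0 ≤ c) {D : Set ℝ}
    (hD : MeasurableSet D) :
    ∫⁻ ω, expNeg (ENNReal.ofReal c * totalEcho p t X M D ω) ∂μ =
      expNeg (∫⁻ x, (1 - expNeg (D.indicator (markCost p c) (dist x t)))
        ∂(ENNReal.ofReal p.lamBS • volume : Measure Plane)) := by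
  have h := hM.lintegral_mul_expNeg_totalEcho hX.measurable (F := fun _ => 1) measurable_const
    (fun _ => le_rfl) (c := fun _ => c) measurable_const (fun _ => hc) (D := fun _ => D)
    (measurable_snd hD)
  simp only [one_mul] at h
  rw [h]
  refine hX.lintegral_expNeg_pointSum (f := fun x => D.indicator (markCost p c) (dist x t)) ?_
  have hm : Measurable (D.indicator (markCost p c)) :=
    ((measurable_markCost p).comp measurable_prodMk_left).indicator hD
  exact hm.comp (by fun_prop)

lemma one_sub_one_div_le {x : ℝ} (hx : 0 ≤ x) : 1 - 1 / (1 + x) ≤ x := by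
  rw [sub_le_iff_le_add, ← sub_le_iff_le_add', le_div_iff₀ (by positivity)]
  nlinarith

/-- Linear in `c`, by `1 - 1 / (1 + x) ≤ x` and `r^(-α) ≤ ρ^(-α)`; thus the exponent of the Laplace
transform vanishes as `c` tends to `0`. -/
lemma setIntegral_markLoss_le {ρ : ℝ} (hρ : 0 < ρ) {c : ℝ} (hc : 0 ≤ c) :
    p.lamBS * (2 * Real.pi * ∫ r in Ioi ρ, markLoss p c r * r) ≤
      c * (p.lamBS * (2 * Real.pi *
        (ρ ^ (-p.alphaL) * p.sigmaAv * ∫ r in Ioi ρ, losProb p r * r))) := by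
  have hσ := p.sigmaAv_pos
  have hlam := p.lamBS_pos
  have hle : ∫ r in Ioi ρ, markLoss p c r * r ≤
      ∫ r in Ioi ρ, (c * ρ ^ (-p.alphaL) * p.sigmaAv) * (losProb p r * r) := by
    refine setIntegral_mono_on
      ((integrableOn_markLoss_mul hc).mono_set (Ioi_subset_Ioi hρ.le))
      (((integrableOn_mul_losProb p).mono_set (Ioi_subset_Ioi hρ.le)).const_mul _)
      measurableSet_Ioi fun r (hr : ρ < r) => ?_
    have hr0 : 0 < r := hρ.trans hr
    have h1 : r ^ (-p.alphaL) ≤ ρ ^ (-p.alphaL) :=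
      Real.rpow_le_rpow_of_nonpos hρ hr.le (by linarith [p.alphaL_pos])
    have hb := beamProb_pos p
    have hb1 := beamProb_le_one p
    have hl := losProb_pos p r
    have h2 := one_sub_one_div_le (markArg_nonneg (p := p) hc hr0.le)
    have h3 : 0 ≤ r ^ (-p.alphaL) := Real.rpow_nonneg hr0.le _
    rw [← mul_assoc]
    refine mul_le_mul_of_nonneg_right ?_ hr0.le
    calc markLoss p c r ≤ beamProb p * losProb p r * (c * r ^ (-p.alphaL) * p.sigmaAv) := by
          unfold markLoss
          gcongr
      _ ≤ 1 * losProb p r * (c * ρ ^ (-p.alphaL) * p.sigmaAv) := by gcongr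
      _ = _ := by ring
  rw [integral_const_mul] at hle
  calc _ ≤ p.lamBS * (2 * Real.pi * ((c * ρ ^ (-p.alphaL) * p.sigmaAv) *
        ∫ r in Ioi ρ, losProb p r * r)) := by gcongr
    _ = _ := by ring

/-- For every `c > 0` the expectation of `exp (-cT)` is at most the probability that `T` is finite.
It is also at least `exp (-cC)`, which tends to `1` as `c` decreases to `0`. -/
lemma ae_totalEcho_Ici_ne_top_of_pos
    (hX : IsPoissonPointProcess μ (ENNReal.ofReal p.lamBS • volume) X)
    (hM : IsIndependentMarking μ X (markLaw p t) M) {ρ : ℝ} (hρ : 0 < ρ) :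
    ∀ᵐ ω ∂μ, totalEcho p t X M (Ici ρ) ω ≠ ∞ := by
  set C : ℝ := p.lamBS * (2 * Real.pi *
        (ρ ^ (-p.alphaL) * p.sigmaAv * ∫ r in Ioi ρ, losProb p r * r)) with hC
  have hTm : Measurable fun ω => totalEcho p t X M (Ici ρ) ω :=
    measurable_totalEcho hX.measurable hM.measurable (D := fun _ => Ici ρ)
      (measurable_snd measurableSet_Ici)
  set S : Set Ω := {ω | totalEcho p t X M (Ici ρ) ω ≠ ∞} with hS
  have hSm : MeasurableSet S := (hTm (measurableSet_singleton ∞)).compl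
  have hbound : ∀ c : ℝ, 0 < c → ENNReal.ofReal (Real.exp (-(c * C))) ≤ μ S := by
    intro c hc
    have h1 := lintegral_expNeg_totalEcho hX hM hc.le (measurableSet_Ici (a := ρ))
    have hset : Ioi 0 ∩ Ici ρ = Ici ρ := inter_eq_right.2 fun r hr => hρ.trans_le hr
    rw [lintegral_one_sub_expNeg_markCost t hc.le measurableSet_Ici, hset,
      integral_Ici_eq_integral_Ioi, expNeg_ofReal (integral_markLoss_nonneg hc.le hρ.le)] at h1
    calc ENNReal.ofReal (Real.exp (-(c * C)))
        ≤ ENNReal.ofReal (Real.exp (-(p.lamBS *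
            (2 * Real.pi * ∫ r in Ioi ρ, markLoss p c r * r)))) := by
          refine ENNReal.ofReal_le_ofReal (Real.exp_le_exp.2 (neg_le_neg ?_))
          exact setIntegral_markLoss_le hρ hc.le
      _ = ∫⁻ ω, expNeg (ENNReal.ofReal c * totalEcho p t X M (Ici ρ) ω) ∂μ := h1.symm
      _ ≤ ∫⁻ ω, S.indicator 1 ω ∂μ := by
          refine lintegral_mono fun ω => ?_
          by_cases hω : ω ∈ S
          · simpa [hω] using expNeg_le_one _
          · have : totalEcho p t X M (Ici ρ) ω = ∞ := not_not.1 hω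
            simp [this, ENNReal.mul_top (ENNReal.ofReal_pos.2 hc).ne']
      _ = μ S := lintegral_indicator_one hSm
  have hlim : Tendsto (fun c : ℝ => ENNReal.ofReal (Real.exp (-(c * C)))) (𝓝[>] 0) (𝓝 1) := by
    have : Continuous fun c : ℝ => ENNReal.ofReal (Real.exp (-(c * C))) :=
      ENNReal.continuous_ofReal.comp (by fun_prop)
    have h2 := this.tendsto 0
    simp only [zero_mul, neg_zero, Real.exp_zero, ENNReal.ofReal_one] at h2
    exact h2.mono_left nhdsWithin_le_nhds
  have h1 : μ S = 1 := le_antisymm prob_le_one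
    (le_of_tendsto hlim (eventually_nhdsWithin_of_forall fun c hc => hbound c hc))
  exact (prob_compl_eq_zero_iff hSm).2 h1

/-- The radii `1 / (k + 1)` suffice, because the echo decreases in `ρ`; so one null set serves all
`ρ`. -/
lemma ae_totalEcho_Ici_ne_top
    (hX : IsPoissonPointProcess μ (ENNReal.ofReal p.lamBS • volume) X)
    (hM : IsIndependentMarking μ X (markLaw p t) M) :
    ∀ᵐ ω ∂μ, ∀ ρ : ℝ, 0 < ρ → totalEcho p t X M (Ici ρ) ω ≠ ∞ := by
  have h : ∀ᵐ ω ∂μ, ∀ k : ℕ, totalEcho p t X M (Ici (1 / ((k : ℝ) + 1))) ω ≠ ∞ :=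
    ae_all_iff.2 fun k => ae_totalEcho_Ici_ne_top_of_pos hX hM (by positivity)
  filter_upwards [h, hM.ae_nonneg] with ω h1 h2 ρ hρ
  obtain ⟨k, hk⟩ := exists_nat_one_div_lt hρ
  exact ne_top_of_le_ne_top (h1 k) (totalEcho_mono (Ici_subset_Ici.2 hk.le) h2)

end Echo

end ISAC

end

noncomputable section

namespace ISAC

open Filter Topology
open scoped ENNReal NNReal

/-! ### The interference outside the exclusion disc -/

section Interference

variable {Ω : Type*} {p : Params} {t : Plane} {X : ℕ → Ω → Plane} {M : ℕ → Ω → Mark}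

lemma measurableSet_setOf_mem_comp {α : Type*} [MeasurableSpace α] {D : ℝ → Set ℝ}
    (hD : MeasurableSet {z : ℝ × ℝ | z.2 ∈ D z.1}) {R : α → ℝ} (hR : Measurable R) :
    MeasurableSet {z : α × ℝ | z.2 ∈ D (R z.1)} := by
  have : Measurable fun z : α × ℝ => (R z.1, z.2) :=
    (hR.comp measurable_fst).prodMk measurable_snd
  exact this hD

/-- Without ties exactly one point lies on the rim, and its cost splits off as a separate factor. -/
lemma expNeg_pointSum_Ici (h : ℝ → ℝ → ℝ≥0∞) {n : ℕ} (hn : 1 ≤ n) {ω : Ω}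
    (hω : IsGeneric X t ω) (a : ℝ) :
    expNeg (pointSum X (fun x => (Ici (nthDist X t n ω)).indicator (h a) (dist x t)) ω) =
      expNeg (h a (nthDist X t n ω)) *
        expNeg (pointSum X (radialTail t h a (nthDist X t n ω)) ω) := by
  obtain ⟨i, hi⟩ := hω.exists_dist_eq_nthDist hn
  rw [← expNeg_add, pointSum, pointSum, ← tsum_ite_eq i fun _ => h a (nthDist X t n ω),
    ← ENNReal.tsum_add]
  congr 1
  refine tsum_congr fun j => ?_
  by_cases hj : j = i
  · subst hj
    simp [radialTail, hi]
  · have hne : dist (X j ω) t ≠ nthDist X t n ω := fun h' =>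
      hj (hω.injective (h'.trans hi.symm))
    rw [if_neg hj, zero_add, radialTail]
    by_cases hlt : nthDist X t n ω < dist (X j ω) t
    · rw [indicator_of_mem (mem_Ici.2 hlt.le), indicator_of_mem (mem_Ioi.2 hlt)]
    · have hle : dist (X j ω) t ∉ Ici (nthDist X t n ω) := fun hm =>
        hlt (lt_of_le_of_ne hm hne.symm)
      rw [indicator_of_notMem hle, indicator_of_notMem (by exact hlt)]

lemma radiusKernel_ae_le (n : ℕ) {a : ℝ} (ha : 0 ≤ a) : ∀ᵐ ρ ∂radiusKernel p n a, a ≤ ρ := by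
  have hdm : Measurable fun ρ => ENNReal.ofReal (condDensity p n a ρ) :=
    ENNReal.measurable_ofReal.comp ((measurable_condDensity p n).comp measurable_prodMk_left)
  rw [radiusKernel_eq p n ha, ae_withDensity_iff hdm]
  refine Eventually.of_forall fun ρ h => ?_
  by_contra hlt
  exact h (by rw [condDensity, if_neg hlt, ENNReal.ofReal_zero])

variable [MeasurableSpace Ω] {μ : Measure Ω} [IsProbabilityMeasure μ]

/-- Almost surely all cross sections are nonnegative, and then the real sum coincides with a
measurable `[0, ∞]`-valued one. -/
lemma aemeasurable_reflectedPower (hX : ∀ i, Measurable (X i))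
    (hM : IsIndependentMarking μ X (markLaw p t) M) {D : ℝ → Set ℝ}
    (hD : MeasurableSet {z : ℝ × ℝ | z.2 ∈ D z.1}) {R₁ R : Ω → ℝ} (hR₁ : Measurable R₁)
    (hR : Measurable R) :
    AEMeasurable (fun ω => reflectedPower p t X M (R₁ ω) (D (R ω)) ω) μ := by
  have hm : Measurable fun ω => echoGain p (R₁ ω) * (totalEcho p t X M (D (R ω)) ω).toReal :=
    ((measurable_echoGain p).comp hR₁).mul (measurable_totalEcho hX hM.measurable
      (D := fun ω => D (R ω)) (measurableSet_setOf_mem_comp hD hR)).ennreal_toReal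
  refine ⟨_, hm, ?_⟩
  filter_upwards [hM.ae_nonneg] with ω hω using reflectedPower_eq hω _

lemma integral_exp_reflectedPower_Ici
    (hX : IsPoissonPointProcess μ (ENNReal.ofReal p.lamBS • volume) X)
    (hM : IsIndependentMarking μ X (markLaw p t) M) {r₁ ρ s : ℝ} (hr₁ : 0 < r₁) (hρ : 0 < ρ)
    (hs : 0 ≤ s) :
    ∫ ω, Real.exp (-(s * reflectedPower p t X M r₁ (Ici ρ) ω)) ∂μ = pgflFactor p r₁ s ρ := by
  have hm : AEMeasurable (fun ω => reflectedPower p t X M r₁ (Ici ρ) ω) μ :=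
    aemeasurable_reflectedPower hX.measurable hM (D := fun _ => Ici ρ)
      (measurable_snd measurableSet_Ici) (R₁ := fun _ => r₁) (R := fun _ => 0) measurable_const
      measurable_const
  have hexp : AEMeasurable (fun ω => Real.exp (-(s * reflectedPower p t X M r₁ (Ici ρ) ω))) μ :=
    Real.measurable_exp.comp_aemeasurable (hm.const_mul s).neg
  rw [integral_eq_lintegral_of_nonneg_ae (Eventually.of_forall fun ω => Real.exp_nonneg _)
    hexp.aestronglyMeasurable]
  have h : ∫⁻ ω, ENNReal.ofReal (Real.exp (-(s * reflectedPower p t X M r₁ (Ici ρ) ω))) ∂μ =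
      ∫⁻ ω, expNeg (ENNReal.ofReal (s * echoGain p r₁) * totalEcho p t X M (Ici ρ) ω) ∂μ := by
    refine lintegral_congr_ae ?_
    filter_upwards [hM.ae_nonneg, ae_totalEcho_Ici_ne_top hX hM] with ω h1 h2
    rw [← expNeg_reflectedPower h1 (h2 ρ hρ) hr₁.le hs,
      expNeg_ofReal (mul_nonneg hs (reflectedPower_nonneg h1 hr₁.le))]
  have h' := expNeg_lintegral_eq_pgflFactor (p := p) t hs hr₁.le hρ.le measurableSet_Ici
    (Ioi_ae_eq_Ici (μ := volume) (a := ρ)).symm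
  rw [h, lintegral_expNeg_totalEcho hX hM (mul_nonneg hs (echoGain_nonneg p hr₁.le))
    measurableSet_Ici]
  exact (congrArg ENNReal.toReal h').trans (ENNReal.toReal_ofReal (pgflFactor_nonneg _ _ _))

/-- The Laplace transform, given `R₁`, of the power reflected from the base stations with distance
in `D R_{n+1}`, where `D ρ` is one of `(ρ, ∞)` and `[ρ, ∞)` and `w` is the factor for a base
station on the rim of the exclusion disc. -/
theorem ae_integral_exp_condDistrib_reflectedPower
    (hX : IsPoissonPointProcess μ (ENNReal.ofReal p.lamBS • volume) X)
    (hM : IsIndependentMarking μ X (markLaw p t) M) {n : ℕ} (hn : 1 ≤ n) {D : ℝ → Set ℝ}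
    (hD : MeasurableSet {z : ℝ × ℝ | z.2 ∈ D z.1}) (hDsub : ∀ ρ, D ρ ⊆ Ici ρ)
    {w : ℝ → ℝ → ℝ → ℝ≥0∞} (hw : ∀ s, Measurable (Function.uncurry (w s)))
    (hw1 : ∀ s a ρ, w s a ρ ≤ 1)
    (hwanti : ∀ a ρ, 0 ≤ a → 0 ≤ ρ → AntitoneOn (fun s => w s a ρ) (Ici 0))
    (hsum : ∀ s ω, IsGeneric X t ω → expNeg (pointSum X (fun x =>
        (D (nthDist X t (n + 1) ω)).indicator (echoCost p s (nthDist X t 1 ω)) (dist x t)) ω) =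
      w s (nthDist X t 1 ω) (nthDist X t (n + 1) ω) * expNeg (pointSum X
        (radialTail t (echoCost p s) (nthDist X t 1 ω) (nthDist X t (n + 1) ω)) ω)) :
    ∀ᵐ ω ∂μ, ∀ s : ℝ, 0 ≤ s →
      ∫ y, Real.exp (-(s * y)) ∂(condDistrib (fun ω => reflectedPower p t X M (nthDist X t 1 ω)
          (D (nthDist X t (n + 1) ω)) ω) (nthDist X t 1) μ (nthDist X t 1 ω)) =
        (∫⁻ ρ, w s (nthDist X t 1 ω) ρ *
          expNeg (tailExponent p.lamBS t (echoCost p s) (nthDist X t 1 ω) ρ)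
            ∂radiusKernel p n (nthDist X t 1 ω)).toReal := by
  have hR₁ := measurable_nthDist hX.measurable t 1
  have hR := measurable_nthDist hX.measurable t (n + 1)
  have hker := isMarkovKernel_radiusKernel p hn
  have hT : ∀ s, Measurable fun z : ℝ × ℝ =>
      expNeg (tailExponent p.lamBS t (echoCost p s) z.1 z.2) := fun s =>
    measurable_expNeg.comp (measurable_tailExponent p.lamBS (measurable_echoCost p s))
  have hwT : ∀ s, Measurable fun z : ℝ × ℝ =>
      w s z.1 z.2 * expNeg (tailExponent p.lamBS t (echoCost p s) z.1 z.2) := fun s =>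
    (hw s).mul (hT s)
  refine ae_integral_exp_condDistrib (J := fun s a => ∫⁻ ρ, w s a ρ *
      expNeg (tailExponent p.lamBS t (echoCost p s) a ρ) ∂radiusKernel p n a) hR₁
    (nthDist_nonneg X t 1) (aemeasurable_reflectedPower hX.measurable hM hD hR₁ hR) ?_
    (fun s _ => (hwT s).lintegral_kernel_prod_right') ?_ ?_
  · filter_upwards [hM.ae_nonneg] with ω hω using
      reflectedPower_nonneg hω (nthDist_nonneg X t 1 ω)
  · intro a ha s hs s' hs' hss
    -- `hwanti` is available for `ρ ≥ 0` only; the kernel at `a ≥ 0` lives on `ρ ≥ a`.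
    refine lintegral_mono_ae ((radiusKernel_ae_le n ha).mono fun ρ hρ => ?_)
    exact mul_le_mul' (hwanti a ρ ha (ha.trans hρ) hs hs' hss)
      (antitone_expNeg (tailExponent_mono t hs hss ha ρ))
  · intro s hs A hA
    have hAm : Measurable (A.indicator (1 : ℝ → ℝ≥0∞)) := measurable_one.indicator hA
    have hA1 : ∀ a, A.indicator (1 : ℝ → ℝ≥0∞) a ≤ 1 := fun a =>
      indicator_le_self' (fun _ _ => zero_le_one) a
    -- The distances are viewed as functions on the space of configurations, through the coordinate
    -- process, so that they may enter `F`, `c` and `D` when the marks are integrated out.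
    have hev : ∀ i, Measurable fun x : ℕ → Plane => x i := fun i => measurable_pi_apply i
    have hE₁ := measurable_nthDist hev t 1
    have hE := measurable_nthDist hev t (n + 1)
    have hmark := hM.lintegral_mul_expNeg_totalEcho hX.measurable
      (F := fun x => A.indicator 1 (nthDist (fun i (x : ℕ → Plane) => x i) t 1 x))
      (hAm.comp hE₁) (fun x => hA1 _)
      (c := fun x => s * echoGain p (nthDist (fun i (x : ℕ → Plane) => x i) t 1 x))
      (((measurable_echoGain p).comp hE₁).const_mul s)
      (fun x => mul_nonneg hs (echoGain_nonneg p (nthDist_nonneg _ _ _ _)))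
      (D := fun x => D (nthDist (fun i (x : ℕ → Plane) => x i) t (n + 1) x))
      (measurableSet_setOf_mem_comp hD hE)
    -- The rim factor depends on the two distances only, so it is absorbed into the test function
    -- `φ`.
    have htail := hX.lintegral_radialTail_nthDist (t := t) p.lamBS_pos
      (show 2 ≤ n + 1 by omega) (measurable_echoCost p s)
      (fun d hd => antitoneOn_echoCost hs hd) (fun d r hd hr => tendsto_echoCost hs hd hr)
      (φ := fun z => A.indicator 1 z.1 * w s z.1 z.2)
      ((hAm.comp measurable_fst).mul (hw s)) (fun z => mul_le_one' (hA1 _) (hw1 _ _ _))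
    have hG : Measurable fun z : ℝ × ℝ => A.indicator 1 z.1 *
        (w s z.1 z.2 * expNeg (tailExponent p.lamBS t (echoCost p s) z.1 z.2)) :=
      (hAm.comp measurable_fst).mul (hwT s)
    have hpos := hX.ae_isGeneric p.lamBS_pos t
    calc ∫⁻ ω, A.indicator 1 (nthDist X t 1 ω) * expNeg (ENNReal.ofReal (s *
          reflectedPower p t X M (nthDist X t 1 ω) (D (nthDist X t (n + 1) ω)) ω)) ∂μ
        = ∫⁻ ω, A.indicator 1 (nthDist X t 1 ω) *
            expNeg (ENNReal.ofReal (s * echoGain p (nthDist X t 1 ω)) *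
              totalEcho p t X M (D (nthDist X t (n + 1) ω)) ω) ∂μ := by
          refine lintegral_congr_ae ?_
          filter_upwards [hM.ae_nonneg, ae_totalEcho_Ici_ne_top hX hM, hpos] with ω h1 h2 h3
          have hfin := ne_top_of_le_ne_top (h2 _ (h3.nthDist_pos (Nat.le_add_left 1 n)))
            (totalEcho_mono (p := p) (t := t) (X := X) (hDsub _) h1)
          rw [expNeg_reflectedPower h1 hfin (nthDist_nonneg X t 1 ω) hs]
      _ = ∫⁻ ω, A.indicator 1 (nthDist X t 1 ω) * expNeg (pointSum X (fun x =>
            (D (nthDist X t (n + 1) ω)).indicator (echoCost p s (nthDist X t 1 ω))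
              (dist x t)) ω) ∂μ := hmark
      _ = ∫⁻ ω, A.indicator 1 (nthDist X t 1 ω) *
            w s (nthDist X t 1 ω) (nthDist X t (n + 1) ω) * expNeg (pointSum X
              (radialTail t (echoCost p s) (nthDist X t 1 ω) (nthDist X t (n + 1) ω)) ω) ∂μ := by
          refine lintegral_congr_ae ?_
          filter_upwards [hpos] with ω hω
          rw [hsum s ω hω, mul_assoc]
      _ = ∫⁻ ω, A.indicator 1 (nthDist X t 1 ω) *
            w s (nthDist X t 1 ω) (nthDist X t (n + 1) ω) *
            expNeg (tailExponent p.lamBS t (echoCost p s) (nthDist X t 1 ω)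
              (nthDist X t (n + 1) ω)) ∂μ := htail
      _ = ∫⁻ z, A.indicator 1 z.1 * (w s z.1 z.2 *
            expNeg (tailExponent p.lamBS t (echoCost p s) z.1 z.2))
              ∂μ.map (fun ω => (nthDist X t 1 ω, nthDist X t (n + 1) ω)) := by
          rw [lintegral_map hG (hR₁.prodMk hR)]
          exact lintegral_congr fun ω => mul_assoc _ _ _
      _ = _ := by
          have : IsProbabilityMeasure (μ.map (nthDist X t 1)) :=
            Measure.isProbabilityMeasure_map hR₁.aemeasurable
          rw [hX.map_nthDist_one t hn, Measure.lintegral_compProd hG,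
            lintegral_map hG.lintegral_kernel_prod_right' hR₁]
          exact lintegral_congr fun ω => lintegral_const_mul (A.indicator 1 (nthDist X t 1 ω))
            (f := fun ρ => w s (nthDist X t 1 ω) ρ *
              expNeg (tailExponent p.lamBS t (echoCost p s) (nthDist X t 1 ω) ρ))
            ((hwT s).comp measurable_prodMk_left)

end Interference

end ISAC

end

/-! ### Assembly of the lemma. -/

open ISAC in
theorem lemma2 {Ω : Type*} [MeasurableSpace Ω] (μ : Measure Ω) [IsProbabilityMeasure μ]
    (p : Params) (t : Plane) (Nc : ℕ) (hNc : 1 ≤ Nc)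
    (X : ℕ → Ω → Plane) (M : ℕ → Ω → Mark)
    (hX : IsPoissonPointProcess μ (ENNReal.ofReal p.lamBS • volume) X)
    (hM : IsIndependentMarking μ X (markLaw p t) M) :
    -- the random variables are well defined
    (AEMeasurable (nthDist X t 1) μ ∧ AEMeasurable (nthDist X t (Nc + 1)) μ ∧
      AEMeasurable (interferenceExterior p t Nc X M) μ ∧
      AEMeasurable (interferenceWithRim p t Nc X M) μ ∧
      ∀ᵐ ω ∂μ, 0 < nthDist X t 1 ω ∧ nthDist X t 1 ω < nthDist X t (Nc + 1) ω ∧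
        ∀ ρ : ℝ, 0 < ρ → Summable (fun i => echoTerm p t X M (Ici ρ) i ω)) ∧
    -- the conditional density of the exclusion radius
    (∀ᵐ ω ∂μ, condDistrib (nthDist X t (Nc + 1)) (nthDist X t 1) μ (nthDist X t 1 ω) =
      volume.withDensity (fun ρ => ENNReal.ofReal (condDensity p Nc (nthDist X t 1 ω) ρ))) ∧
    -- the generating functional over the distances `r ≥ ρ`
    (∀ r₁ ρ s : ℝ, 0 < r₁ → 0 < ρ → 0 ≤ s →
      ∫ ω, Real.exp (-(s * reflectedPower p t X M r₁ (Ici ρ) ω)) ∂μ = pgflFactor p r₁ s ρ) ∧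
    -- the Laplace transform given `R_1`, with the interferers outside the exclusion disc
    (∀ᵐ ω ∂μ, ∀ s : ℝ, 0 ≤ s →
      ∫ y, Real.exp (-(s * y))
          ∂(condDistrib (interferenceExterior p t Nc X M) (nthDist X t 1) μ (nthDist X t 1 ω)) =
        explicitLT p Nc (nthDist X t 1 ω) s) ∧
    -- the same, with the base station on the rim of the exclusion disc as an interferer
    (∀ᵐ ω ∂μ, ∀ s : ℝ, 0 ≤ s →
      ∫ y, Real.exp (-(s * y))
          ∂(condDistrib (interferenceWithRim p t Nc X M) (nthDist X t 1) μ (nthDist X t 1 ω)) =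
        explicitLTWithRim p Nc (nthDist X t 1 ω) s) := by
  have hR₁ := measurable_nthDist hX.measurable t 1
  have hR := measurable_nthDist hX.measurable t (Nc + 1)
  have hIoi : MeasurableSet {z : ℝ × ℝ | z.2 ∈ Ioi z.1} :=
    measurableSet_lt measurable_fst measurable_snd
  have hIci : MeasurableSet {z : ℝ × ℝ | z.2 ∈ Ici z.1} :=
    measurableSet_le measurable_fst measurable_snd
  refine ⟨⟨hR₁.aemeasurable, hR.aemeasurable,
    aemeasurable_reflectedPower hX.measurable hM (D := Ioi) hIoi hR₁ hR,
    aemeasurable_reflectedPower hX.measurable hM (D := Ici) hIci hR₁ hR, ?_⟩, ?_,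
    fun r₁ ρ s hr₁ hρ hs => integral_exp_reflectedPower_Ici hX hM hr₁ hρ hs, ?_, ?_⟩
  · filter_upwards [hX.ae_isGeneric p.lamBS_pos t, hM.ae_nonneg, ae_totalEcho_Ici_ne_top hX hM]
      with ω h1 h2 h3
    exact ⟨h1.nthDist_pos le_rfl, h1.nthDist_one_lt (by omega),
      fun ρ hρ => summable_echoTerm h2 (h3 ρ hρ)⟩
  · have hker := isMarkovKernel_radiusKernel p hNc
    have h := condDistrib_ae_eq_of_measure_eq_compProd (nthDist X t 1) hR.aemeasurable
      (hX.map_nthDist_one t hNc)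
    filter_upwards [ae_of_ae_map hR₁.aemeasurable h] with ω hω
    rw [hω, radiusKernel_eq p Nc (nthDist_nonneg X t 1 ω)]
  -- The open exterior excludes the rim point, so the rim factor is `1`.
  · have h := ae_integral_exp_condDistrib_reflectedPower hX hM hNc (D := Ioi) hIoi
      (fun ρ => Ioi_subset_Ici_self) (w := fun _ _ _ => 1) (fun s => measurable_const)
      (fun _ _ _ => le_rfl) (fun _ _ _ _ => antitoneOn_const)
      (fun s ω _ => (one_mul _).symm)
    filter_upwards [h] with ω hω s hs
    have hω' := hω s hs
    have h0 := nthDist_nonneg X t 1 ω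
    simp only [one_mul] at hω'
    rw [lintegral_radiusKernel_explicitLT t hNc h0 hs,
      ENNReal.toReal_ofReal (explicitLT_nonneg Nc h0 s)] at hω'
    exact hω'
  -- The rim factor is the Laplace transform of a single station's echo at distance `ρ`, averaged
  -- over its marks.
  · have h := ae_integral_exp_condDistrib_reflectedPower hX hM hNc (D := Ici) hIci
      (fun ρ => subset_rfl) (w := fun s a ρ => expNeg (echoCost p s a ρ))
      (fun s => measurable_expNeg.comp (measurable_echoCost p s))
      (fun _ _ _ => expNeg_le_one _)
      (fun a ρ ha hρ s hs s' _ hss => antitone_expNeg (echoCost_mono hs hss ha hρ))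
      (fun s ω hω => expNeg_pointSum_Ici (echoCost p s) (Nat.le_add_left 1 Nc) hω _)
    filter_upwards [h] with ω hω s hs
    have hω' := hω s hs
    have h0 := nthDist_nonneg X t 1 ω
    rw [lintegral_radiusKernel_explicitLTWithRim t hNc h0 hs,
      ENNReal.toReal_ofReal (explicitLTWithRim_nonneg Nc h0 hs)] at hω'
    exact hω'
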